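/- Let $n$ be a natural number, let $\Bbbk$ be a field (of any characteristic), and let $(V,c)$ be an $n$-dimensional braided vector space of diagonal type over $\Bbbk$: $V$ has a basis $x_1,\dots,x_n$ and there is a matrix $\mathbf q=(q_{ij})\in(\Bbbk^\times)^{n\times n}$ such that $c(x_i\otimes x_j)=q_{ij}\,x_j\otimes x_i$ for all $i,j$. View the tensor algebra $T(V)$ as a braided bialgebra, with the coproduct $\Delta:T(V)\to T(V)\otimes T(V)$ which is the algebra map given by $v\mapsto v\otimes 1+1\otimes v$ for $v\in V$, where $T(V)\otimes T(V)$ carries the braided product $(a\otimes b)(a'\otimes b')=a\,c(b\otimes a')\,b'$. Let $\mathcal I(V)$ be the sum of all homogeneous two-sided ideals $I\subseteq\bigoplus_{k\ge 2}V^{\otimes k}$ of $T(V)$ with $\Delta(I)\subseteq I\otimes T(V)+T(V)\otimes I$, and let $\mathcal B(V)=T(V)/\mathcal I(V)$ be the Nichols algebra of $V$. For a ring element $q$ and $m\in\mathbb N_0$ put $(m)_q=1+q+\cdots+q^{m-1}$. Let $e_1,\dots,e_n$ be the standard basis vectors of $\mathbb N_0^n$ and $|m|=m_1+\cdots+m_n$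 for $m=(m_1,\dots,m_n)\in\mathbb N_0^n$. For $m\in\mathbb N_0^n$ with $|m|\ge 2$ define $P_m\in\mathbb Z[p_{ij}\mid 1\le i,j\le n]$ as follows, where $i\neq j$ in (2)–(7): 1. if $m=m_ie_i$, then $P_m=(m_i)_{p_{ii}}$; 2. if $m=e_i+m_je_j$ with $m_j\ge1$, then $P_m=1-p_{jj}^{m_j-1}p_{ij}p_{ji}$; 3. if $m=2e_i+m_je_j$ with $m_j\ge 1$, then $P_m=1+p_{jj}^{m_j(m_j-1)/2}(-p_{ij}p_{ji})^{m_j}p_{ii}$; 4. if $m=3e_i+3e_j$, then $P_m=(3)_{p_{ii}^2(p_{ij}p_{ji})^3p_{jj}^2}$; 5. if $m=3e_i+4e_j$, then $P_m=\bigl(1-p_{ii}^2(p_{ij}p_{ji})^4p_{jj}^4\bigr)\,(3)_{p_{ii}(p_{ij}p_{ji})^2p_{jj}^2}$; 6. if $m=3e_i+6e_j$, then $P_m=\bigl(1-p_{ii}(p_{ij}p_{ji})^3p_{jj}^5\bigr)\,(3)_{p_{ii}^2(p_{ij}p_{ji})^6p_{jj}^{10}}$; 7. if $m=4e_i+4e_j$,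 then $P_m=\bigl(1+p_{ii}^3(p_{ij}p_{ji})^4p_{jj}^3\bigr)\bigl(1+p_{ii}^6(p_{ij}p_{ji})^8p_{jj}^6\bigr)$; 8. otherwise, $P_m=1-\prod_{1\le i\le n}p_{ii}^{m_i(m_i-1)}\prod_{1\le i<j\le n}(p_{ij}p_{ji})^{m_im_j}$. (Where several cases or choices of $i,j$ apply, they give the same polynomial.) Then $\mathcal B(V)=T(V)$, that is, the canonical projection $T(V)\to\mathcal B(V)$ is bijective, if and only if $P_m(\mathbf q)\neq 0$ for every $m\in\mathbb N_0^n$ with $|m|\ge 2$. -/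

import Mathlib

open scoped TensorProduct

noncomputable section

/-! ### The Nichols algebra of a braided vector space -/

section Nichols

variable {K V : Type*} [Field K] [AddCommGroup V] [Module K V]

/-- Left multiplication `T(V) ⊗ (T(V) ⊗ V) → T(V) ⊗ V`, `s ⊗ (t ⊗ v) ↦ st ⊗ v`. -/
def tensorLeftMul (K V : Type*) [Field K] [AddCommGroup V] [Module K V] :
    TensorAlgebra K V ⊗[K] (TensorAlgebra K V ⊗[K] V) →ₗ[K] TensorAlgebra K V ⊗[K] V :=
  (LinearMap.mul' K (TensorAlgebra K V)).rTensor V ∘ₗ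
    (TensorProduct.assoc K (TensorAlgebra K V) (TensorAlgebra K V) V).symm.toLinearMap

/-- For `w ∈ V` and `f : V → T(V) ⊗ V`, the map `v ↦ ∑ w' · f(v')`, where
`c (v ⊗ w) = ∑ w' ⊗ v'`. -/
def braidingStep (c : V ⊗[K] V →ₗ[K] V ⊗[K] V) :
    V →ₗ[K] Module.End K (V →ₗ[K] TensorAlgebra K V ⊗[K] V) :=
  LinearMap.mk₂ K
    (fun w f => tensorLeftMul K V ∘ₗ TensorProduct.map (TensorAlgebra.ι K) f ∘ₗ c ∘ₗ
      (TensorProduct.mk K V V).flip w)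
    (fun w w' f => by ext v; simp)
    (fun a w f => by ext v; simp)
    (fun w f f' => by ext v; simp [TensorProduct.map_add_right])
    (fun a w f => by ext v; simp [TensorProduct.map_smul_right])

/-- The extension `c_{V,T(V)} : V ⊗ T(V) → T(V) ⊗ V` of the braiding `c` (in curried form). It is
determined by `v ⊗ 1 ↦ 1 ⊗ v` and `v ⊗ w t ↦ ∑ w' · c_{V,T(V)}(v' ⊗ t)` for `v, w ∈ V`, where
`c (v ⊗ w) = ∑ w' ⊗ v'`. -/
def braidingExt (c : V ⊗[K] V →ₗ[K] V ⊗[K] V) :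
    V →ₗ[K] TensorAlgebra K V →ₗ[K] TensorAlgebra K V ⊗[K] V :=
  LinearMap.flip <|
    (LinearMap.applyₗ (R := K) (TensorProduct.mk K (TensorAlgebra K V) V 1)) ∘ₗ
      (TensorAlgebra.lift K (braidingStep c)).toLinearMap

/-- Left multiplication by `v ⊗ 1 + 1 ⊗ v` in the braided tensor product algebra
`T(V) ⊗ T(V)`, whose product is `(a ⊗ b)(a' ⊗ b') = a c(b ⊗ a') b'`; that is,
`a ⊗ b ↦ v a ⊗ b + ∑ a' ⊗ v' b`, where `c_{V,T(V)}(v ⊗ a) = ∑ a' ⊗ v'`. -/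
def primitiveMul (c : V ⊗[K] V →ₗ[K] V ⊗[K] V) (v : V) :
    Module.End K (TensorAlgebra K V ⊗[K] TensorAlgebra K V) :=
  (LinearMap.mulLeft K (TensorAlgebra.ι K v)).rTensor (TensorAlgebra K V) +
    (LinearMap.mul' K (TensorAlgebra K V) ∘ₗ
        (TensorAlgebra.ι K).rTensor (TensorAlgebra K V)).lTensor (TensorAlgebra K V) ∘ₗ
      (TensorProduct.assoc K (TensorAlgebra K V) V (TensorAlgebra K V)).toLinearMap ∘ₗ
        (braidingExt c v).rTensor (TensorAlgebra K V)

/-- `primitiveMul` as a linear map in `v`. -/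
def primitiveMulₗ (c : V ⊗[K] V →ₗ[K] V ⊗[K] V) :
    V →ₗ[K] Module.End K (TensorAlgebra K V ⊗[K] TensorAlgebra K V) where
  toFun := primitiveMul c
  map_add' v w := by
    ext a b
    simp [primitiveMul, add_mul, TensorProduct.add_tmul]
    abel
  map_smul' r v := by
    ext a b
    simp [primitiveMul, ← TensorProduct.smul_tmul']

/-- The braided coproduct of the tensor algebra: the algebra map from `T(V)` to the braided tensor
product algebra `T(V) ⊗ T(V)` with `v ↦ v ⊗ 1 + 1 ⊗ v` for `v ∈ V`. -/
def braidedComul (c : V ⊗[K] V →ₗ[K] V ⊗[K] V) :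
    TensorAlgebra K V →ₗ[K] TensorAlgebra K V ⊗[K] TensorAlgebra K V :=
  (LinearMap.applyₗ (R := K) (1 ⊗ₜ[K] 1)) ∘ₗ
    (TensorAlgebra.lift K (primitiveMulₗ c)).toLinearMap

/-- A two-sided ideal of `T(V)` as a `K`-subspace. -/
def TwoSidedIdeal.toSubspace (I : TwoSidedIdeal (TensorAlgebra K V)) :
    Submodule K (TensorAlgebra K V) :=
  (TwoSidedIdeal.asIdeal I).restrictScalars K

/-- The homogeneous component of degree `d` of an element of `T(V)`. -/
def tensorComponent (d : ℕ) (t : TensorAlgebra K V) : TensorAlgebra K V :=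
  DirectSum.decompose (fun k : ℕ => LinearMap.range (TensorAlgebra.ι K : V →ₗ[K] _) ^ k) t d

/-- Homogeneous two-sided ideals of `T(V)` which are generated in degrees at least two and are
coideals for the braided coproduct. -/
structure IsNicholsCoideal (c : V ⊗[K] V →ₗ[K] V ⊗[K] V)
    (I : TwoSidedIdeal (TensorAlgebra K V)) : Prop where
  homogeneous : ∀ t ∈ I, ∀ d : ℕ, tensorComponent d t ∈ I
  two_le_degree : ∀ t ∈ I, ∀ d < 2, tensorComponent d t = 0
  coideal : ∀ t ∈ I, braidedComul c t ∈
    LinearMap.range (I.toSubspace.subtype.rTensor (TensorAlgebra K V)) ⊔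
      LinearMap.range (I.toSubspace.subtype.lTensor (TensorAlgebra K V))

/-- The defining ideal of the Nichols algebra: the sum of all homogeneous ideals of `T(V)` which
are generated in degrees at least two and are coideals. -/
def nicholsIdeal (c : V ⊗[K] V →ₗ[K] V ⊗[K] V) : TwoSidedIdeal (TensorAlgebra K V) :=
  sSup {I | IsNicholsCoideal c I}

/-- The Nichols algebra `B(V)` of the braided vector space `(V, c)`. -/
abbrev NicholsAlgebra (c : V ⊗[K] V →ₗ[K] V ⊗[K] V) : Type _ :=
  (nicholsIdeal c).ringCon.Quotient

/-- The canonical projection `T(V) → B(V)`. -/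
def NicholsAlgebra.proj (c : V ⊗[K] V →ₗ[K] V ⊗[K] V) :
    TensorAlgebra K V →ₐ[K] NicholsAlgebra c :=
  (nicholsIdeal c).ringCon.mkₐ K

/-- `(V, c)` is of diagonal type with respect to the basis `x`, with braiding matrix `q`. -/
structure IsDiagonalBraiding {n : ℕ} (c : V ⊗[K] V →ₗ[K] V ⊗[K] V)
    (x : Module.Basis (Fin n) K V) (q : Matrix (Fin n) (Fin n) K) : Prop where
  ne_zero : ∀ i j, q i j ≠ 0
  braiding : ∀ i j, c (x i ⊗ₜ[K] x j) = q i j • (x j ⊗ₜ[K] x i)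

end Nichols

/-! ### The polynomials `P_m` -/

section Polynomials

open MvPolynomial

/-- `(m)_q = 1 + q + ⋯ + q ^ (m - 1)`. -/
def qNumber {R : Type*} [Semiring R] (m : ℕ) (q : R) : R :=
  ∑ k ∈ Finset.range m, q ^ k

/-- The variable `p_ij` of `ℤ[p_ij | 1 ≤ i, j ≤ n]`. -/
abbrev pVar {n : ℕ} (i j : Fin n) : MvPolynomial (Fin n × Fin n) ℤ := X (i, j)

/-- `m = a e_i + b e_j` with `i ≠ j`, where `s = (i, j)`. -/
def IsTwoTerm {n : ℕ} (m : Fin n → ℕ) (a b : ℕ) (s : Fin n × Fin n) : Prop :=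
  s.1 ≠ s.2 ∧ m = Pi.single s.1 a + Pi.single s.2 b

open Classical in
/-- The polynomial `P_m`, for `m ∈ ℕ₀ⁿ` with `|m| ≥ 2`. Where the pair `(i, j)` in one of the cases
is not unique, the polynomial does not depend on its choice. -/
def nicholsP {n : ℕ} (m : Fin n → ℕ) : MvPolynomial (Fin n × Fin n) ℤ :=
  if h : ∃ i : Fin n, m = Pi.single i (m i) then
    qNumber (m h.choose) (pVar h.choose h.choose)
  else if h : ∃ s : Fin n × Fin n, 0 < m s.2 ∧ IsTwoTerm m 1 (m s.2) s then
    let i := h.choose.1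
    let j := h.choose.2
    1 - pVar j j ^ (m j - 1) * (pVar i j * pVar j i)
  else if h : ∃ s : Fin n × Fin n, 0 < m s.2 ∧ IsTwoTerm m 2 (m s.2) s then
    let i := h.choose.1
    let j := h.choose.2
    1 + pVar j j ^ (m j * (m j - 1) / 2) * (-(pVar i j * pVar j i)) ^ m j * pVar i i
  else if h : ∃ s : Fin n × Fin n, IsTwoTerm m 3 3 s then
    let i := h.choose.1
    let j := h.choose.2
    qNumber 3 (pVar i i ^ 2 * (pVar i j * pVar j i) ^ 3 * pVar j j ^ 2)
  else if h : ∃ s : Fin n × Fin n, IsTwoTerm m 3 4 s then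
    let i := h.choose.1
    let j := h.choose.2
    (1 - pVar i i ^ 2 * (pVar i j * pVar j i) ^ 4 * pVar j j ^ 4) *
      qNumber 3 (pVar i i * (pVar i j * pVar j i) ^ 2 * pVar j j ^ 2)
  else if h : ∃ s : Fin n × Fin n, IsTwoTerm m 3 6 s then
    let i := h.choose.1
    let j := h.choose.2
    (1 - pVar i i * (pVar i j * pVar j i) ^ 3 * pVar j j ^ 5) *
      qNumber 3 (pVar i i ^ 2 * (pVar i j * pVar j i) ^ 6 * pVar j j ^ 10)
  else if h : ∃ s : Fin n × Fin n, IsTwoTerm m 4 4 s then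
    let i := h.choose.1
    let j := h.choose.2
    (1 + pVar i i ^ 3 * (pVar i j * pVar j i) ^ 4 * pVar j j ^ 3) *
      (1 + pVar i i ^ 6 * (pVar i j * pVar j i) ^ 8 * pVar j j ^ 6)
  else
    1 - (∏ i, pVar i i ^ (m i * (m i - 1))) *
      ∏ i, ∏ j ∈ Finset.Ioi i, (pVar i j * pVar j i) ^ (m i * m j)

/-- The value `P(q)` of a polynomial `P ∈ ℤ[p_ij]` at a matrix `q`. -/
def evalAtMatrix {K : Type*} [Field K] {n : ℕ} (q : Matrix (Fin n) (Fin n) K)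
    (P : MvPolynomial (Fin n × Fin n) ℤ) : K :=
  aeval (fun s : Fin n × Fin n => q s.1 s.2) P

end Polynomials

end

/-! Write Δ(t) = t ⊗ 1 + Σ_j ∂_j(t) ⊗ x_j + ⋯ with skew derivations ∂_j. The Nichols ideal is zero
exactly when no nonzero homogeneous element of positive degree is killed by all ∂_j. The map t ↦ Σ_j
∂_j(t) x_j takes each letter of a word in turn, braids it past the later letters and puts it at the
end. So the condition says that the matrix S_d of this operator on words of length d
(`shuffleMatrix`) is invertible for all d ≥ 1; this is `bijective_proj_iff_forall_det`.

The determinants satisfy a recursion. Let R move the first letter of a word to the end, with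
braiding, and let T do the same with all letters but the last, with an additional double braiding
between the moved letter and the last one. Then (1 - R) S_{d+1} = (id ⊗ S_d)(1 - T)
(`one_sub_rotation_mul_shuffle`). Both R and T are weighted permutations, so det(1 - R) and det(1 -
T) are products over cycles of rotated words. Let σ_l be the double braiding of all pairs of letters
in degree l. A cycle of proper r-th powers w contributes 1 - σ_l^(1/r), where l = deg w for R, and l
= deg w + e_j for T acting on words w j. Hence det S_{d+1} is (det S_d)^n times one contribution for
each degree l with |l| = d + 1: a quotient of products of factors 1 - σ_l^(1/r), with exponents
given by numbers of words (`card_dvd_rootOrder`).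

It remains to see that the contribution of l vanishes where P_l does. Each 1 - σ_l^(1/r) divides 1 -
σ_l. If periodic words are rare enough (`periodicBound`), the numerator has more factors 1 - σ_l
than the denominator can cancel, so the contribution has the zeros of 1 - σ_l
(`hasDegreeRatio_of_lt`). This settles all degrees with three or more letters, and those with two
letters outside the special families; in these families the quotient is computed explicitly. For one
letter the contribution is a power of (m)_q / (m-1)_q, and the denominator is controlled by
induction on the degree.

All cancellations take place in the domain ℤ[p_ij], before evaluation at q, because 1 - R may become
singular there. -/

/-! ### Determinants of weighted permutations -/

section WeightedPerm

variable {ι R : Type*} [Fintype ι] [DecidableEq ι] [CommRing R]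

/-- The matrix of the operator `w ↦ s w • f w` on the free module with basis `ι`, in the row
convention. -/
def weightedPerm (f : Equiv.Perm ι) (s : ι → R) : Matrix ι ι R :=
  Matrix.of fun w v => if v = f w then s w else 0

theorem weightedPerm_mulVec (f : Equiv.Perm ι) (s : ι → R) (F : ι → R) (w : ι) :
    (weightedPerm f s).mulVec F w = s w * F (f w) := by
  simp [weightedPerm, Matrix.mulVec, dotProduct]

/-- If σ fixes y, injectivity prevents the predecessor of y from moving to y, so fixed points of σ
propagate backwards around the cycle. These σ index the nonzero Leibniz terms in the next
determinant. -/
theorem eq_one_or_eq_of_forall_sameCycle {f : Equiv.Perm ι} (ht : ∀ x y, f.SameCycle x y)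
    {σ : Equiv.Perm ι} (hσ : ∀ x, σ x = x ∨ σ x = f x) : σ = 1 ∨ σ = f := by
  by_cases h : ∃ x, σ x = x
  · left
    obtain ⟨x, hx⟩ := h
    have step : ∀ y, σ y = y → σ (f⁻¹ y) = f⁻¹ y := by
      intro y hy
      rcases hσ (f⁻¹ y) with h | h
      · exact h
      · have h1 : σ (f⁻¹ y) = σ y := by rw [h, hy]; simp
        rw [σ.injective h1, hy]
    have hk : ∀ k : ℕ, σ ((f⁻¹ ^ k) x) = (f⁻¹ ^ k) x := by
      intro k
      induction k with
      | zero => simpa using hx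
      | succ k ih =>
        rw [pow_succ']
        exact step _ ih
    ext y
    obtain ⟨k, -, rfl⟩ := (Equiv.Perm.sameCycle_inv.2 (ht x y)).exists_pow_eq'
    simpa using hk k
  · right
    push Not at h
    ext y
    exact (hσ y).resolve_left (h y)

theorem det_one_sub_weightedPerm_of_sameCycle [Nonempty ι] (f : Equiv.Perm ι) (s : ι → R)
    (ht : ∀ x y, f.SameCycle x y) : (1 - weightedPerm f s).det = 1 - ∏ w, s w := by
  -- With a fixed point the single cycle is a point. Then the identity and `f` coincide and the two
  -- Leibniz terms would collapse into one.
  by_cases hf : ∃ x, f x = x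
  · obtain ⟨x, hx⟩ := hf
    have : ∀ y, y = x := by
      intro y
      obtain ⟨k, hk⟩ := ht x y
      rw [← hk, Equiv.Perm.zpow_apply_eq_self_of_apply_eq_self hx]
    let _ : Unique ι := ⟨⟨x⟩, this⟩
    rw [Matrix.det_unique, Fintype.prod_unique]
    simp [weightedPerm, Subsingleton.elim _ (default : ι)]
  · push Not at hf
    have hne : (1 : Equiv.Perm ι) ≠ f := by
      intro h
      obtain ⟨x⟩ := ‹Nonempty ι›
      exact hf x (by rw [← h]; rfl)
    rw [← Matrix.det_transpose, Matrix.det_apply',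
      ← Finset.sum_subset (Finset.subset_univ {1, f}), Finset.sum_pair hne]
    · have hsupp : f.support = Finset.univ := by
        ext x; simpa using hf x
      have hcyc : f.IsCycle := by
        obtain ⟨x⟩ := ‹Nonempty ι›
        exact ⟨x, hf x, fun y _ => ht x y⟩
      have h1 : ∀ w, (1 - weightedPerm f s) w w = 1 := by
        intro w
        simp [weightedPerm, (hf w).symm]
      have h2 : ∀ w, (1 - weightedPerm f s) w (f w) = - s w := by
        intro w
        simp [weightedPerm, Matrix.one_apply_ne (hf w).symm]
      simp only [Matrix.transpose_apply, Equiv.Perm.one_apply, h1, h2, hcyc.sign, hsupp,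
        Finset.card_univ]
      rw [show (∏ x, -s x) = (-1) ^ Fintype.card ι * ∏ x, s x by
        simp [Finset.prod_neg]]
      have : ((-1 : R) ^ Fintype.card ι) * (-1) ^ Fintype.card ι = 1 := by
        rw [← mul_pow]; simp
      push_cast
      simp only [Equiv.Perm.sign_one, Finset.prod_const_one]
      push_cast
      linear_combination (-(∏ x, s x)) * this
    · intro σ _ hσ
      simp only [Finset.mem_insert, Finset.mem_singleton] at hσ
      by_contra hprod
      refine hσ (eq_one_or_eq_of_forall_sameCycle ht fun x => ?_)
      by_contra hx
      push Not at hx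
      refine hprod (mul_eq_zero_of_right _ (Finset.prod_eq_zero (Finset.mem_univ x) ?_))
      simp [weightedPerm, Matrix.one_apply_ne hx.1.symm, hx.2]

theorem image_iterate_range_minimalPeriod {f : Equiv.Perm ι} (w : ι)
    [DecidablePred (f.SameCycle w)] :
    (Finset.range (Function.minimalPeriod f w)).image (fun i => f^[i] w) =
      ({v | f.SameCycle w v} : Finset ι) := by
  have hpos : w ∈ Function.periodicPts f := by
    refine Function.mk_mem_periodicPts (orderOf_pos f) ?_
    rw [Function.IsPeriodicPt, Function.IsFixedPt, ← Equiv.Perm.coe_pow, pow_orderOf_eq_one]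
    rfl
  ext v
  simp only [Finset.mem_image, Finset.mem_range, Finset.mem_filter, Finset.mem_univ, true_and]
  constructor
  · rintro ⟨i, -, rfl⟩
    exact ⟨i, by rw [zpow_natCast, Equiv.Perm.coe_pow]⟩
  · intro h
    obtain ⟨k, -, hk⟩ := h.exists_pow_eq'
    refine ⟨k % Function.minimalPeriod f w, Nat.mod_lt _
      (Function.minimalPeriod_pos_of_mem_periodicPts hpos), ?_⟩
    rw [Function.iterate_mod_minimalPeriod_eq, ← Equiv.Perm.coe_pow, hk]

theorem injOn_iterate_range_minimalPeriod {κ : Type*} {f : Equiv.Perm κ} (w : κ) :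
    Set.InjOn (fun i => f^[i] w) (Finset.range (Function.minimalPeriod f w)) := by
  intro a ha b hb hab
  exact Function.iterate_injOn_Iio_minimalPeriod (by simpa using ha) (by simpa using hb) hab

theorem prod_range_minimalPeriod {f : Equiv.Perm ι} (s : ι → R) (w : ι)
    [DecidablePred (f.SameCycle w)] :
    ∏ i ∈ Finset.range (Function.minimalPeriod f w), s (f^[i] w) =
      ∏ v with f.SameCycle w v, s v := by
  rw [← image_iterate_range_minimalPeriod, Finset.prod_image (injOn_iterate_range_minimalPeriod w)]

theorem card_sameCycle {f : Equiv.Perm ι} (w : ι) [DecidablePred (f.SameCycle w)] :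
    ({v | f.SameCycle w v} : Finset ι).card = Function.minimalPeriod f w := by
  rw [← image_iterate_range_minimalPeriod,
    Finset.card_image_of_injOn (injOn_iterate_range_minimalPeriod w), Finset.card_range]

/-- Ordering the cycles makes the matrix block triangular, with one factor per cycle. Taking the
`d`-th power allows indexing by points instead of cycles: a cycle of length L is counted by each of
its L points, with exponent d / L. -/
theorem det_one_sub_weightedPerm_pow (f : Equiv.Perm ι) (s : ι → R) (d : ℕ)
    (hd : ∀ w, f^[d] w = w) :
    (1 - weightedPerm f s).det ^ d = ∏ w, (1 - ∏ i ∈ Finset.range (Function.minimalPeriod f w),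
      s (f^[i] w)) ^ (d / Function.minimalPeriod f w) := by
  classical
  let Q := Quotient (Equiv.Perm.SameCycle.setoid f)
  let e : Q ≃ Fin (Fintype.card Q) := Fintype.equivFin Q
  let b : ι → Fin (Fintype.card Q) := fun w => e (Quotient.mk _ w)
  have hb : ∀ w v, b w = b v ↔ f.SameCycle w v := by
    intro w v
    simp only [b, e.apply_eq_iff_eq]
    exact Quotient.eq (r := Equiv.Perm.SameCycle.setoid f)
  have hbf : ∀ w, b (f w) = b w := by
    intro w
    rw [hb]
    exact Equiv.Perm.sameCycle_apply_left.2 (Equiv.Perm.SameCycle.refl f w)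
  have htri : (1 - weightedPerm f s).BlockTriangular b := by
    intro w v h
    have hne : w ≠ v := by rintro rfl; exact lt_irrefl _ h
    have hne' : v ≠ f w := by rintro rfl; rw [hbf] at h; exact lt_irrefl _ h
    simp [weightedPerm, Matrix.one_apply_ne hne, hne']
  have hblock : ∀ k, ((1 - weightedPerm f s).toSquareBlock b k).det =
      1 - ∏ w with b w = k, s w := by
    intro k
    have hk : ∀ w, b (f w) = k ↔ b w = k := fun w => by rw [hbf]
    obtain ⟨x, hx⟩ : ∃ x, b x = k := by
      obtain ⟨x, hx⟩ := Quotient.exists_rep (e.symm k)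
      exact ⟨x, by simp [b, hx]⟩
    have : Nonempty {w // b w = k} := ⟨⟨x, hx⟩⟩
    have hM : (1 - weightedPerm f s).toSquareBlock b k =
        1 - weightedPerm (f.subtypePerm hk) (fun w : {w // b w = k} => s w) := by
      ext w v
      simp [Matrix.toSquareBlock_def, weightedPerm, Matrix.one_apply, Subtype.ext_iff]
    rw [hM, det_one_sub_weightedPerm_of_sameCycle]
    · congr 1
      exact (Finset.prod_subtype _ (by simp) _).symm
    · rintro ⟨y, hy⟩ ⟨z, hz⟩
      rw [Equiv.Perm.sameCycle_subtypePerm, ← hb, hy, hz]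
  have hfib : ∀ w, (∏ i ∈ Finset.range (Function.minimalPeriod f w), s (f^[i] w)) =
      ∏ v with b v = b w, s v := by
    intro w
    rw [prod_range_minimalPeriod]
    congr 1
    ext v
    simp [← hb, eq_comm]
  rw [htri.det_fintype, ← Finset.prod_pow, ← Finset.prod_fiberwise _ b]
  refine Finset.prod_congr rfl fun k _ => ?_
  obtain ⟨x, hx⟩ : ∃ x, b x = k := by
    obtain ⟨x, hx⟩ := Quotient.exists_rep (e.symm k)
    exact ⟨x, by simp [b, hx]⟩
  have hL : ∀ w, b w = k →
      Function.minimalPeriod f w = ({v | b v = k} : Finset ι).card := by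
    intro w hw
    rw [← card_sameCycle]
    congr 1
    ext v
    simp [← hb, ← hw, eq_comm]
  rw [Finset.prod_congr rfl (g := fun _ => (1 - ∏ w with b w = k, s w) ^
    (d / Function.minimalPeriod f x))]
  · rw [Finset.prod_const, ← pow_mul, ← hL x hx, hblock, Nat.div_mul_cancel]
    exact Function.IsPeriodicPt.minimalPeriod_dvd (hd x)
  · intro w hw
    have hw : b w = k := by simpa using hw
    rw [hfib, hw, hL w hw, hL x hx]

end WeightedPerm

/-! ### The operators on words -/

section Words

variable {n : ℕ} {R : Type*} [CommRing R]

/-- The product of the `p i (w k)` over all letters of the word `w`. -/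
def wordChar (p : Fin n → Fin n → R) (i : Fin n) {d : ℕ} (w : Fin d → Fin n) : R :=
  ∏ k, p i (w k)

theorem wordChar_cons (p : Fin n → Fin n → R) (i a : Fin n) {d : ℕ} (w : Fin d → Fin n) :
    wordChar p i (Fin.cons a w : Fin (d + 1) → Fin n) = p i a * wordChar p i w := by
  simp [wordChar, Fin.prod_univ_succ]

theorem wordChar_snoc (p : Fin n → Fin n → R) (i a : Fin n) {d : ℕ} (w : Fin d → Fin n) :
    wordChar p i (Fin.snoc w a : Fin (d + 1) → Fin n) = wordChar p i w * p i a := by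
  simp [wordChar, Fin.prod_univ_castSucc]

/-- Cyclic rotation of words: the first letter is moved to the end. -/
def rotateWord (n d : ℕ) : Equiv.Perm (Fin d → Fin n) :=
  Equiv.arrowCongr (finRotate d).symm (Equiv.refl _)

theorem rotateWord_apply {d : ℕ} (w : Fin d → Fin n) (k : Fin d) :
    rotateWord n d w k = w (finRotate d k) := rfl

theorem rotateWord_cons {d : ℕ} (i : Fin n) (s : Fin d → Fin n) :
    rotateWord n (d + 1) (Fin.cons i s) = Fin.snoc s i := by
  ext k
  rw [rotateWord_apply]
  refine Fin.lastCases ?_ (fun k => ?_) k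
  · simp
  · simp

/-- The matrix of the operator on words of length `d` which sends a word to the sum, over all its
letters, of the words in which this letter is moved to the end. -/
def shuffleMatrix (p : Fin n → Fin n → R) :
    (d : ℕ) → Matrix (Fin d → Fin n) (Fin d → Fin n) R
  | 0 => 0
  | d + 1 => Matrix.of fun w v =>
      (if w 0 = v 0 then shuffleMatrix p d (Fin.tail w) (Fin.tail v) else 0) +
        if v = rotateWord n (d + 1) w then wordChar p (w 0) (Fin.tail w) else 0

/-- The matrix of the identity on the first letter tensored with `M`. -/
def consMatrix {d : ℕ} (M : Matrix (Fin d → Fin n) (Fin d → Fin n) R) :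
    Matrix (Fin (d + 1) → Fin n) (Fin (d + 1) → Fin n) R :=
  Matrix.of fun w v => if w 0 = v 0 then M (Fin.tail w) (Fin.tail v) else 0

/-- The matrix of the rotation of words, braiding the first letter past all the others. -/
def rotationMatrix (p : Fin n → Fin n → R) (d : ℕ) :
    Matrix (Fin (d + 1) → Fin n) (Fin (d + 1) → Fin n) R :=
  weightedPerm (rotateWord n (d + 1)) fun w => wordChar p (w 0) (Fin.tail w)

/-- The weight of the rotation of a word `w` which is followed by the letter `j`, where the first
letter of `w` is braided with `j` twice. -/
def twistedWeight (p : Fin n → Fin n → R) (j : Fin n) {d : ℕ} (w : Fin (d + 1) → Fin n) : R :=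
  wordChar p (w 0) (Fin.tail w) * (p (w 0) j * p j (w 0))

/-- The matrix of the rotation of all letters but the last, where the first letter is braided with
the last one twice. -/
def twistedRotationMatrix (p : Fin n → Fin n → R) (d : ℕ) :
    Matrix (Fin (d + 2) → Fin n) (Fin (d + 2) → Fin n) R :=
  Matrix.of fun w v => if w (Fin.last _) = v (Fin.last _) then
    weightedPerm (rotateWord n (d + 1)) (twistedWeight p (w (Fin.last _)))
      (Fin.init w) (Fin.init v) else 0

theorem sum_cons {d : ℕ} {M : Type*} [AddCommMonoid M] (F : (Fin (d + 1) → Fin n) → M) :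
    ∑ w, F w = ∑ i, ∑ s, F (Fin.cons i s) := by
  rw [← Fintype.sum_prod_type', ← (Fin.consEquiv fun _ => Fin n).sum_comp]
  rfl

theorem sum_snoc {d : ℕ} {M : Type*} [AddCommMonoid M] (F : (Fin (d + 1) → Fin n) → M) :
    ∑ w, F w = ∑ i, ∑ s, F (Fin.snoc s i) := by
  rw [← Fintype.sum_prod_type', ← (Fin.snocEquiv fun _ => Fin n).sum_comp]
  rfl

theorem consMatrix_mulVec {d : ℕ} (M : Matrix (Fin d → Fin n) (Fin d → Fin n) R)
    (F : (Fin (d + 1) → Fin n) → R) (i : Fin n) (s : Fin d → Fin n) :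
    (consMatrix M).mulVec F (Fin.cons i s) = M.mulVec (fun v => F (Fin.cons i v)) s := by
  simp only [Matrix.mulVec, dotProduct, consMatrix, sum_cons]
  rw [Finset.sum_eq_single i] <;> simp +contextual [eq_comm]

theorem shuffleMatrix_succ (p : Fin n → Fin n → R) (d : ℕ) :
    shuffleMatrix p (d + 1) = consMatrix (shuffleMatrix p d) + rotationMatrix p d := rfl

theorem rotationMatrix_mulVec (p : Fin n → Fin n → R) {d : ℕ} (F : (Fin (d + 1) → Fin n) → R)
    (i : Fin n) (s : Fin d → Fin n) :
    (rotationMatrix p d).mulVec F (Fin.cons i s) = wordChar p i s * F (Fin.snoc s i) := by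
  rw [rotationMatrix, weightedPerm_mulVec, rotateWord_cons]
  simp

theorem shuffleMatrix_mulVec_cons (p : Fin n → Fin n → R) {d : ℕ} (F : (Fin (d + 1) → Fin n) → R)
    (i : Fin n) (s : Fin d → Fin n) :
    (shuffleMatrix p (d + 1)).mulVec F (Fin.cons i s) =
      (shuffleMatrix p d).mulVec (fun v => F (Fin.cons i v)) s +
        wordChar p i s * F (Fin.snoc s i) := by
  rw [shuffleMatrix_succ, Matrix.add_mulVec, Pi.add_apply, consMatrix_mulVec,
    rotationMatrix_mulVec]

theorem twistedRotationMatrix_mulVec (p : Fin n → Fin n → R) {d : ℕ}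
    (F : (Fin (d + 2) → Fin n) → R) (u : Fin (d + 1) → Fin n) (j : Fin n) :
    (twistedRotationMatrix p d).mulVec F (Fin.snoc u j) =
      twistedWeight p j u * F (Fin.snoc (rotateWord n (d + 1) u) j) := by
  simp only [Matrix.mulVec, dotProduct, twistedRotationMatrix]
  rw [sum_snoc, Finset.sum_eq_single j]
  · simp [weightedPerm]
  · intro b _ hb
    simp [hb.symm]
  · simp

/-- The function `u = v j ↦ p j i * F (v i j)`. -/
def insertBeforeLast (p : Fin n → Fin n → R) {d : ℕ} (F : (Fin (d + 2) → Fin n) → R)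
    (i : Fin n) (u : Fin (d + 1) → Fin n) : R :=
  p (u (Fin.last d)) i * F (Fin.snoc (Fin.snoc (Fin.init u) i) (u (Fin.last d)))

/-- The operator only rearranges the letters of a word, and `wordChar p i` depends only on the
multiset of letters. -/
theorem shuffleMatrix_mulVec_wordChar (p : Fin n → Fin n → R) (i : Fin n) {d : ℕ}
    (F : (Fin d → Fin n) → R) (s : Fin d → Fin n) :
    (shuffleMatrix p d).mulVec (fun v => wordChar p i v * F v) s =
      wordChar p i s * (shuffleMatrix p d).mulVec F s := by
  induction d with
  | zero => simp [shuffleMatrix]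
  | succ d ih =>
    induction s using Fin.consCases with
    | cons a s =>
      simp only [shuffleMatrix_mulVec_cons, wordChar_cons, wordChar_snoc]
      have := ih (fun v => p i a * F (Fin.cons a v)) s
      have h2 : (shuffleMatrix p d).mulVec (fun v => p i a * F (Fin.cons a v)) s =
          p i a * (shuffleMatrix p d).mulVec (fun v => F (Fin.cons a v)) s := by
        exact congrFun (Matrix.mulVec_smul _ (p i a) (fun v => F (Fin.cons a v))) s
      rw [h2] at this
      rw [show (fun v => p i a * wordChar p i v * F (Fin.cons a v)) =
        fun v => wordChar p i v * (p i a * F (Fin.cons a v)) by ext; ring, this]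
      ring

theorem shuffleMatrix_one_mulVec (p : Fin n → Fin n → R) (F : (Fin 1 → Fin n) → R)
    (s : Fin 1 → Fin n) : (shuffleMatrix p 1).mulVec F s = F s := by
  induction s using Fin.consCases with
  | cons a s =>
    rw [shuffleMatrix_mulVec_cons]
    simp only [shuffleMatrix, Matrix.zero_mulVec, wordChar]
    simp
    congr 1
    ext k
    fin_cases k
    rfl

/-- The defining recursion strips the first letter; this one strips the last. Either the last letter
itself is the one moved, or an earlier letter j is moved to the end of `s` and then braided past
`i`, which produces the factor `p j i` in `insertBeforeLast`. -/
theorem shuffleMatrix_mulVec_snoc (p : Fin n → Fin n → R) {d : ℕ}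
    (F : (Fin (d + 2) → Fin n) → R) (s : Fin (d + 1) → Fin n) (i : Fin n) :
    (shuffleMatrix p (d + 2)).mulVec F (Fin.snoc s i) =
      F (Fin.snoc s i) + (shuffleMatrix p (d + 1)).mulVec (insertBeforeLast p F i) s := by
  induction d with
  | zero =>
    induction s using Fin.consCases with
    | cons a s =>
      rw [← Fin.cons_snoc_eq_snoc_cons, shuffleMatrix_mulVec_cons, shuffleMatrix_one_mulVec,
        shuffleMatrix_one_mulVec]
      congr 1
      have h1 : (Fin.cons a s : Fin 1 → Fin n) (Fin.last 0) = a := rfl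
      have h2 : Fin.init (Fin.cons a s : Fin 1 → Fin n) = s := Subsingleton.elim _ _
      rw [insertBeforeLast, h1, h2, wordChar_snoc]
      simp [wordChar]
  | succ d ih =>
    induction s using Fin.consCases with
    | cons a s =>
      rw [← Fin.cons_snoc_eq_snoc_cons, shuffleMatrix_mulVec_cons, ih, shuffleMatrix_mulVec_cons,
        wordChar_snoc]
      have h1 : insertBeforeLast p (fun v => F (Fin.cons a v)) i =
          fun v => insertBeforeLast p F i (Fin.cons a v) := by
        ext v
        induction v using Fin.snocCases with
        | snoc v j =>
        simp only [insertBeforeLast, Fin.cons_snoc_eq_snoc_cons, Fin.snoc_last, Fin.init_snoc]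
      rw [h1]
      simp only [insertBeforeLast, Fin.snoc_last, Fin.init_snoc]
      ring

/-- Expand S on `i s` by the first letter, and on the rotated word `s i` by the last letter. The
terms `s i` cancel, and in what remains the character of `i` commutes with S on `s`, so that S
factors out on the left. The factors `p i j` from the rotation and `p j i` from the insertion
combine to the double braiding in T. -/
theorem one_sub_rotation_mul_shuffle (p : Fin n → Fin n → R) (d : ℕ) :
    (1 - rotationMatrix p (d + 1)) * shuffleMatrix p (d + 2) =
      consMatrix (shuffleMatrix p (d + 1)) * (1 - twistedRotationMatrix p d) := by
  apply Matrix.mulVec_injective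
  ext F w
  induction w using Fin.consCases with
  | cons i s =>
  rw [← Matrix.mulVec_mulVec, ← Matrix.mulVec_mulVec, Matrix.sub_mulVec, Matrix.one_mulVec,
    Pi.sub_apply, rotationMatrix_mulVec, shuffleMatrix_mulVec_cons, shuffleMatrix_mulVec_snoc,
    consMatrix_mulVec]
  have h : (fun v => (Matrix.mulVec (1 - twistedRotationMatrix p d) F) (Fin.cons i v)) =
      (fun v => F (Fin.cons i v)) - fun v => wordChar p i v * insertBeforeLast p F i v := by
    ext v
    rw [Matrix.sub_mulVec, Matrix.one_mulVec, Pi.sub_apply, Pi.sub_apply]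
    congr 1
    induction v using Fin.snocCases with
    | snoc v j =>
    rw [Fin.cons_snoc_eq_snoc_cons, twistedRotationMatrix_mulVec, rotateWord_cons]
    simp only [twistedWeight, insertBeforeLast, wordChar_snoc, Fin.snoc_last, Fin.init_snoc,
      Fin.cons_zero, Fin.tail_cons]
    ring
  rw [h, Matrix.mulVec_sub, Pi.sub_apply, shuffleMatrix_mulVec_wordChar]
  ring

theorem det_consMatrix {d : ℕ} (M : Matrix (Fin d → Fin n) (Fin d → Fin n) R) :
    (consMatrix M).det = M.det ^ n := by
  let e := (Fin.consEquiv (n := d) fun _ => Fin n).trans (Equiv.refl _)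
  have h : (consMatrix M).submatrix ((Equiv.prodComm _ _).trans e) ((Equiv.prodComm _ _).trans e) =
      Matrix.blockDiagonal fun _ : Fin n => M := by
    ext ⟨s, i⟩ ⟨t, j⟩
    simp [consMatrix, Matrix.blockDiagonal_apply, e, Fin.consEquiv]
  rw [← Matrix.det_submatrix_equiv_self ((Equiv.prodComm _ _).trans e), h,
    Matrix.det_blockDiagonal]
  simp

theorem det_one_sub_twistedRotationMatrix (p : Fin n → Fin n → R) (d : ℕ) :
    (1 - twistedRotationMatrix p d).det =
      ∏ j, (1 - weightedPerm (rotateWord n (d + 1)) (twistedWeight p j)).det := by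
  let e := (Fin.snocEquiv (n := d + 1) fun _ => Fin n).trans (Equiv.refl _)
  have h : (1 - twistedRotationMatrix p d).submatrix
      ((Equiv.prodComm _ _).trans e) ((Equiv.prodComm _ _).trans e) =
      Matrix.blockDiagonal fun j : Fin n =>
        1 - weightedPerm (rotateWord n (d + 1)) (twistedWeight p j) := by
    ext ⟨s, i⟩ ⟨t, j⟩
    simp [twistedRotationMatrix, Matrix.blockDiagonal_apply, e, Fin.snocEquiv, Matrix.one_apply,
      Fin.snoc_inj]
    by_cases h : i = j <;> simp [h]
  rw [← Matrix.det_submatrix_equiv_self ((Equiv.prodComm _ _).trans e), h,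
    Matrix.det_blockDiagonal]

theorem det_shuffleMatrix_succ (p : Fin n → Fin n → R) (d : ℕ) :
    (1 - rotationMatrix p (d + 1)).det * (shuffleMatrix p (d + 2)).det =
      (shuffleMatrix p (d + 1)).det ^ n *
        ∏ j, (1 - weightedPerm (rotateWord n (d + 1)) (twistedWeight p j)).det := by
  rw [← Matrix.det_mul, one_sub_rotation_mul_shuffle, Matrix.det_mul, det_consMatrix,
    det_one_sub_twistedRotationMatrix]

theorem shuffleMatrix_one (p : Fin n → Fin n → R) : shuffleMatrix p 1 = 1 := by
  apply Matrix.mulVec_injective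
  ext F w
  rw [shuffleMatrix_one_mulVec, Matrix.one_mulVec]

end Words

/-! ### Degrees and roots of words -/

section Degrees

variable {n : ℕ} {R : Type*} [CommRing R]

/-- The degree of a word: the multiplicity of each letter. -/
def wordDeg {d : ℕ} (w : Fin d → Fin n) : Fin n → ℕ :=
  fun a => ({k | w k = a} : Finset (Fin d)).card

theorem wordDeg_eq_sum {d : ℕ} (w : Fin d → Fin n) (a : Fin n) :
    wordDeg w a = ∑ k, if w k = a then 1 else 0 := by
  simp [wordDeg]

theorem sum_wordDeg {d : ℕ} (w : Fin d → Fin n) : ∑ a, wordDeg w a = d := by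
  simp_rw [wordDeg_eq_sum]
  rw [Finset.sum_comm]
  simp

theorem wordDeg_cons {d : ℕ} (i : Fin n) (s : Fin d → Fin n) :
    wordDeg (Fin.cons i s : Fin (d + 1) → Fin n) = wordDeg s + Pi.single i 1 := by
  ext a
  rw [wordDeg_eq_sum, Fin.sum_univ_succ, Pi.add_apply, wordDeg_eq_sum, add_comm]
  simp [Pi.single_apply, eq_comm]

theorem wordDeg_comp_equiv {d : ℕ} (w : Fin d → Fin n) (e : Equiv.Perm (Fin d)) :
    wordDeg (w ∘ e) = wordDeg w := by
  ext a
  simp only [wordDeg_eq_sum, Function.comp_apply]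
  exact Equiv.sum_comp e fun k => if w k = a then 1 else 0

theorem wordDeg_rotateWord_iterate {d : ℕ} (w : Fin d → Fin n) (i : ℕ) :
    wordDeg ((rotateWord n d)^[i] w) = wordDeg w := by
  induction i with
  | zero => rfl
  | succ i ih => rw [Function.iterate_succ_apply', ← ih]; exact wordDeg_comp_equiv _ _

theorem rotateWord_iterate_apply {d : ℕ} (w : Fin (d + 1) → Fin n) (i : ℕ) (k : Fin (d + 1)) :
    (rotateWord n (d + 1))^[i] w k = w (k + Fin.ofNat (d + 1) i) := by
  induction i generalizing k with
  | zero => simp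
  | succ i ih =>
    rw [Function.iterate_succ_apply', rotateWord_apply, ih, finRotate_apply]
    congr 1
    rw [add_assoc]
    congr 1
    ext
    simp [Fin.val_add, add_comm]

theorem rotateWord_iterate_self {d : ℕ} (w : Fin (d + 1) → Fin n) :
    (rotateWord n (d + 1))^[d + 1] w = w := by
  ext k
  rw [rotateWord_iterate_apply]
  simp

/-- The largest `r` such that `w` is an `r`-th power. -/
noncomputable def rootOrder {d : ℕ} (w : Fin d → Fin n) : ℕ :=
  d / Function.minimalPeriod (rotateWord n d) w

theorem minimalPeriod_dvd_length {d : ℕ} (w : Fin (d + 1) → Fin n) :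
    Function.minimalPeriod (rotateWord n (d + 1)) w ∣ d + 1 :=
  Function.IsPeriodicPt.minimalPeriod_dvd (rotateWord_iterate_self w)

theorem minimalPeriod_mul_rootOrder {d : ℕ} (w : Fin (d + 1) → Fin n) :
    Function.minimalPeriod (rotateWord n (d + 1)) w * rootOrder w = d + 1 :=
  Nat.mul_div_cancel' (minimalPeriod_dvd_length w)

theorem rootOrder_pos {d : ℕ} (w : Fin (d + 1) → Fin n) : 0 < rootOrder w := by
  rcases Nat.eq_zero_or_pos (rootOrder w) with h | h
  · have := minimalPeriod_mul_rootOrder w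
    simp [h] at this
  · exact h

theorem rootOrder_dvd {d : ℕ} (w : Fin (d + 1) → Fin n) : rootOrder w ∣ d + 1 :=
  Dvd.intro_left _ (minimalPeriod_mul_rootOrder w)

/-- The monomial with exponents `e` in the `p i j`. -/
def pMonomial (p : Fin n → Fin n → R) (e : Fin n × Fin n → ℕ) : R :=
  ∏ x, p x.1 x.2 ^ e x

theorem pMonomial_add (p : Fin n → Fin n → R) (e e' : Fin n × Fin n → ℕ) :
    pMonomial p (e + e') = pMonomial p e * pMonomial p e' := by
  simp [pMonomial, pow_add, Finset.prod_mul_distrib]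

theorem pMonomial_sum (p : Fin n → Fin n → R) {ι : Type*} (s : Finset ι)
    (e : ι → Fin n × Fin n → ℕ) :
    pMonomial p (∑ i ∈ s, e i) = ∏ i ∈ s, pMonomial p (e i) := by
  simp only [pMonomial, Finset.sum_apply]
  rw [Finset.prod_comm]
  exact Finset.prod_congr rfl fun x _ => (Finset.prod_pow_eq_pow_sum _ _ _).symm

theorem pMonomial_nsmul (p : Fin n → Fin n → R) (r : ℕ) (e : Fin n × Fin n → ℕ) :
    pMonomial p (r • e) = pMonomial p e ^ r := by
  simp only [pMonomial, Pi.smul_apply, smul_eq_mul, ← Finset.prod_pow, ← pow_mul, mul_comm]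

theorem pMonomial_single (p : Fin n → Fin n → R) (x : Fin n × Fin n) :
    pMonomial p (Pi.single x 1) = p x.1 x.2 := by
  rw [pMonomial, Finset.prod_eq_single x]
  · simp
  · intro b _ hb
    simp [hb]
  · simp

/-- The exponents of the double braiding of all pairs of letters in a word of degree `l`. -/
def twistExp (l : Fin n → ℕ) : Fin n × Fin n → ℕ :=
  fun x => l x.1 * (l x.2 - if x.1 = x.2 then 1 else 0)

/-- The exponents of the braiding of the first letter of `w` past the other letters. -/
def headExp {d : ℕ} (w : Fin (d + 1) → Fin n) : Fin n × Fin n → ℕ :=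
  fun x => if w 0 = x.1 then wordDeg w x.2 - if x.1 = x.2 then 1 else 0 else 0

theorem wordChar_eq_prod_pow (p : Fin n → Fin n → R) (i : Fin n) {d : ℕ} (w : Fin d → Fin n) :
    wordChar p i w = ∏ a, p i a ^ wordDeg w a := by
  rw [wordChar, ← Finset.prod_fiberwise _ w]
  refine Finset.prod_congr rfl fun a _ => ?_
  rw [wordDeg, ← Finset.prod_const]
  refine Finset.prod_congr rfl fun k hk => ?_
  rw [(Finset.mem_filter.1 hk).2]

theorem pMonomial_headExp (p : Fin n → Fin n → R) {d : ℕ} (w : Fin (d + 1) → Fin n) :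
    pMonomial p (headExp w) = wordChar p (w 0) (Fin.tail w) := by
  induction w using Fin.consCases with
  | cons i s =>
  rw [pMonomial, Fintype.prod_prod_type, Finset.prod_eq_single i]
  · rw [wordChar_eq_prod_pow]
    refine Finset.prod_congr rfl fun a _ => ?_
    simp [headExp, wordDeg_cons, Pi.single_apply, eq_comm]
  · intro b _ hb
    simp [headExp, hb.symm]
  · simp

theorem sum_range_rotateWord_zero {d : ℕ} (w : Fin (d + 1) → Fin n) {M : Type*} [AddCommMonoid M]
    (F : Fin n → M) :
    ∑ i ∈ Finset.range (d + 1), F ((rotateWord n (d + 1))^[i] w 0) = ∑ k, F (w k) := by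
  rw [Finset.sum_range]
  refine Finset.sum_congr rfl fun k _ => ?_
  rw [rotateWord_iterate_apply]
  simp

/-- During a full turn each letter comes to the head exactly once and is braided past all the
others, so every ordered pair of positions is met once. -/
theorem sum_headExp {d : ℕ} (w : Fin (d + 1) → Fin n) :
    ∑ i ∈ Finset.range (d + 1), headExp ((rotateWord n (d + 1))^[i] w) = twistExp (wordDeg w) := by
  ext x
  simp only [Finset.sum_apply, headExp, wordDeg_rotateWord_iterate]
  rw [sum_range_rotateWord_zero w fun a =>
    if a = x.1 then wordDeg w x.2 - if x.1 = x.2 then 1 else 0 else 0]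
  rw [← Finset.sum_filter, Finset.sum_const, twistExp, smul_eq_mul]
  rfl

/-- The exponents of `twistedWeight`. -/
def twistedHeadExp {d : ℕ} (j : Fin n) (w : Fin (d + 1) → Fin n) : Fin n × Fin n → ℕ :=
  headExp w + (Pi.single (w 0, j) 1 + Pi.single (j, w 0) 1)

theorem pMonomial_twistedHeadExp (p : Fin n → Fin n → R) (j : Fin n) {d : ℕ}
    (w : Fin (d + 1) → Fin n) : pMonomial p (twistedHeadExp j w) = twistedWeight p j w := by
  rw [twistedHeadExp, pMonomial_add, pMonomial_add, pMonomial_single, pMonomial_single,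
    pMonomial_headExp, twistedWeight]

/-- The double braidings with the fixed last letter `j` supply the pairs involving it. Thus T yields
the same monomial σ as R does, for the degree of the whole word. -/
theorem sum_twistedHeadExp {d : ℕ} (j : Fin n) (w : Fin (d + 1) → Fin n) :
    ∑ i ∈ Finset.range (d + 1), twistedHeadExp j ((rotateWord n (d + 1))^[i] w) =
      twistExp (wordDeg w + Pi.single j 1) := by
  simp only [twistedHeadExp, Finset.sum_add_distrib]
  rw [sum_headExp, sum_range_rotateWord_zero w (fun a => (Pi.single (a, j) 1 : _ → ℕ)),
    sum_range_rotateWord_zero w (fun a => (Pi.single (j, a) 1 : _ → ℕ))]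
  have h1 : ∀ a b, (∑ k, (Pi.single (w k, j) 1 : _ → ℕ)) (a, b) =
      if b = j then wordDeg w a else 0 := by
    intro a b
    simp only [Finset.sum_apply, Pi.single_apply, Prod.mk.injEq, wordDeg_eq_sum]
    split_ifs with h <;> simp [h, eq_comm]
  have h2 : ∀ a b, (∑ k, (Pi.single (j, w k) 1 : _ → ℕ)) (a, b) =
      if a = j then wordDeg w b else 0 := by
    intro a b
    simp only [Finset.sum_apply, Pi.single_apply, Prod.mk.injEq, wordDeg_eq_sum]
    split_ifs with h <;> simp [h, eq_comm]
  ext ⟨a, b⟩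
  simp only [Pi.add_apply, h1, h2, twistExp, Pi.single_apply]
  by_cases hab : a = b
  · subst hab
    by_cases haj : a = j
    · simp only [haj, if_true]
      cases wordDeg w j <;> simp; ring
    · simp [haj]
  · by_cases haj : a = j
    · have : b ≠ j := fun h => hab (haj.trans h.symm)
      simp [haj, this, this.symm]
      ring
    · by_cases hbj : b = j
      · simp [haj, hbj]
        ring
      · simp [hab, haj, hbj]

theorem sum_range_minimalPeriod {d : ℕ} {M : Type*} [AddCommMonoid M]
    (E : (Fin (d + 1) → Fin n) → M) (w : Fin (d + 1) → Fin n) :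
    rootOrder w • ∑ i ∈ Finset.range (Function.minimalPeriod (rotateWord n (d + 1)) w),
      E ((rotateWord n (d + 1))^[i] w) =
    ∑ i ∈ Finset.range (d + 1), E ((rotateWord n (d + 1))^[i] w) := by
  set f := rotateWord n (d + 1)
  set L := Function.minimalPeriod f w with hL
  have key : ∀ r, ∑ i ∈ Finset.range (L * r), E (f^[i] w) =
      r • ∑ i ∈ Finset.range L, E (f^[i] w) := by
    intro r
    induction r with
    | zero => simp
    | succ r ih =>
      rw [mul_add, mul_one, Finset.sum_range_add, ih, add_smul, one_smul]
      congr 1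
      refine Finset.sum_congr rfl fun i _ => ?_
      rw [add_comm (L * r), Function.iterate_add_apply]
      congr 2
      exact ((Function.isPeriodicPt_minimalPeriod f w).mul_const r)
  rw [← key, hL, minimalPeriod_mul_rootOrder]

/-- A full turn runs `rootOrder w` times through the period, so the exponents over one period are an
exact quotient. This is the meaning of σ^(1/r). -/
theorem prod_range_minimalPeriod_pMonomial (p : Fin n → Fin n → R) {d : ℕ}
    (E : (Fin (d + 1) → Fin n) → Fin n × Fin n → ℕ) (e : Fin n × Fin n → ℕ)
    (w : Fin (d + 1) → Fin n)
    (he : ∑ i ∈ Finset.range (d + 1), E ((rotateWord n (d + 1))^[i] w) = e) :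
    ∏ i ∈ Finset.range (Function.minimalPeriod (rotateWord n (d + 1)) w),
      pMonomial p (E ((rotateWord n (d + 1))^[i] w)) =
    pMonomial p (fun x => e x / rootOrder w) := by
  rw [← pMonomial_sum]
  congr 1
  ext x
  rw [← he, ← sum_range_minimalPeriod E w, Pi.smul_apply, smul_eq_mul,
    Nat.mul_div_cancel_left _ (rootOrder_pos w)]

theorem det_one_sub_rotationMatrix_pow (p : Fin n → Fin n → R) (d : ℕ) :
    (1 - rotationMatrix p d).det ^ (d + 1) = ∏ w : Fin (d + 1) → Fin n,
      (1 - pMonomial p (fun x => twistExp (wordDeg w) x / rootOrder w)) ^ rootOrder w := by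
  rw [rotationMatrix, det_one_sub_weightedPerm_pow _ _ _ rotateWord_iterate_self]
  refine Finset.prod_congr rfl fun w _ => ?_
  rw [← prod_range_minimalPeriod_pMonomial p headExp _ w (sum_headExp w)]
  simp only [pMonomial_headExp, rootOrder]

theorem det_one_sub_twistedWeight_pow (p : Fin n → Fin n → R) (d : ℕ) (j : Fin n) :
    (1 - weightedPerm (rotateWord n (d + 1)) (twistedWeight p j)).det ^ (d + 1) =
      ∏ w : Fin (d + 1) → Fin n, (1 - pMonomial p
        (fun x => twistExp (wordDeg w + Pi.single j 1) x / rootOrder w)) ^ rootOrder w := by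
  rw [det_one_sub_weightedPerm_pow _ _ _ rotateWord_iterate_self]
  refine Finset.prod_congr rfl fun w _ => ?_
  rw [← prod_range_minimalPeriod_pMonomial p (twistedHeadExp j) _ w (sum_twistedHeadExp j w)]
  simp only [pMonomial_twistedHeadExp, rootOrder]

end Degrees

/-! ### Counting words -/

section Counting

variable {n : ℕ}

/-- Pascal's rule: after multiplication by ∏ (l a)!, the summand of `i` becomes l_i · (|l| - 1)!.
Removal of the first letter of a word gives the same recursion for the number of words. -/
theorem multinomial_eq_sum_sub_single (l : Fin n → ℕ) (hl : ∑ a, l a ≠ 0) :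
    Nat.multinomial Finset.univ l =
      ∑ i with 0 < l i, Nat.multinomial Finset.univ (l - Pi.single i 1) := by
  have hpos : 0 < ∏ a, (l a).factorial := Finset.prod_pos fun a _ => Nat.factorial_pos _
  refine Nat.eq_of_mul_eq_mul_left hpos ?_
  rw [Nat.multinomial_spec, Finset.mul_sum]
  have key : ∀ i ∈ ({i | 0 < l i} : Finset (Fin n)),
      (∏ a, (l a).factorial) * Nat.multinomial Finset.univ (l - Pi.single i 1) =
        l i * (∑ a, l a - 1).factorial := by
    intro i hi
    have hi : 0 < l i := by simpa using hi
    obtain ⟨m, hm⟩ : ∃ m, m = l - Pi.single i 1 := ⟨_, rfl⟩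
    have hmi : m i = l i - 1 := by simp [hm]
    have hma : ∀ a ∈ Finset.univ.erase i, m a = l a := fun a ha => by
      simp [hm, Finset.ne_of_mem_erase ha]
    rw [← hm]
    have h1 : (∏ a, (l a).factorial) = l i * ∏ a, (m a).factorial := by
      rw [← Finset.mul_prod_erase _ _ (Finset.mem_univ i),
        ← Finset.mul_prod_erase _ (fun a => (m a).factorial) (Finset.mem_univ i), ← mul_assoc,
        hmi, Nat.mul_factorial_pred hi.ne']
      congr 1
      exact Finset.prod_congr rfl fun a ha => by rw [hma a ha]
    have h2 : ∑ a, m a = ∑ a, l a - 1 := by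
      rw [← Finset.add_sum_erase _ _ (Finset.mem_univ i),
        ← Finset.add_sum_erase _ l (Finset.mem_univ i), Finset.sum_congr rfl hma, hmi]
      exact (Nat.sub_add_comm hi).symm
    rw [h1, mul_assoc, Nat.multinomial_spec, h2]
  rw [Finset.sum_congr rfl key, ← Finset.sum_mul]
  have : ∑ i with 0 < l i, l i = ∑ a, l a := by
    refine Finset.sum_subset (Finset.filter_subset _ _) fun a _ ha => ?_
    simpa using ha
  rw [this, Nat.mul_factorial_pred hl]

theorem card_wordDeg_eq {d : ℕ} (l : Fin n → ℕ) (hl : ∑ a, l a = d) :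
    ({w | wordDeg w = l} : Finset (Fin d → Fin n)).card = Nat.multinomial Finset.univ l := by
  induction d generalizing l with
  | zero =>
    have h0 : l = 0 := by
      ext a
      exact (Finset.sum_eq_zero_iff.1 hl) a (Finset.mem_univ a)
    have h1 : ∀ w : Fin 0 → Fin n, wordDeg w = l := by
      intro w
      ext a
      simp [wordDeg, h0]
    simp [h1, h0, Nat.multinomial]
  | succ d ih =>
    rw [multinomial_eq_sum_sub_single l (by omega), Finset.card_filter, sum_cons,
      Finset.sum_filter]
    refine Finset.sum_congr rfl fun i _ => ?_
    rw [← Finset.card_filter]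
    split_ifs with hi
    · rw [← ih]
      · congr 1
        ext s
        simp only [Finset.mem_filter, Finset.mem_univ, true_and, wordDeg_cons]
        constructor
        · rintro rfl
          simp
        · rintro h
          rw [h]
          ext a
          by_cases ha : a = i
          · subst ha
            simp
            omega
          · simp [ha]
      · have : l = (l - Pi.single i 1) + Pi.single i 1 := by
          ext a
          by_cases ha : a = i
          · subst ha
            simp
            omega
          · simp [ha]
        rw [this] at hl
        simp only [Pi.add_apply, Finset.sum_add_distrib, Finset.sum_pi_single', Finset.mem_univ,
          if_true] at hl
        omega
    · rw [Finset.card_eq_zero, Finset.filter_eq_empty_iff]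
      rintro s - rfl
      simp [wordDeg_cons] at hi

theorem dvd_rootOrder_iff {d r L : ℕ} (hrL : r * L = d + 1) (w : Fin (d + 1) → Fin n) :
    r ∣ rootOrder w ↔ (rotateWord n (d + 1))^[L] w = w := by
  have h := minimalPeriod_mul_rootOrder w
  rw [show ((rotateWord n (d + 1))^[L] w = w) ↔ Function.IsPeriodicPt (rotateWord n (d + 1)) L w
    from Iff.rfl, Function.isPeriodicPt_iff_minimalPeriod_dvd]
  have hr : 0 < r := Nat.pos_of_ne_zero (by rintro rfl; omega)
  have hM : 0 < Function.minimalPeriod (rotateWord n (d + 1)) w :=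
    Nat.pos_of_ne_zero (by intro h0; rw [h0] at h; omega)
  constructor
  · rintro ⟨t, ht⟩
    refine ⟨t, Nat.eq_of_mul_eq_mul_left hr ?_⟩
    rw [hrL]
    refine h.symm.trans ?_
    rw [ht]
    ring
  · rintro ⟨t, ht⟩
    refine ⟨t, Nat.eq_of_mul_eq_mul_left hM ?_⟩
    rw [h]
    refine hrL.symm.trans ?_
    rw [mul_left_comm, ← ht]

/-- The `r`-th power of a word of length `L`, where `r * L = d`. -/
def powWord {r L d : ℕ} (h : r * L = d) (u : Fin L → Fin n) : Fin d → Fin n :=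
  fun k => u ((finProdFinEquiv (m := r) (n := L)).symm (Fin.cast h.symm k)).2

theorem wordDeg_powWord {r L d : ℕ} (h : r * L = d) (u : Fin L → Fin n) :
    wordDeg (powWord h u) = r • wordDeg u := by
  subst h
  ext a
  simp only [wordDeg_eq_sum, powWord, Pi.smul_apply, Fin.cast_refl, id]
  rw [← finProdFinEquiv.sum_comp]
  simp only [Equiv.symm_apply_apply, Fintype.sum_prod_type]
  trans ∑ _x : Fin r, ∑ k, if u k = a then 1 else 0
  · exact Finset.sum_congr rfl fun x _ => Finset.sum_congr rfl fun y _ => by congr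
  · rw [Finset.sum_const, Finset.card_univ, Fintype.card_fin]

theorem powWord_apply {r L d : ℕ} (h : r * L = d) (u : Fin L → Fin n) (k : Fin d)
    (hk : k.val % L < L) : powWord h u k = u ⟨k.val % L, hk⟩ := rfl

/-- A word invariant under rotation by `L` is the `r`-th power of its first `L` letters. -/
theorem card_dvd_rootOrder_eq {d r L : ℕ} (hrL : r * L = d + 1) (l : Fin n → ℕ) :
    ({w | wordDeg w = l ∧ r ∣ rootOrder w} : Finset (Fin (d + 1) → Fin n)).card =
      ({u | r • wordDeg u = l} : Finset (Fin L → Fin n)).card := by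
  have hL : 0 < L := Nat.pos_of_ne_zero (by rintro rfl; omega)
  have hLd : L ∣ d + 1 := ⟨r, by rw [mul_comm, hrL]⟩
  symm
  refine Finset.card_bij (fun u _ => powWord hrL u) ?_ ?_ ?_
  · intro u hu
    simp only [Finset.mem_filter, Finset.mem_univ, true_and] at hu ⊢
    refine ⟨by rw [wordDeg_powWord, hu], ?_⟩
    rw [dvd_rootOrder_iff hrL]
    ext k
    rw [rotateWord_iterate_apply, powWord_apply _ _ _ (Nat.mod_lt _ hL),
      powWord_apply _ _ _ (Nat.mod_lt _ hL)]
    congr 2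
    ext
    simp [Fin.val_add, Nat.mod_mod_of_dvd _ hLd]
  · intro u _ u' _ h
    ext k
    have hk : k.val < d + 1 := lt_of_lt_of_le k.2 (Nat.le_of_dvd (by omega) hLd)
    have := congrFun h ⟨k, hk⟩
    rw [powWord_apply _ _ _ (Nat.mod_lt _ hL), powWord_apply _ _ _ (Nat.mod_lt _ hL)] at this
    simp only [Nat.mod_eq_of_lt k.2] at this
    exact congrArg Fin.val this
  · intro w hw
    simp only [Finset.mem_filter, Finset.mem_univ, true_and] at hw
    obtain ⟨hdeg, hr⟩ := hw
    rw [dvd_rootOrder_iff hrL] at hr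
    have hle : L ≤ d + 1 := Nat.le_of_dvd (by omega) hLd
    have hw : powWord hrL (fun k : Fin L => w (Fin.castLE hle k)) = w := by
      ext k
      rw [powWord_apply _ _ _ (Nat.mod_lt _ hL)]
      -- Evaluating this rotation at position k mod L reads off the letter at position k.
      have h1 : (rotateWord n (d + 1))^[L * (k.val / L)] w = w :=
        Function.IsPeriodicPt.mul_const hr _
      conv_lhs => rw [← h1]
      rw [rotateWord_iterate_apply]
      congr 2
      ext
      simp only [Fin.val_add, Fin.val_castLE, Fin.val_ofNat, Nat.add_mod_mod, Nat.mod_add_div]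
      exact Nat.mod_eq_of_lt k.2
    refine ⟨fun k => w (Fin.castLE hle k), ?_, hw⟩
    simp only [Finset.mem_filter, Finset.mem_univ, true_and]
    rw [← wordDeg_powWord hrL, hw, hdeg]

theorem dvd_wordDeg {d r : ℕ} (w : Fin (d + 1) → Fin n) (h : r ∣ rootOrder w) (a : Fin n) :
    r ∣ wordDeg w a := by
  obtain ⟨L, hL⟩ := h.trans (rootOrder_dvd w)
  have := card_dvd_rootOrder_eq hL.symm (wordDeg w)
  have hpos : 0 < ({v | wordDeg v = wordDeg w ∧ r ∣ rootOrder v} :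
      Finset (Fin (d + 1) → Fin n)).card := Finset.card_pos.2 ⟨w, by simpa using h⟩
  rw [this] at hpos
  obtain ⟨u, hu⟩ := Finset.card_pos.1 hpos
  simp only [Finset.mem_filter, Finset.mem_univ, true_and] at hu
  rw [← hu]
  simp

theorem card_dvd_rootOrder {d r : ℕ} (l : Fin n → ℕ) (hl : ∑ a, l a = d + 1)
    (hr : ∀ a, r ∣ l a) :
    ({w | wordDeg w = l ∧ r ∣ rootOrder w} : Finset (Fin (d + 1) → Fin n)).card =
      Nat.multinomial Finset.univ (fun a => l a / r) := by
  obtain ⟨L, hL⟩ : r ∣ d + 1 := hl ▸ Finset.dvd_sum fun a _ => hr a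
  have hr0 : 0 < r := Nat.pos_of_ne_zero (by rintro rfl; omega)
  rw [card_dvd_rootOrder_eq hL.symm, ← card_wordDeg_eq (d := L)]
  · congr 1
    ext u
    simp only [Finset.mem_filter, Finset.mem_univ, true_and, funext_iff, Pi.smul_apply, smul_eq_mul]
    refine forall_congr' fun a => ?_
    obtain ⟨t, ht⟩ := hr a
    rw [ht, Nat.mul_div_cancel_left _ hr0]
    exact Nat.mul_right_inj hr0.ne'
  · rw [← Nat.sum_div fun a _ => hr a, hl, hL, Nat.mul_div_cancel_left _ hr0]

end Counting

/-! ### Products over all words of a given degree -/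

section RootProducts

variable {n : ℕ} {R : Type*} [CommRing R]

/-- The product of the `g r ^ r` over all words of length `d` and degree `l`, where the word is a
proper `r`-th power. -/
noncomputable def rootProd (g : ℕ → R) (d : ℕ) (l : Fin n → ℕ) : R :=
  ∏ w : Fin d → Fin n with wordDeg w = l, g (rootOrder w) ^ rootOrder w

/-- The product of the `rootProd` over all degrees obtained by removing a letter from `l`. -/
noncomputable def deletionProd (g : ℕ → R) (d : ℕ) (l : Fin n → ℕ) : R :=
  ∏ j with 0 < l j, rootProd g d (l - Pi.single j 1)

theorem rootProd_of_coprime (g : ℕ → R) {d : ℕ} {l : Fin n → ℕ} (hl : ∑ a, l a = d + 1)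
    (h : ∀ r, (∀ a, r ∣ l a) → r = 1) :
    rootProd g (d + 1) l = g 1 ^ Nat.multinomial Finset.univ l := by
  rw [← card_wordDeg_eq l hl, rootProd, ← Finset.prod_const]
  refine Finset.prod_congr rfl fun w hw => ?_
  have hw : wordDeg w = l := by simpa using hw
  rw [h (rootOrder w) fun a => hw ▸ dvd_wordDeg w dvd_rfl a, pow_one]

/-- The hypothesis `h` says that no admissible root order lies strictly between `s` and the
multiples of `r`. So the words in question have root order exactly `s`, and they are counted by a
difference of two multinomials. -/
theorem prod_not_dvd_rootOrder (g : ℕ → R) {d r s : ℕ} {l : Fin n → ℕ} (hl : ∑ a, l a = d + 1)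
    (hr : ∀ a, r ∣ l a) (hs : ∀ a, s ∣ l a) (hsr : s ∣ r)
    (h : ∀ t, (∀ a, t ∣ l a) → s ∣ t → t = s ∨ r ∣ t) :
    ∏ w : Fin (d + 1) → Fin n with (wordDeg w = l ∧ s ∣ rootOrder w) ∧ ¬ r ∣ rootOrder w,
      g (rootOrder w) ^ rootOrder w =
    g s ^ (s * (Nat.multinomial Finset.univ (fun a => l a / s) -
      Nat.multinomial Finset.univ (fun a => l a / r))) := by
  have hcard : ({w : Fin (d + 1) → Fin n | (wordDeg w = l ∧ s ∣ rootOrder w) ∧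
      ¬ r ∣ rootOrder w} : Finset _).card = Nat.multinomial Finset.univ (fun a => l a / s) -
      Nat.multinomial Finset.univ (fun a => l a / r) := by
    rw [← card_dvd_rootOrder l hl hr, ← card_dvd_rootOrder l hl hs]
    rw [← Finset.card_filter_add_card_filter_not (s := {w : Fin (d + 1) → Fin n | wordDeg w = l ∧
      s ∣ rootOrder w}) (fun w => r ∣ rootOrder w)]
    rw [Finset.filter_filter, Finset.filter_filter]
    have : ({w : Fin (d + 1) → Fin n | (wordDeg w = l ∧ s ∣ rootOrder w) ∧ r ∣ rootOrder w} :
        Finset _) = ({w : Fin (d + 1) → Fin n | wordDeg w = l ∧ r ∣ rootOrder w} : Finset _) := by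
      ext w
      simp only [Finset.mem_filter, Finset.mem_univ, true_and]
      constructor
      · rintro ⟨⟨h1, -⟩, h2⟩
        exact ⟨h1, h2⟩
      · rintro ⟨h1, h2⟩
        exact ⟨⟨h1, hsr.trans h2⟩, h2⟩
    rw [this]
    omega
  rw [pow_mul, ← hcard, ← Finset.prod_const]
  refine Finset.prod_congr rfl fun w hw => ?_
  simp only [Finset.mem_filter, Finset.mem_univ, true_and] at hw
  obtain ⟨⟨h1, h2⟩, h3⟩ := hw
  rw [(h (rootOrder w) (fun a => h1 ▸ dvd_wordDeg w dvd_rfl a) h2).resolve_right h3]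

theorem prod_dvd_rootOrder (g : ℕ → R) {d r : ℕ} {l : Fin n → ℕ} (hl : ∑ a, l a = d + 1)
    (hr : ∀ a, r ∣ l a) (h : ∀ t, (∀ a, t ∣ l a) → r ∣ t → t = r) :
    ∏ w : Fin (d + 1) → Fin n with wordDeg w = l ∧ r ∣ rootOrder w,
      g (rootOrder w) ^ rootOrder w =
    g r ^ (r * Nat.multinomial Finset.univ (fun a => l a / r)) := by
  rw [pow_mul, ← card_dvd_rootOrder l hl hr, ← Finset.prod_const]
  refine Finset.prod_congr rfl fun w hw => ?_
  simp only [Finset.mem_filter, Finset.mem_univ, true_and] at hw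
  rw [h (rootOrder w) (fun a => hw.1 ▸ dvd_wordDeg w dvd_rfl a) hw.2]

theorem rootProd_split (g : ℕ → R) {d r s : ℕ} (l : Fin n → ℕ) (hsr : s ∣ r) :
    ∏ w : Fin (d + 1) → Fin n with wordDeg w = l ∧ s ∣ rootOrder w,
      g (rootOrder w) ^ rootOrder w =
    (∏ w : Fin (d + 1) → Fin n with wordDeg w = l ∧ r ∣ rootOrder w,
      g (rootOrder w) ^ rootOrder w) *
    ∏ w : Fin (d + 1) → Fin n with (wordDeg w = l ∧ s ∣ rootOrder w) ∧ ¬ r ∣ rootOrder w,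
      g (rootOrder w) ^ rootOrder w := by
  rw [← Finset.prod_filter_mul_prod_filter_not _ (fun w => r ∣ rootOrder w), Finset.filter_filter,
    Finset.filter_filter]
  congr 2
  ext w
  simp only [Finset.mem_filter, Finset.mem_univ, true_and]
  constructor
  · rintro ⟨⟨h1, -⟩, h2⟩
    exact ⟨h1, h2⟩
  · rintro ⟨h1, h2⟩
    exact ⟨⟨h1, hsr.trans h2⟩, h2⟩

theorem rootProd_eq_one_dvd (g : ℕ → R) (d : ℕ) (l : Fin n → ℕ) :
    rootProd g d l = ∏ w : Fin d → Fin n with wordDeg w = l ∧ 1 ∣ rootOrder w,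
      g (rootOrder w) ^ rootOrder w := by
  simp [rootProd]

/-- The case in which the common divisors of `l` are `1` and `r`. -/
theorem rootProd_of_two_divisors (g : ℕ → R) {d r : ℕ} {l : Fin n → ℕ} (hl : ∑ a, l a = d + 1)
    (hr : ∀ a, r ∣ l a) (h : ∀ t, (∀ a, t ∣ l a) → t = 1 ∨ t = r) :
    rootProd g (d + 1) l =
      g r ^ (r * Nat.multinomial Finset.univ (fun a => l a / r)) *
        g 1 ^ (Nat.multinomial Finset.univ l - Nat.multinomial Finset.univ (fun a => l a / r)) := by
  rw [rootProd_eq_one_dvd, rootProd_split g l (one_dvd r), prod_dvd_rootOrder g hl hr,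
    prod_not_dvd_rootOrder g hl hr (fun _ => one_dvd _) (one_dvd r)]
  · simp
  · intro t ht _
    rcases h t ht with h | h
    · exact Or.inl h
    · exact Or.inr h.symm.dvd
  · intro t ht htr
    rcases h t ht with h | h
    · subst h
      exact (Nat.dvd_one.1 htr).symm
    · exact h

/-- The case in which the common divisors of `l` are `1`, `2` and `4`. -/
theorem rootProd_of_dvd_four (g : ℕ → R) {d : ℕ} {l : Fin n → ℕ} (hl : ∑ a, l a = d + 1)
    (hr : ∀ a, 4 ∣ l a) (h : ∀ t, (∀ a, t ∣ l a) → t ∣ 4) :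
    rootProd g (d + 1) l =
      g 4 ^ (4 * Nat.multinomial Finset.univ (fun a => l a / 4)) *
        g 2 ^ (2 * (Nat.multinomial Finset.univ (fun a => l a / 2) -
          Nat.multinomial Finset.univ (fun a => l a / 4))) *
        g 1 ^ (Nat.multinomial Finset.univ l - Nat.multinomial Finset.univ (fun a => l a / 2)) := by
  have h2 : ∀ a, 2 ∣ l a := fun a => (by norm_num : 2 ∣ 4).trans (hr a)
  have key : ∀ t, (∀ a, t ∣ l a) → t = 1 ∨ t = 2 ∨ t = 4 := by
    intro t ht
    have h4 := h t ht
    have : t ≤ 4 := Nat.le_of_dvd (by norm_num) h4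
    clear ht h hr
    interval_cases t <;> revert h4 <;> decide
  rw [rootProd_eq_one_dvd, rootProd_split g l (one_dvd 2),
    rootProd_split g l (by norm_num : 2 ∣ 4), prod_dvd_rootOrder g hl hr,
    prod_not_dvd_rootOrder g hl hr h2 (by norm_num),
    prod_not_dvd_rootOrder g hl h2 (fun _ => one_dvd _) (one_dvd _)]
  · simp
  · intro t ht _
    rcases key t ht with h | h | h <;> simp [h]
  · intro t ht h'
    rcases key t ht with h | h | h
    · simp [h] at h'
    · exact Or.inl h
    · simp [h]
  · intro t ht h'
    exact Nat.dvd_antisymm (h t ht) h'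

theorem rootProd_single (g : ℕ → R) {d : ℕ} (i : Fin n) :
    rootProd g (d + 1) (Pi.single i (d + 1)) = g (d + 1) ^ (d + 1) := by
  have hl : ∑ a, (Pi.single i (d + 1) : Fin n → ℕ) a = d + 1 := by simp
  have hdvd : ∀ a, d + 1 ∣ (Pi.single i (d + 1) : Fin n → ℕ) a := by
    intro a
    by_cases h : a = i
    · subst h; simp
    · simp [h]
  have hm : ∀ m, Nat.multinomial Finset.univ (Pi.single i m : Fin n → ℕ) = 1 := by
    intro m
    have := Nat.multinomial_spec (Finset.univ : Finset (Fin n)) (Pi.single i m : Fin n → ℕ)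
    rw [Finset.prod_eq_single i (by intro b _ hb; simp [hb]) (by simp)] at this
    simp only [Pi.single_eq_same, Finset.sum_pi_single', Finset.mem_univ, if_true] at this
    exact Nat.eq_of_mul_eq_mul_left (Nat.factorial_pos m) (by rw [this, mul_one])
  have h1 : (fun a => (Pi.single i (d + 1) : Fin n → ℕ) a / (d + 1)) = Pi.single i 1 := by
    ext a
    by_cases h : a = i
    · subst h; simp
    · simp [h]
  -- Both sets have one element, so the constant word has maximal root order.
  have hall : ({w | wordDeg w = Pi.single i (d + 1) ∧ d + 1 ∣ rootOrder w} :
      Finset (Fin (d + 1) → Fin n)) = ({w | wordDeg w = Pi.single i (d + 1)} : Finset _) := by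
    refine Finset.eq_of_subset_of_card_le ?_ ?_
    · intro w
      simp +contextual
    · rw [card_dvd_rootOrder _ hl hdvd, card_wordDeg_eq _ hl, h1, hm, hm]
  rw [rootProd, ← hall, prod_dvd_rootOrder g hl hdvd, h1, hm, mul_one]
  intro t ht h
  exact Nat.dvd_antisymm (by simpa using ht i) h

/-! ### Degrees with two letters -/

/-- The degree `a e_i + b e_j`. -/
def twoDeg (i j : Fin n) (a b : ℕ) : Fin n → ℕ := Pi.single i a + Pi.single j b

variable {i j : Fin n}

theorem twoDeg_comm (a b : ℕ) : twoDeg i j a b = twoDeg j i b a := add_comm _ _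

theorem sum_twoDeg (a b : ℕ) : ∑ c, twoDeg i j a b c = a + b := by
  simp [twoDeg, Finset.sum_add_distrib]

theorem twoDeg_left (hij : i ≠ j) (a b : ℕ) : twoDeg i j a b i = a := by
  simp [twoDeg, hij]

theorem twoDeg_right (hij : i ≠ j) (a b : ℕ) : twoDeg i j a b j = b := by
  simp [twoDeg, hij.symm]

theorem twoDeg_of_ne {c : Fin n} (hi : c ≠ i) (hj : c ≠ j) (a b : ℕ) : twoDeg i j a b c = 0 := by
  simp [twoDeg, hi, hj]

theorem forall_dvd_twoDeg (hij : i ≠ j) {a b r : ℕ} :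
    (∀ c, r ∣ twoDeg i j a b c) ↔ r ∣ a ∧ r ∣ b := by
  constructor
  · intro h
    exact ⟨twoDeg_left hij a b ▸ h i, twoDeg_right hij a b ▸ h j⟩
  · rintro ⟨h1, h2⟩ c
    by_cases hi : c = i
    · rw [hi, twoDeg_left hij]; exact h1
    · by_cases hj : c = j
      · rw [hj, twoDeg_right hij]; exact h2
      · simp [twoDeg_of_ne hi hj]

theorem twoDeg_div (hij : i ≠ j) (a b r : ℕ) :
    (fun c => twoDeg i j a b c / r) = twoDeg i j (a / r) (b / r) := by
  ext c
  by_cases hi : c = i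
  · rw [hi, twoDeg_left hij, twoDeg_left hij]
  · by_cases hj : c = j
    · rw [hj, twoDeg_right hij, twoDeg_right hij]
    · simp [twoDeg_of_ne hi hj]

theorem multinomial_twoDeg (hij : i ≠ j) (a b : ℕ) :
    Nat.multinomial Finset.univ (twoDeg i j a b) = (a + b).choose a := by
  have h := Nat.multinomial_spec (Finset.univ : Finset (Fin n)) (twoDeg i j a b)
  rw [sum_twoDeg, Finset.prod_eq_mul i j hij (by
    rintro c - ⟨hi, hj⟩; simp [twoDeg_of_ne hi hj]) (by simp) (by simp), twoDeg_left hij,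
    twoDeg_right hij, ← Nat.add_choose_mul_factorial_mul_factorial a b] at h
  have hpos : 0 < a.factorial * b.factorial :=
    Nat.mul_pos (Nat.factorial_pos a) (Nat.factorial_pos b)
  refine Nat.eq_of_mul_eq_mul_left hpos ?_
  rw [h, Nat.choose_symm_add]
  ring

theorem deletionProd_twoDeg (g : ℕ → R) (hij : i ≠ j) (d a b : ℕ) :
    deletionProd g d (twoDeg i j (a + 1) (b + 1)) =
      rootProd g d (twoDeg i j a (b + 1)) * rootProd g d (twoDeg i j (a + 1) b) := by
  have h : ({c | 0 < twoDeg i j (a + 1) (b + 1) c} : Finset (Fin n)) = {i, j} := by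
    ext c
    by_cases hi : c = i
    · subst hi; simp [twoDeg_left hij]
    · by_cases hj : c = j
      · subst hj; simp [twoDeg_right hij]
      · simp [twoDeg_of_ne hi hj, hi, hj]
  rw [deletionProd, h, Finset.prod_pair hij]
  congr 2
  · ext c
    by_cases hi : c = i
    · subst hi; simp [twoDeg_left hij]
    · simp [twoDeg, hi]
  · ext c
    by_cases hj : c = j
    · subst hj; simp [twoDeg_right hij]
    · simp [twoDeg, hj]

theorem pMonomial_twoDeg (p : Fin n → Fin n → R) (hij : i ≠ j) (a b r : ℕ) :
    pMonomial p (fun x => twistExp (twoDeg i j a b) x / r) =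
      p i i ^ (a * (a - 1) / r) * (p i j * p j i) ^ (a * b / r) * p j j ^ (b * (b - 1) / r) := by
  have h0 : ∀ x y, x ∉ ({i, j} : Finset (Fin n)) ∨ y ∉ ({i, j} : Finset (Fin n)) →
      twistExp (twoDeg i j a b) (x, y) = 0 := by
    intro x y h
    rcases h with h | h
    · simp only [Finset.mem_insert, Finset.mem_singleton, not_or] at h
      simp [twistExp, twoDeg_of_ne h.1 h.2]
    · simp only [Finset.mem_insert, Finset.mem_singleton, not_or] at h
      simp [twistExp, twoDeg_of_ne h.1 h.2]
  rw [pMonomial, Fintype.prod_prod_type, Finset.prod_eq_mul i j hij, Finset.prod_eq_mul i j hij,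
    Finset.prod_eq_mul i j hij]
  · simp only [twistExp, twoDeg_left hij, twoDeg_right hij, hij, hij.symm, if_true, if_false,
      Nat.sub_zero, mul_pow, mul_comm b a]
    ring
  · rintro c - hc
    simp [h0 j c (Or.inr (by simpa using hc))]
  · simp
  · simp
  · rintro c - hc
    simp [h0 i c (Or.inr (by simpa using hc))]
  · simp
  · simp
  · rintro c - hc
    refine Finset.prod_eq_one fun y _ => ?_
    simp [h0 c y (Or.inl (by simpa using hc))]
  · simp
  · simp

end RootProducts

/-! ### The exceptional degrees -/

section Exceptional

variable {n : ℕ} {R : Type*} [CommRing R]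

/-- Two ring elements each of which divides a power of the other. -/
def RadEquiv (D P : R) : Prop := (∃ N, D ∣ P ^ N) ∧ ∃ N, P ∣ D ^ N

theorem RadEquiv.map_eq_zero_iff {K : Type*} [Field K] {D P : R} (h : RadEquiv D P)
    (φ : R →+* K) : φ D = 0 ↔ φ P = 0 := by
  have key : ∀ {A B : R} {N : ℕ}, A ∣ B ^ N → φ A = 0 → φ B = 0 := by
    intro A B N hAB hA
    have := map_dvd φ hAB
    rw [hA, map_pow, zero_dvd_iff] at this
    exact eq_zero_of_pow_eq_zero this
  obtain ⟨⟨N, hN⟩, M, hM⟩ := h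
  exact ⟨key hN, key hM⟩

theorem RadEquiv.of_pow {D₀ P : R} {k : ℕ} (hk : k ≠ 0) (N : ℕ) (h₁ : D₀ ∣ P ^ N) (h₂ : P ∣ D₀) :
    RadEquiv (D₀ ^ k) P :=
  ⟨⟨N * k, by rw [pow_mul]; exact pow_dvd_pow_of_dvd h₁ k⟩,
    1, by rw [pow_one]; exact h₂.trans (dvd_pow_self D₀ hk)⟩

/-- The factors `1 - σ ^ (1 / r)`, where `σ` is the double braiding of all pairs of letters in a
word of degree `l`. -/
noncomputable def twistFactor (p : Fin n → Fin n → R) (l : Fin n → ℕ) (r : ℕ) : R :=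
  1 - pMonomial p fun x => twistExp l x / r

/-- The contribution of the degree `l` to the quotient of consecutive determinants is a ring
element with the same zeros as `P`. -/
def HasDegreeRatio (p : Fin n → Fin n → R) (d : ℕ) (l : Fin n → ℕ) (P : R) : Prop :=
  ∃ D, deletionProd (twistFactor p l) (d + 1) l ^ (d + 2) =
    D * rootProd (twistFactor p l) (d + 2) l ^ (d + 1) ∧ RadEquiv D P

variable {i j : Fin n}

theorem rootProd_twoDeg_coprime (g : ℕ → R) (hij : i ≠ j) {a b d : ℕ} (h : a + b = d + 1)
    (hab : Nat.Coprime a b) :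
    rootProd g (d + 1) (twoDeg i j a b) = g 1 ^ (a + b).choose a := by
  rw [rootProd_of_coprime g (by rw [sum_twoDeg, h]), multinomial_twoDeg hij]
  intro r hr
  rw [forall_dvd_twoDeg hij] at hr
  exact Nat.eq_one_of_dvd_coprimes hab hr.1 hr.2

theorem rootProd_twoDeg_prime (g : ℕ → R) (hij : i ≠ j) {a b d r : ℕ} (h : a + b = d + 1)
    (hr : r.Prime) (hab : Nat.gcd a b = r) :
    rootProd g (d + 1) (twoDeg i j a b) =
      g r ^ (r * (a / r + b / r).choose (a / r)) *
        g 1 ^ ((a + b).choose a - (a / r + b / r).choose (a / r)) := by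
  rw [rootProd_of_two_divisors g (by rw [sum_twoDeg, h]) (r := r), multinomial_twoDeg hij,
    twoDeg_div hij, multinomial_twoDeg hij]
  · rw [forall_dvd_twoDeg hij, ← hab]
    exact ⟨Nat.gcd_dvd_left a b, Nat.gcd_dvd_right a b⟩
  · intro t ht
    rw [forall_dvd_twoDeg hij] at ht
    exact (Nat.dvd_prime hr).1 (hab ▸ Nat.dvd_gcd ht.1 ht.2)

theorem twistFactor_twoDeg (p : Fin n → Fin n → R) (hij : i ≠ j) (a b r : ℕ) :
    twistFactor p (twoDeg i j a b) r =
      1 - p i i ^ (a * (a - 1) / r) * (p i j * p j i) ^ (a * b / r) *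
        p j j ^ (b * (b - 1) / r) := by
  rw [twistFactor, pMonomial_twoDeg p hij]

/-- The factors of root order one cancel exactly. What remains comes from deleting `i`, which leaves
the constant word in `j` of root order m + 1. -/
theorem hasDegreeRatio_one (p : Fin n → Fin n → R) (hij : i ≠ j) (m : ℕ) :
    HasDegreeRatio p m (twoDeg i j 1 (m + 1)) (1 - p j j ^ m * (p i j * p j i)) := by
  have hP : twistFactor p (twoDeg i j 1 (m + 1)) (m + 1) = 1 - p j j ^ m * (p i j * p j i) := by
    rw [twistFactor_twoDeg p hij]
    simp
    ring
  refine ⟨twistFactor p (twoDeg i j 1 (m + 1)) (m + 1) ^ ((m + 1) * (m + 2)), ?_, ?_⟩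
  · generalize twistFactor p (twoDeg i j 1 (m + 1)) = g
    have : twoDeg i j 0 (m + 1) = Pi.single j (m + 1) := by simp [twoDeg]
    rw [show 1 = 0 + 1 from rfl, deletionProd_twoDeg g hij, this, rootProd_single, zero_add,
      rootProd_twoDeg_coprime g hij (by omega) (by simp),
      rootProd_twoDeg_coprime g hij (by omega) (by simp)]
    simp only [Nat.choose_one_right]
    ring
  · rw [hP]
    exact RadEquiv.of_pow (by positivity) 1 (by simp) dvd_rfl

theorem choose_two_even (k : ℕ) : (2 * k + 2).choose 2 = (k + 1) * (2 * k + 1) := by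
  rw [Nat.choose_two_right, show (2 * k + 2) * (2 * k + 2 - 1) = ((k + 1) * (2 * k + 1)) * 2 by
    rw [show 2 * k + 2 - 1 = 2 * k + 1 by omega]; ring, Nat.mul_div_cancel _ (by norm_num)]

theorem choose_two_odd (k : ℕ) : (2 * k + 1).choose 2 = k * (2 * k + 1) := by
  rw [Nat.choose_two_right, show (2 * k + 1) * (2 * k + 1 - 1) = (k * (2 * k + 1)) * 2 by
    rw [show 2 * k + 1 - 1 = 2 * k by omega]; ring, Nat.mul_div_cancel _ (by norm_num)]

/-- With y = σ^(1/2), squares occur in degree `l` but not after deleting a letter. They contribute 1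
- y instead of 1 - y², which leaves exactly a power of 1 + y. -/
theorem hasDegreeRatio_two_even (p : Fin n → Fin n → R) (hij : i ≠ j) (k : ℕ) :
    HasDegreeRatio p (2 * k + 2) (twoDeg i j 2 (2 * k + 2))
      (1 + p j j ^ ((2 * k + 2) * (2 * k + 1) / 2) * (-(p i j * p j i)) ^ (2 * k + 2) * p i i) := by
  set y := p i i * (p i j * p j i) ^ (2 * k + 2) * p j j ^ ((k + 1) * (2 * k + 1)) with hy
  have h1 : twistFactor p (twoDeg i j 2 (2 * k + 2)) 1 = (1 - y) * (1 + y) := by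
    rw [twistFactor_twoDeg p hij, hy]
    simp only [Nat.div_one, show 2 * k + 2 - 1 = 2 * k + 1 by omega]
    ring
  have e1 : (2 * k + 2) * (2 * k + 1) / 2 = (k + 1) * (2 * k + 1) := by
    rw [show (2 * k + 2) * (2 * k + 1) = 2 * ((k + 1) * (2 * k + 1)) by ring]
    exact Nat.mul_div_cancel_left _ (by norm_num)
  have h2 : twistFactor p (twoDeg i j 2 (2 * k + 2)) 2 = 1 - y := by
    rw [twistFactor_twoDeg p hij, hy, Nat.mul_div_cancel_left _ (by norm_num),
      show 2 * k + 2 - 1 = 2 * k + 1 by omega, e1]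
    simp
  have hP : 1 + p j j ^ ((2 * k + 2) * (2 * k + 1) / 2) * (-(p i j * p j i)) ^ (2 * k + 2) * p i i =
      1 + y := by
    rw [e1, Even.neg_pow ⟨k + 1, by ring⟩, hy]
    ring
  refine ⟨(1 + y) ^ (2 * (k + 2) * (2 * k + 3)), ?_, ?_⟩
  · revert h1 h2
    generalize twistFactor p (twoDeg i j 2 (2 * k + 2)) = g
    intro h1 h2
    rw [show 2 * k + 2 = (2 * k + 1) + 1 by ring, deletionProd_twoDeg g hij,
      rootProd_twoDeg_coprime g hij (by omega) (by simp),
      rootProd_twoDeg_coprime g hij (by omega) (by simp),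
      rootProd_twoDeg_prime g hij (r := 2) (by omega) Nat.prime_two
        (by rw [show 2 * k + 1 + 1 = 2 * (k + 1) by ring, Nat.gcd_mul_right_right])]
    rw [show (2 * k + 1 + 1) / 2 = k + 1 by omega, h1, h2, Nat.div_self (by norm_num),
      show 2 + (2 * k + 1 + 1) = 2 * (k + 1) + 2 by ring, choose_two_even,
      show 1 + 1 + (2 * k + 1) = 2 * (k + 1) + 1 by ring, choose_two_odd]
    simp only [Nat.choose_one_right]
    rw [show (k + 1 + 1) * (2 * (k + 1) + 1) - (1 + (k + 1)) = (k + 2) * (2 * k + 2) by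
      rw [Nat.sub_eq_iff_eq_add (by nlinarith)]; ring]
    generalize 1 - y = A
    generalize 1 + y = B
    ring
  · rw [hP]
    exact RadEquiv.of_pow (by positivity) 1 (by simp) dvd_rfl

/-- Now squares occur only after deleting a `j`. The factors of root order one cancel, and a power
of 1 - σ^(1/2) remains; the odd exponent turns the plus sign in P into this minus. -/
theorem hasDegreeRatio_two_odd (p : Fin n → Fin n → R) (hij : i ≠ j) (k : ℕ) :
    HasDegreeRatio p (2 * k + 3) (twoDeg i j 2 (2 * k + 3))
      (1 + p j j ^ ((2 * k + 3) * (2 * k + 2) / 2) * (-(p i j * p j i)) ^ (2 * k + 3) * p i i) := by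
  set y := p i i * (p i j * p j i) ^ (2 * k + 3) * p j j ^ ((2 * k + 3) * (k + 1)) with hy
  have e1 : (2 * k + 3) * (2 * k + 2) / 2 = (2 * k + 3) * (k + 1) := by
    rw [show (2 * k + 3) * (2 * k + 2) = 2 * ((2 * k + 3) * (k + 1)) by ring]
    exact Nat.mul_div_cancel_left _ (by norm_num)
  have h2 : twistFactor p (twoDeg i j 2 (2 * k + 3)) 2 = 1 - y := by
    rw [twistFactor_twoDeg p hij, hy, Nat.mul_div_cancel_left _ (by norm_num),
      show 2 * k + 3 - 1 = 2 * k + 2 by omega, e1]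
    simp
  have hP : 1 + p j j ^ ((2 * k + 3) * (2 * k + 2) / 2) * (-(p i j * p j i)) ^ (2 * k + 3) * p i i =
      1 - y := by
    rw [e1, Odd.neg_pow ⟨k + 1, by ring⟩, hy]
    ring
  refine ⟨(1 - y) ^ (2 * (k + 2) * (2 * k + 5)), ?_, ?_⟩
  · revert h2
    generalize twistFactor p (twoDeg i j 2 (2 * k + 3)) = g
    intro h2
    rw [show 2 * k + 3 = (2 * k + 2) + 1 by ring, deletionProd_twoDeg g hij,
      rootProd_twoDeg_coprime g hij (a := 1) (by omega) (by simp),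
      rootProd_twoDeg_coprime g hij (a := 2) (b := 2 * k + 2 + 1) (by omega)
        (by rw [show 2 * k + 2 + 1 = 2 * (k + 1) + 1 by ring]; simp),
      rootProd_twoDeg_prime g hij (a := 1 + 1) (r := 2) (by omega) Nat.prime_two
        (by rw [show 2 * k + 2 = 2 * (k + 1) by ring, Nat.gcd_mul_right_right])]
    rw [show 1 + 1 = 2 from rfl, show (2 * k + 2) / 2 = k + 1 by omega, h2, Nat.div_self (by norm_num),
      show 2 + (2 * k + 2) = 2 * (k + 1) + 2 by ring, choose_two_even,
      show 2 + (2 * k + 2 + 1) = 2 * (k + 2) + 1 by ring, choose_two_odd]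
    simp only [Nat.choose_one_right]
    rw [show (k + 1 + 1) * (2 * (k + 1) + 1) - (1 + (k + 1)) = (k + 2) * (2 * k + 2) by
      rw [Nat.sub_eq_iff_eq_add (by nlinarith)]; ring]
    generalize 1 - y = A
    ring
  · rw [hP]
    exact RadEquiv.of_pow (by positivity) 1 (by simp) dvd_rfl

/-- Cubes in degree `l` lower the denominator by factors 1 + y + y², with y = σ^(1/3); the powers of
1 - y balance. -/
theorem hasDegreeRatio_three_three (p : Fin n → Fin n → R) (hij : i ≠ j) :
    HasDegreeRatio p 4 (twoDeg i j 3 3)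
      (qNumber 3 (p i i ^ 2 * (p i j * p j i) ^ 3 * p j j ^ 2)) := by
  set y := p i i ^ 2 * (p i j * p j i) ^ 3 * p j j ^ 2 with hy
  have h1 : twistFactor p (twoDeg i j 3 3) 1 = (1 - y) * (1 + y + y ^ 2) := by
    rw [twistFactor_twoDeg p hij, hy]
    norm_num
    ring
  have h3 : twistFactor p (twoDeg i j 3 3) 3 = 1 - y := by
    rw [twistFactor_twoDeg p hij, hy]
  have hP : qNumber 3 y = 1 + y + y ^ 2 := by
    simp [qNumber, Finset.sum_range_succ]
  refine ⟨(1 + y + y ^ 2) ^ 30, ?_, ?_⟩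
  · revert h1 h3
    generalize twistFactor p (twoDeg i j 3 3) = g
    intro h1 h3
    rw [deletionProd_twoDeg g hij, rootProd_twoDeg_coprime g hij (by norm_num) (by norm_num),
      rootProd_twoDeg_coprime g hij (by norm_num) (by norm_num),
      rootProd_twoDeg_prime g hij (r := 3) (by norm_num) Nat.prime_three (by norm_num), h1, h3]
    norm_num [Nat.choose]
    simp only [mul_pow, ← pow_mul]
    generalize 1 - y = A
    generalize 1 + y + y ^ 2 = B
    ring
  · rw [hP]
    exact RadEquiv.of_pow (by positivity) 1 (by simp) dvd_rfl

/-- All words of this degree are primitive. Deleting `i` admits squares and deleting `j` admits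
cubes; with y = σ^(1/6) they contribute 1 - y³ and 1 - y². -/
theorem hasDegreeRatio_three_four (p : Fin n → Fin n → R) (hij : i ≠ j) :
    HasDegreeRatio p 5 (twoDeg i j 3 4)
      ((1 - p i i ^ 2 * (p i j * p j i) ^ 4 * p j j ^ 4) *
        qNumber 3 (p i i * (p i j * p j i) ^ 2 * p j j ^ 2)) := by
  set y := p i i * (p i j * p j i) ^ 2 * p j j ^ 2 with hy
  have h2 : twistFactor p (twoDeg i j 3 4) 2 = 1 - y ^ 3 := by
    rw [twistFactor_twoDeg p hij, hy]
    norm_num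
    ring
  have h3 : twistFactor p (twoDeg i j 3 4) 3 = 1 - y ^ 2 := by
    rw [twistFactor_twoDeg p hij, hy]
    norm_num
    ring
  have hP : (1 - p i i ^ 2 * (p i j * p j i) ^ 4 * p j j ^ 4) * qNumber 3 y =
      (1 - y ^ 2) * (1 + y + y ^ 2) := by
    rw [show p i i ^ 2 * (p i j * p j i) ^ 4 * p j j ^ 4 = y ^ 2 by rw [hy]; ring]
    simp [qNumber, Finset.sum_range_succ]
  refine ⟨((1 - y ^ 3) * (1 - y ^ 2)) ^ 42, ?_, ?_⟩
  · revert h2 h3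
    generalize twistFactor p (twoDeg i j 3 4) = g
    intro h2 h3
    rw [deletionProd_twoDeg g hij 6 2 3, rootProd_twoDeg_coprime g hij (a := 3) (b := 4)
      (by norm_num) (by norm_num),
      rootProd_twoDeg_prime g hij (a := 2 + 1) (b := 3) (r := 3) (by norm_num) Nat.prime_three
        (by norm_num),
      rootProd_twoDeg_prime g hij (a := 2) (b := 3 + 1) (r := 2) (by norm_num) Nat.prime_two
        (by norm_num), h2, h3]
    norm_num [Nat.choose]
    simp only [mul_pow, ← pow_mul]
    generalize 1 - y ^ 2 = A
    generalize 1 - y ^ 3 = B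
    ring
  · rw [hP]
    -- The ratio has the factor 1 - y twice and P has it once, so the equality holds only up to
    -- radicals.
    exact RadEquiv.of_pow (by positivity) 2 ⟨(1 + y) * (1 + y + y ^ 2), by ring⟩ ⟨1 - y, by ring⟩

/-- Cubes in degree `l` leave 1 + y² + y⁴, and squares after deleting `i` give 1 - y³, where y =
σ^(1/6). The factor 1 + y + y² of 1 - y³ already divides 1 + y² + y⁴, so P retains only 1 - y. -/
theorem hasDegreeRatio_three_six (p : Fin n → Fin n → R) (hij : i ≠ j) :
    HasDegreeRatio p 7 (twoDeg i j 3 6)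
      ((1 - p i i * (p i j * p j i) ^ 3 * p j j ^ 5) *
        qNumber 3 (p i i ^ 2 * (p i j * p j i) ^ 6 * p j j ^ 10)) := by
  set y := p i i * (p i j * p j i) ^ 3 * p j j ^ 5 with hy
  have h1 : twistFactor p (twoDeg i j 3 6) 1 = (1 - y ^ 2) * (1 + y ^ 2 + y ^ 4) := by
    rw [twistFactor_twoDeg p hij, hy]
    norm_num
    ring
  have h2 : twistFactor p (twoDeg i j 3 6) 2 = 1 - y ^ 3 := by
    rw [twistFactor_twoDeg p hij, hy]
    norm_num
    ring
  have h3 : twistFactor p (twoDeg i j 3 6) 3 = 1 - y ^ 2 := by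
    rw [twistFactor_twoDeg p hij, hy]
    norm_num
    ring
  have hP : (1 - y) * qNumber 3 (p i i ^ 2 * (p i j * p j i) ^ 6 * p j j ^ 10) =
      (1 - y) * (1 + y ^ 2 + y ^ 4) := by
    rw [show p i i ^ 2 * (p i j * p j i) ^ 6 * p j j ^ 10 = y ^ 2 by rw [hy]; ring]
    simp [qNumber, Finset.sum_range_succ, ← pow_mul]
  refine ⟨((1 + y ^ 2 + y ^ 4) * (1 - y ^ 3)) ^ 72, ?_, ?_⟩
  · revert h1 h2 h3
    generalize twistFactor p (twoDeg i j 3 6) = g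
    intro h1 h2 h3
    rw [deletionProd_twoDeg g hij 8 2 5, rootProd_twoDeg_coprime g hij (a := 2 + 1) (b := 5)
      (by norm_num) (by norm_num),
      rootProd_twoDeg_prime g hij (a := 3) (b := 6) (r := 3) (by norm_num) Nat.prime_three
        (by norm_num),
      rootProd_twoDeg_prime g hij (a := 2) (b := 5 + 1) (r := 2) (by norm_num) Nat.prime_two
        (by norm_num), h1, h2, h3]
    norm_num [Nat.choose]
    simp only [mul_pow, ← pow_mul]
    generalize 1 - y ^ 2 = A
    generalize 1 - y ^ 3 = B
    generalize 1 + y ^ 2 + y ^ 4 = C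
    ring
  · rw [hP]
    exact RadEquiv.of_pow (by positivity) 2 ⟨(1 - y) * (1 - y + y ^ 2), by ring⟩
      ⟨1 + y + y ^ 2, by ring⟩

/-- Here y = σ^(1/4). Both deletions give primitive words only, while squares and fourth powers in
degree `l` reduce the denominator by factors 1 + y² and 1 + y. -/
theorem hasDegreeRatio_four_four (p : Fin n → Fin n → R) (hij : i ≠ j) :
    HasDegreeRatio p 6 (twoDeg i j 4 4)
      ((1 + p i i ^ 3 * (p i j * p j i) ^ 4 * p j j ^ 3) *
        (1 + p i i ^ 6 * (p i j * p j i) ^ 8 * p j j ^ 6)) := by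
  set y := p i i ^ 3 * (p i j * p j i) ^ 4 * p j j ^ 3 with hy
  have h1 : twistFactor p (twoDeg i j 4 4) 1 = (1 - y) * (1 + y) * (1 + y ^ 2) := by
    rw [twistFactor_twoDeg p hij, hy]
    norm_num
    ring
  have h2 : twistFactor p (twoDeg i j 4 4) 2 = (1 - y) * (1 + y) := by
    rw [twistFactor_twoDeg p hij, hy]
    norm_num
    ring
  have h4 : twistFactor p (twoDeg i j 4 4) 4 = 1 - y := by
    rw [twistFactor_twoDeg p hij, hy]
  have hP : p i i ^ 6 * (p i j * p j i) ^ 8 * p j j ^ 6 = y ^ 2 := by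
    rw [hy]; ring
  refine ⟨((1 + y) * (1 + y ^ 2) ^ 2) ^ 56, ?_, ?_⟩
  · revert h1 h2 h4
    generalize twistFactor p (twoDeg i j 4 4) = g
    intro h1 h2 h4
    rw [deletionProd_twoDeg g hij,
      rootProd_twoDeg_coprime g hij (by norm_num) (by norm_num),
      rootProd_twoDeg_coprime g hij (by norm_num) (by norm_num),
      rootProd_of_dvd_four g (by rw [sum_twoDeg])]
    · simp only [twoDeg_div hij, multinomial_twoDeg hij, h1, h2, h4]
      norm_num [Nat.choose]
      simp only [mul_pow, ← pow_mul]
      generalize 1 - y = A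
      generalize 1 + y = B
      generalize 1 + y ^ 2 = C
      ring
    · rw [forall_dvd_twoDeg hij]
      norm_num
    · intro t ht
      rw [forall_dvd_twoDeg hij] at ht
      exact ht.1
  · rw [hP]
    exact RadEquiv.of_pow (by positivity) 2 ⟨1 + y, by ring⟩ ⟨1 + y ^ 2, by ring⟩

end Exceptional

/-! ### The generic degrees -/

section Generic

variable {n : ℕ} {R : Type*} [CommRing R]

theorem twistFactor_dvd (p : Fin n → Fin n → R) {l : Fin n → ℕ} {r : ℕ}
    (hr : ∀ x, r ∣ twistExp l x) : twistFactor p l r ∣ twistFactor p l 1 := by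
  have h : pMonomial p (fun x => twistExp l x / 1) =
      (pMonomial p fun x => twistExp l x / r) ^ r := by
    rw [← pMonomial_nsmul]
    congr 1
    ext x
    simp [Nat.mul_div_cancel' (hr x)]
  rw [twistFactor, twistFactor, h]
  simpa using sub_dvd_pow_sub_pow (1 : R) (pMonomial p fun x => twistExp l x / r) r

theorem dvd_twistExp_of_forall_dvd {l : Fin n → ℕ} {r : ℕ} (h : ∀ a, r ∣ l a) (x : Fin n × Fin n) :
    r ∣ twistExp l x :=
  Dvd.dvd.mul_right (h x.1) _

theorem dvd_twistExp_of_forall_dvd_sub {l : Fin n → ℕ} {r : ℕ} {j : Fin n}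
    (h : ∀ a, r ∣ (l - Pi.single j 1 : Fin n → ℕ) a) (x : Fin n × Fin n) :
    r ∣ twistExp l x := by
  obtain ⟨a, b⟩ := x
  have hj : r ∣ l j - 1 := by simpa using h j
  have hne : ∀ c ≠ j, r ∣ l c := fun c hc => by simpa [hc] using h c
  by_cases ha : a = j
  · by_cases hb : b = j
    · subst ha hb
      simpa [twistExp] using Dvd.dvd.mul_left hj (l b)
    · have : a ≠ b := fun h => hb (h ▸ ha)
      simpa [twistExp, this] using Dvd.dvd.mul_left (hne b hb) (l a)
  · exact Dvd.dvd.mul_right (hne a ha) _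

/-- Every factor divides g 1 = 1 - σ. The denominator therefore divides g 1 to the power on the left
of `h`, whereas the primitive words in the numerator alone contribute g 1 to the power on the right.
After cancellation a factor g 1 survives, and everything else divides a power of g 1. -/
theorem hasDegreeRatio_of_lt (p : Fin n → Fin n → R) {d : ℕ} {l : Fin n → ℕ}
    (h : (d + 1) * ∑ w : Fin (d + 2) → Fin n with wordDeg w = l, rootOrder w <
      (d + 2) * ∑ j with 0 < l j, ({w | wordDeg w = l - Pi.single j 1 ∧ rootOrder w = 1} :
        Finset (Fin (d + 1) → Fin n)).card) :
    HasDegreeRatio p d l (twistFactor p l 1) := by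
  classical
  set g := twistFactor p l with hg
  have hroot : rootProd g (d + 2) l ∣
      g 1 ^ ∑ w : Fin (d + 2) → Fin n with wordDeg w = l, rootOrder w := by
    rw [rootProd, ← Finset.prod_pow_eq_pow_sum]
    refine Finset.prod_dvd_prod_of_dvd _ _ fun w hw => pow_dvd_pow_of_dvd ?_ _
    have hw : wordDeg w = l := by simpa using hw
    exact twistFactor_dvd p (dvd_twistExp_of_forall_dvd fun a => hw ▸ dvd_wordDeg w dvd_rfl a)
  have hdel : ∀ j : Fin n, ∃ G, rootProd g (d + 1) (l - Pi.single j 1) =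
      g 1 ^ ({w | wordDeg w = l - Pi.single j 1 ∧ rootOrder w = 1} :
        Finset (Fin (d + 1) → Fin n)).card * G ∧ ∃ M, G ∣ g 1 ^ M := by
    intro j
    refine ⟨∏ w : Fin (d + 1) → Fin n with wordDeg w = l - Pi.single j 1 ∧ ¬ rootOrder w = 1,
      g (rootOrder w) ^ rootOrder w, ?_, ∑ w : Fin (d + 1) → Fin n with
        wordDeg w = l - Pi.single j 1 ∧ ¬ rootOrder w = 1, rootOrder w, ?_⟩
    · rw [rootProd, ← Finset.prod_filter_mul_prod_filter_not _ (fun w => rootOrder w = 1),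
        Finset.filter_filter, Finset.filter_filter, ← Finset.prod_const]
      congr 1
      refine Finset.prod_congr rfl fun w hw => ?_
      simp only [Finset.mem_filter, Finset.mem_univ, true_and] at hw
      rw [hw.2, pow_one]
    · rw [← Finset.prod_pow_eq_pow_sum]
      refine Finset.prod_dvd_prod_of_dvd _ _ fun w hw => pow_dvd_pow_of_dvd ?_ _
      simp only [Finset.mem_filter, Finset.mem_univ, true_and] at hw
      exact twistFactor_dvd p (dvd_twistExp_of_forall_dvd_sub fun a =>
        hw.1 ▸ dvd_wordDeg w dvd_rfl a)
  choose G hG M hM using hdel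
  set S := (d + 1) * ∑ w : Fin (d + 2) → Fin n with wordDeg w = l, rootOrder w with hS
  set Q := (d + 2) * ∑ j with 0 < l j, ({w | wordDeg w = l - Pi.single j 1 ∧ rootOrder w = 1} :
        Finset (Fin (d + 1) → Fin n)).card with hQ
  obtain ⟨H, hH⟩ : rootProd g (d + 2) l ^ (d + 1) ∣ g 1 ^ S := by
    rw [hS, mul_comm, pow_mul]
    exact pow_dvd_pow_of_dvd hroot _
  -- The strict inequality guarantees the one surplus factor g 1 that makes g 1 divide the ratio.
  obtain ⟨X, hX⟩ : ∃ X, Q = S + (X + 1) := ⟨Q - S - 1, by omega⟩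
  have hdel : deletionProd g (d + 1) l ^ (d + 2) = g 1 ^ Q * (∏ j with 0 < l j, G j) ^ (d + 2) := by
    rw [deletionProd, Finset.prod_congr rfl fun j _ => hG j, Finset.prod_mul_distrib,
      Finset.prod_pow_eq_pow_sum, mul_pow, ← pow_mul, hQ, mul_comm (d + 2)]
  refine ⟨g 1 ^ (X + 1) * H * (∏ j with 0 < l j, G j) ^ (d + 2), ?_, ?_, 1, ?_⟩
  · rw [hdel, hX, pow_add, hH]
    ring
  · have hGM : (∏ j with 0 < l j, G j) ∣ g 1 ^ ∑ j with 0 < l j, M j := by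
      rw [← Finset.prod_pow_eq_pow_sum]
      exact Finset.prod_dvd_prod_of_dvd _ _ fun j _ => hM j
    refine ⟨(X + 1) + S + (∑ j with 0 < l j, M j) * (d + 2), ?_⟩
    rw [pow_add (g 1) (X + 1 + S), pow_add (g 1) (X + 1)]
    refine mul_dvd_mul (mul_dvd_mul dvd_rfl ⟨_, hH.trans (mul_comm _ _)⟩) ?_
    rw [pow_mul]
    exact pow_dvd_pow_of_dvd hGM _
  · rw [pow_one, pow_succ]
    exact ⟨g 1 ^ X * H * (∏ j with 0 < l j, G j) ^ (d + 2), by ring⟩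

/-- All multiplicities are multiples of `r`, up to one letter. -/
def IsNearMultiple (r : ℕ) (l : Fin n → ℕ) : Prop :=
  (∀ a, r ∣ l a) ∨ ∃ j, 0 < l j ∧ ∀ a, r ∣ (l - Pi.single j 1 : Fin n → ℕ) a

open Classical in
/-- An upper bound for the number of periodic words of degree `l` or of degree `l` with one letter
removed, counted with multiplicity. -/
noncomputable def periodicBound (l : Fin n → ℕ) : ℕ :=
  ∑ r ∈ Finset.Icc 2 (∑ a, l a), if IsNearMultiple r l then
    r.totient * Nat.multinomial Finset.univ (fun a => l a / r) else 0

theorem card_dvd_rootOrder_eq_zero {d r : ℕ} {l : Fin n → ℕ} (h : ¬ ∀ a, r ∣ l a) :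
    ({w | wordDeg w = l ∧ r ∣ rootOrder w} : Finset (Fin (d + 1) → Fin n)).card = 0 := by
  rw [Finset.card_eq_zero, Finset.filter_eq_empty_iff]
  rintro w - ⟨rfl, hw⟩
  exact h fun a => dvd_wordDeg w hw a

/-- Write each root order as the sum of φ(r) over its divisors r and exchange the sums; the counts
of r-th powers are known. -/
theorem sum_rootOrder {d : ℕ} (l : Fin n → ℕ) :
    ∑ w : Fin (d + 1) → Fin n with wordDeg w = l, rootOrder w =
      ∑ r ∈ Finset.Icc 1 (d + 1), r.totient * ({w | wordDeg w = l ∧ r ∣ rootOrder w} :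
        Finset (Fin (d + 1) → Fin n)).card := by
  have h : ∀ w : Fin (d + 1) → Fin n, rootOrder w =
      ∑ r ∈ Finset.Icc 1 (d + 1), if r ∣ rootOrder w then r.totient else 0 := by
    intro w
    conv_lhs => rw [← Nat.sum_totient (rootOrder w)]
    rw [← Finset.sum_filter]
    refine Finset.sum_congr ?_ fun _ _ => rfl
    ext r
    simp only [Nat.mem_divisors, Finset.mem_filter, Finset.mem_Icc]
    constructor
    · rintro ⟨h1, h2⟩
      exact ⟨⟨Nat.pos_of_dvd_of_pos h1 (rootOrder_pos w),
        Nat.le_of_dvd (by omega) (h1.trans (rootOrder_dvd w))⟩, h1⟩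
    · rintro ⟨-, h1⟩
      exact ⟨h1, (rootOrder_pos w).ne'⟩
  rw [Finset.sum_congr rfl fun w _ => h w, Finset.sum_comm]
  refine Finset.sum_congr rfl fun r _ => ?_
  rw [← Finset.sum_filter, Finset.filter_filter, Finset.sum_const, smul_eq_mul, mul_comm]

theorem card_le_card_rootOrder_one {d : ℕ} (l : Fin n → ℕ) (hl : ∑ a, l a = d + 1) :
    Nat.multinomial Finset.univ l ≤ ({w | wordDeg w = l ∧ rootOrder w = 1} :
        Finset (Fin (d + 1) → Fin n)).card +
      ∑ r ∈ Finset.Icc 2 (d + 2), ({w | wordDeg w = l ∧ r ∣ rootOrder w} :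
        Finset (Fin (d + 1) → Fin n)).card := by
  classical
  rw [← card_wordDeg_eq l hl]
  refine le_trans (Finset.card_le_card (t := ({w | wordDeg w = l ∧ rootOrder w = 1} :
    Finset (Fin (d + 1) → Fin n)) ∪ (Finset.Icc 2 (d + 2)).biUnion fun r =>
      ({w | wordDeg w = l ∧ r ∣ rootOrder w} : Finset (Fin (d + 1) → Fin n))) ?_) ?_
  · intro w hw
    have hw : wordDeg w = l := by simpa using hw
    by_cases h1 : rootOrder w = 1
    · simp [hw, h1]
    · have hpos := rootOrder_pos w
      have hle := Nat.le_of_dvd (by omega) (rootOrder_dvd w)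
      refine Finset.mem_union_right _ (Finset.mem_biUnion.2 ⟨rootOrder w, ?_, ?_⟩)
      · rw [Finset.mem_Icc]
        omega
      · simp [hw]
  · exact (Finset.card_union_le _ _).trans (Nat.add_le_add_left Finset.card_biUnion_le _)

theorem sum_sub_single {d : ℕ} {l : Fin n → ℕ} (hl : ∑ a, l a = d + 1) {j : Fin n} (hj : 0 < l j) :
    ∑ a, (l - Pi.single j 1 : Fin n → ℕ) a = d := by
  have : l = (l - Pi.single j 1) + Pi.single j 1 := by
    ext a
    by_cases ha : a = j
    · subst ha
      simp
      omega
    · simp [ha]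
  rw [this] at hl
  simp only [Pi.add_apply, Finset.sum_add_distrib, Finset.sum_pi_single', Finset.mem_univ,
    if_true] at hl
  omega

-- For r ≥ 2 at most one of the degrees l and l - e_j has all entries divisible by `r`, since
-- otherwise r would divide 1. If it is l - e_j, rounding down gives the same quotient as for l.
open Classical in
theorem totient_mul_card_add_sum_le {d r : ℕ} {l : Fin n → ℕ} (hl : ∑ a, l a = d + 2)
    (hr : 2 ≤ r) :
    r.totient * ({w | wordDeg w = l ∧ r ∣ rootOrder w} : Finset (Fin (d + 2) → Fin n)).card +
      ∑ j with 0 < l j, ({w | wordDeg w = l - Pi.single j 1 ∧ r ∣ rootOrder w} :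
        Finset (Fin (d + 1) → Fin n)).card ≤
    if IsNearMultiple r l then r.totient * Nat.multinomial Finset.univ (fun a => l a / r)
      else 0 := by
  have hcontra : ∀ j, 0 < l j → r ∣ l j → ¬ ∀ a, r ∣ (l - Pi.single j 1 : Fin n → ℕ) a := by
    intro j hj h1 h2
    have h3 : r ∣ l j - 1 := by simpa using h2 j
    have h4 : r ∣ 1 := by
      have := Nat.dvd_sub h1 h3
      rwa [show l j - (l j - 1) = 1 by omega] at this
    have := Nat.le_of_dvd one_pos h4
    omega
  by_cases h : ∀ a, r ∣ l a
  · rw [if_pos (show IsNearMultiple r l from Or.inl h), card_dvd_rootOrder l hl h, Finset.sum_eq_zero, add_zero]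
    intro j hj
    exact card_dvd_rootOrder_eq_zero (hcontra j (by simpa using hj) (h j))
  · rw [card_dvd_rootOrder_eq_zero h, mul_zero, zero_add]
    by_cases h' : ∃ j, 0 < l j ∧ ∀ a, r ∣ (l - Pi.single j 1 : Fin n → ℕ) a
    · rw [if_pos (show IsNearMultiple r l from Or.inr h')]
      obtain ⟨j, hj, hjd⟩ := h'
      rw [Finset.sum_eq_single j]
      · rw [card_dvd_rootOrder _ (sum_sub_single hl hj) hjd]
        have : (fun a => (l - Pi.single j 1 : Fin n → ℕ) a / r) = fun a => l a / r := by
          ext a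
          by_cases ha : a = j
          · subst ha
            obtain ⟨t, ht⟩ : r ∣ l a - 1 := by simpa using hjd a
            have h1 : l a = 1 + r * t := by omega
            simp only [Pi.sub_apply, Pi.single_eq_same]
            rw [ht, h1, Nat.mul_div_cancel_left _ (by omega), Nat.add_mul_div_left _ _ (by omega),
              Nat.div_eq_of_lt (by omega), zero_add]
          · simp [ha]
        rw [this]
        exact Nat.le_mul_of_pos_left _ (Nat.totient_pos.2 (by omega))
      · intro k hk hkj
        refine card_dvd_rootOrder_eq_zero (hcontra k (by simpa using hk) ?_)
        simpa [hkj] using hjd k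
      · intro hj'
        simp [hj] at hj'
    · rw [Finset.sum_eq_zero]
      · exact Nat.zero_le _
      · intro j hj
        exact card_dvd_rootOrder_eq_zero fun hd => h' ⟨j, by simpa using hj, hd⟩

/-- Let M be the number of words of degree l, A the φ-weighted count of powers among them and B the
count of powers after a deletion. It suffices that (d+2)(M - B) exceeds (d+1)(M + A), and this
follows from M > (d+2)(A + B). -/
theorem hasDegreeRatio_of_periodicBound_lt (p : Fin n → Fin n → R) {d : ℕ} {l : Fin n → ℕ}
    (hl : ∑ a, l a = d + 2)
    (h : (d + 2) * periodicBound l < Nat.multinomial Finset.univ l) :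
    HasDegreeRatio p d l (twistFactor p l 1) := by
  classical
  apply hasDegreeRatio_of_lt
  have h1 : ∑ w : Fin (d + 2) → Fin n with wordDeg w = l, rootOrder w =
      Nat.multinomial Finset.univ l + ∑ r ∈ Finset.Icc 2 (d + 2), r.totient *
        ({w | wordDeg w = l ∧ r ∣ rootOrder w} : Finset (Fin (d + 2) → Fin n)).card := by
    rw [sum_rootOrder, ← Finset.insert_Icc_add_one_left_eq_Icc (by omega : 1 ≤ d + 1 + 1),
      Finset.sum_insert (by simp)]
    congr 1
    simp only [one_dvd, and_true, Nat.totient_one, one_mul]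
    exact card_wordDeg_eq l hl
  have h2 : Nat.multinomial Finset.univ l ≤
      ∑ j with 0 < l j, ({w | wordDeg w = l - Pi.single j 1 ∧ rootOrder w = 1} :
        Finset (Fin (d + 1) → Fin n)).card +
      ∑ r ∈ Finset.Icc 2 (d + 2), ∑ j with 0 < l j,
        ({w | wordDeg w = l - Pi.single j 1 ∧ r ∣ rootOrder w} :
          Finset (Fin (d + 1) → Fin n)).card := by
    rw [multinomial_eq_sum_sub_single l (by omega), Finset.sum_comm, ← Finset.sum_add_distrib]
    refine Finset.sum_le_sum fun j hj => ?_
    exact card_le_card_rootOrder_one _ (sum_sub_single hl (by simpa using hj))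
  have h3 : (∑ r ∈ Finset.Icc 2 (d + 2), r.totient *
        ({w | wordDeg w = l ∧ r ∣ rootOrder w} : Finset (Fin (d + 2) → Fin n)).card) +
      ∑ r ∈ Finset.Icc 2 (d + 2), ∑ j with 0 < l j,
        ({w | wordDeg w = l - Pi.single j 1 ∧ r ∣ rootOrder w} :
          Finset (Fin (d + 1) → Fin n)).card ≤ periodicBound l := by
    rw [← Finset.sum_add_distrib, periodicBound, hl]
    exact Finset.sum_le_sum fun r hr => totient_mul_card_add_sum_le hl (Finset.mem_Icc.1 hr).1
  rw [h1]
  revert h2 h3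
  generalize (∑ r ∈ Finset.Icc 2 (d + 2), r.totient *
        ({w | wordDeg w = l ∧ r ∣ rootOrder w} : Finset (Fin (d + 2) → Fin n)).card) = A
  generalize (∑ r ∈ Finset.Icc 2 (d + 2), ∑ j with 0 < l j,
        ({w | wordDeg w = l - Pi.single j 1 ∧ r ∣ rootOrder w} :
          Finset (Fin (d + 1) → Fin n)).card) = B
  generalize (∑ j with 0 < l j, ({w | wordDeg w = l - Pi.single j 1 ∧ rootOrder w = 1} :
        Finset (Fin (d + 1) → Fin n)).card) = Q
  intro h2 h3
  nlinarith

end Generic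

/-! ### Estimates for multinomial coefficients -/

section Estimates

variable {n : ℕ}

theorem wordDeg_append {d e : ℕ} (u : Fin d → Fin n) (v : Fin e → Fin n) :
    wordDeg (Fin.append u v) = wordDeg u + wordDeg v := by
  ext a
  rw [Pi.add_apply, wordDeg_eq_sum, wordDeg_eq_sum, wordDeg_eq_sum, Fin.sum_univ_add]
  simp

/-- Concatenation of words of degrees k and m is injective. -/
theorem multinomial_mul_le (k m : Fin n → ℕ) :
    Nat.multinomial Finset.univ k * Nat.multinomial Finset.univ m ≤
      Nat.multinomial Finset.univ (k + m) := by
  rw [← card_wordDeg_eq k rfl, ← card_wordDeg_eq m rfl,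
    ← card_wordDeg_eq (d := ∑ a, k a + ∑ a, m a) (k + m) (by simp [Finset.sum_add_distrib]),
    ← Finset.card_product]
  refine Finset.card_le_card_of_injOn (fun x => Fin.append x.1 x.2) ?_ ?_
  · rintro ⟨u, v⟩ h
    simp only [Finset.coe_product, Set.mem_prod, Finset.mem_coe, Finset.mem_filter,
      Finset.mem_univ, true_and] at h
    simp [wordDeg_append, h.1, h.2]
  · rintro ⟨u, v⟩ - ⟨u', v'⟩ - h
    simp only at h
    ext k
    · have := congrFun h (Fin.castAdd _ k)
      simpa using congrArg Fin.val this
    · have := congrFun h (Fin.natAdd _ k)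
      simpa using congrArg Fin.val this

theorem multinomial_mono {k m : Fin n → ℕ} (h : k ≤ m) :
    Nat.multinomial Finset.univ k ≤ Nat.multinomial Finset.univ m := by
  obtain ⟨t, rfl⟩ := exists_add_of_le h
  exact le_trans (Nat.le_mul_of_pos_right _ (Nat.multinomial_pos _ _)) (multinomial_mul_le k t)

theorem multinomial_half_mul_le (l : Fin n → ℕ) :
    Nat.multinomial Finset.univ (fun a => l a / 2) *
      Nat.multinomial Finset.univ (fun a => (l a + 1) / 2) ≤ Nat.multinomial Finset.univ l := by
  refine (multinomial_mul_le _ _).trans (le_of_eq ?_)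
  congr 1
  ext a
  simp only [Pi.add_apply]
  omega

theorem choose_mul_choose_le_multinomial (k : Fin n → ℕ) {c c' : Fin n} (hc : c ≠ c') :
    (∑ a, k a).choose (k c) * (∑ a, k a - k c).choose (k c') ≤
      Nat.multinomial Finset.univ k := by
  obtain ⟨s, hs⟩ : ∃ s : Finset (Fin n), s = (Finset.univ.erase c).erase c' := ⟨_, rfl⟩
  have hc's : c' ∉ s := by simp [hs]
  have hcs : c ∉ insert c' s := by simp [hs, hc]
  have huniv : (Finset.univ : Finset (Fin n)) = insert c (insert c' s) := by
    rw [hs, Finset.insert_erase (by simp [hc.symm]), Finset.insert_erase (Finset.mem_univ c)]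
  rw [huniv, Nat.multinomial_insert hcs, Nat.multinomial_insert hc's, Finset.sum_insert hcs,
    Finset.sum_insert hc's, ← mul_assoc, Nat.add_sub_cancel_left]
  exact Nat.le_mul_of_pos_right _ (Nat.multinomial_pos _ _)

theorem IsNearMultiple.dvd_or {r : ℕ} {l : Fin n → ℕ} (h : IsNearMultiple r l) (c : Fin n) :
    r ∣ l c ∨ r ∣ l c - 1 := by
  rcases h with h | ⟨j, -, h⟩
  · exact Or.inl (h c)
  · by_cases hc : c = j
    · subst hc
      exact Or.inr (by simpa using h c)
    · exact Or.inl (by simpa [hc] using h c)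

theorem sum_totient_dvd_le {m N : ℕ} (hm : 0 < m) :
    ∑ r ∈ Finset.Icc 2 N with r ∣ m, r.totient ≤ m - 1 := by
  have h := Nat.sum_totient m
  rw [← Finset.add_sum_erase _ _ (Nat.one_mem_divisors.2 hm.ne'), Nat.totient_one] at h
  refine le_trans (Finset.sum_le_sum_of_subset (t := m.divisors.erase 1) ?_) (by omega)
  intro r hr
  simp only [Finset.mem_filter, Finset.mem_Icc] at hr
  simp only [Finset.mem_erase, Nat.mem_divisors]
  exact ⟨by omega, hr.2, hm.ne'⟩

theorem multinomial_div_le {r : ℕ} (hr : 2 ≤ r) (l : Fin n → ℕ) :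
    Nat.multinomial Finset.univ (fun a => l a / r) ≤
      Nat.multinomial Finset.univ (fun a => l a / 2) :=
  multinomial_mono fun _ => Nat.div_le_div_left hr (by norm_num)

/-- A contributing r divides l c or l c - 1. The totients of the divisors r ≥ 2 of m sum to at most
m - 1, which gives (l c - 1) + (l c - 2). The multinomials are largest for r = 2. -/
theorem periodicBound_le (l : Fin n → ℕ) (c : Fin n) (hc : 2 ≤ l c) :
    periodicBound l ≤ (2 * l c - 3) * Nat.multinomial Finset.univ (fun a => l a / 2) := by
  classical
  have h1 : periodicBound l ≤ ∑ r ∈ Finset.Icc 2 (∑ a, l a),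
      ((if r ∣ l c then r.totient else 0) + (if r ∣ l c - 1 then r.totient else 0)) *
        Nat.multinomial Finset.univ (fun a => l a / 2) := by
    refine Finset.sum_le_sum fun r hr => ?_
    split_ifs with h h2 h3 h3
    · exact Nat.mul_le_mul (by omega) (multinomial_div_le (Finset.mem_Icc.1 hr).1 l)
    · exact Nat.mul_le_mul (by omega) (multinomial_div_le (Finset.mem_Icc.1 hr).1 l)
    · exact Nat.mul_le_mul (by omega) (multinomial_div_le (Finset.mem_Icc.1 hr).1 l)
    · exact absurd (h.dvd_or c) (by tauto)
    all_goals exact Nat.zero_le _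
  refine h1.trans ?_
  rw [← Finset.sum_mul, Finset.sum_add_distrib, ← Finset.sum_filter, ← Finset.sum_filter]
  refine Nat.mul_le_mul_right _ ?_
  have h2 := sum_totient_dvd_le (N := ∑ a, l a) (m := l c) (by omega)
  have h3 := sum_totient_dvd_le (N := ∑ a, l a) (m := l c - 1) (by omega)
  omega

/-- A letter of multiplicity one must be the deleted one, so r has to divide l b itself. -/
theorem periodicBound_le_of_eq_one (l : Fin n → ℕ) {c b : Fin n} (hc : l c = 1) (hb : b ≠ c)
    (hlb : 2 ≤ l b) :
    periodicBound l ≤ (l b - 1) * Nat.multinomial Finset.univ (fun a => l a / 2) := by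
  classical
  have h1 : periodicBound l ≤ ∑ r ∈ Finset.Icc 2 (∑ a, l a),
      (if r ∣ l b then r.totient else 0) * Nat.multinomial Finset.univ (fun a => l a / 2) := by
    refine Finset.sum_le_sum fun r hr => ?_
    have hr2 := (Finset.mem_Icc.1 hr).1
    have hr1 : ¬ r ∣ 1 := fun h => by have := Nat.le_of_dvd one_pos h; omega
    split_ifs with h h2
    · exact Nat.mul_le_mul le_rfl (multinomial_div_le hr2 l)
    · exfalso
      rcases h with h | ⟨j, -, h⟩
      · exact hr1 (hc ▸ h c)
      · by_cases hj : c = j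
        · subst hj
          exact h2 (by simpa [hb] using h b)
        · exact hr1 (by simpa [hj, hc] using h c)
    all_goals exact Nat.zero_le _
  refine h1.trans ?_
  rw [← Finset.sum_mul, ← Finset.sum_filter]
  exact Nat.mul_le_mul_right _ (sum_totient_dvd_le (by omega))

theorem periodicBound_eq_zero (l : Fin n → ℕ) {c b : Fin n} (hc : l c = 1) (hb : b ≠ c)
    (hlb : l b = 1) : periodicBound l = 0 := by
  classical
  refine Finset.sum_eq_zero fun r hr => ?_
  have hr2 := (Finset.mem_Icc.1 hr).1
  have hr1 : ¬ r ∣ 1 := fun h => by have := Nat.le_of_dvd one_pos h; omega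
  rw [if_neg]
  rintro (h | ⟨j, -, h⟩)
  · exact hr1 (hc ▸ h c)
  · by_cases hj : c = j
    · subst hj
      exact hr1 (by simpa [hb, hlb] using h b)
    · exact hr1 (by simpa [hj, hc] using h c)

theorem two_mul_le_centralBinom_sub (y : ℕ) : 2 * (2 * y + 1) ≤ (2 * (y + 1)).choose (y + 1) := by
  have h := Nat.succ_mul_centralBinom_succ y
  rw [Nat.centralBinom_eq_two_mul_choose (y + 1)] at h
  have h2 : y + 1 ≤ y.centralBinom := by
    rcases Nat.eq_zero_or_pos y with rfl | hy
    · simp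
    · rw [Nat.centralBinom_eq_two_mul_choose]
      calc y + 1 = (y + 1).choose y := by simp
        _ ≤ (2 * y).choose y := Nat.choose_le_choose _ (by omega)
  nlinarith

theorem choose_mono_add {x x' y y' : ℕ} (hx : x ≤ x') (hy : y ≤ y') :
    (x + y).choose x ≤ (x' + y').choose x' := by
  calc (x + y).choose x ≤ (x + y').choose x := Nat.choose_le_choose _ (by omega)
    _ = (x + y').choose y' := Nat.choose_symm_add
    _ ≤ (x' + y').choose y' := Nat.choose_le_choose _ (by omega)
    _ = (x' + y').choose x' := Nat.choose_symm_add.symm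

theorem add_le_choose {y z : ℕ} (hy : 1 ≤ y) (hz : 1 ≤ z) : y + z ≤ (y + z).choose y := by
  induction y, hy using Nat.le_induction with
  | base => simp
  | succ y _ ih =>
    rw [show y + 1 + z = (y + z) + 1 by ring, Nat.choose_succ_succ']
    have : 0 < (y + z).choose (y + 1) := Nat.choose_pos (by omega)
    omega

theorem choose_two_add (z : ℕ) : 2 * (2 + z).choose 2 = (z + 2) * (z + 1) := by
  have := Nat.descFactorial_eq_factorial_mul_choose (2 + z) 2
  rw [show (2 : ℕ).factorial = 2 from rfl] at this
  rw [← this]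
  simp only [Nat.descFactorial_succ, Nat.descFactorial_zero]
  rw [show 2 + z - 1 = z + 1 by omega]
  simp
  ring

/-- Splitting l into its lower and upper halves bounds the multinomial of l below by a product. The
lower half cancels against the periodic bound, so only the upper half has to be estimated. -/
theorem periodicBound_lt_of_half {l : Fin n → ℕ} {A : ℕ}
    (h1 : periodicBound l ≤ A * Nat.multinomial Finset.univ (fun a => l a / 2))
    (h2 : (∑ a, l a) * A < Nat.multinomial Finset.univ (fun a => (l a + 1) / 2)) :
    (∑ a, l a) * periodicBound l < Nat.multinomial Finset.univ l := by
  have h3 := multinomial_half_mul_le l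
  have h4 : 0 < Nat.multinomial Finset.univ (fun a => l a / 2) := Nat.multinomial_pos _ _
  refine lt_of_lt_of_le ?_ h3
  calc (∑ a, l a) * periodicBound l
      ≤ (∑ a, l a) * (A * Nat.multinomial Finset.univ (fun a => l a / 2)) :=
        Nat.mul_le_mul_left _ h1
    _ = Nat.multinomial Finset.univ (fun a => l a / 2) * ((∑ a, l a) * A) := by ring
    _ < _ := Nat.mul_lt_mul_of_pos_left h2 h4

theorem add_add_le_sum (k : Fin n → ℕ) {c₁ c₂ c₃ : Fin n} (h12 : c₁ ≠ c₂) (h13 : c₁ ≠ c₃)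
    (h23 : c₂ ≠ c₃) : k c₁ + k c₂ + k c₃ ≤ ∑ a, k a := by
  have : ∑ a ∈ {c₁, c₂, c₃}, k a = k c₁ + k c₂ + k c₃ := by
    rw [Finset.sum_insert (by simp [h12, h13]), Finset.sum_pair h23, add_assoc]
  rw [← this]
  exact Finset.sum_le_sum_of_subset (Finset.subset_univ _)

/-- Here `periodicBound_lt_of_half` just fails, with equality 6 · 1 = 3!. Directly, 6 · 6 < 90; `hK`
excludes further letters. -/
theorem periodicBound_lt_of_two_two_two {l : Fin n → ℕ} {c₁ c₂ c₃ : Fin n} (h12 : c₁ ≠ c₂)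
    (h13 : c₁ ≠ c₃) (h23 : c₂ ≠ c₃) (h1 : l c₁ = 2) (h2 : l c₂ = 2) (h3 : l c₃ = 2)
    (hK : ∑ a, (l a + 1) / 2 = 3) :
    (∑ a, l a) * periodicBound l < Nat.multinomial Finset.univ l := by
  have h0 : ∀ a, a ≠ c₁ → a ≠ c₂ → a ≠ c₃ → l a = 0 := by
    intro a ha1 ha2 ha3
    have hsub : ∑ b ∈ {a, c₁, c₂, c₃}, (l b + 1) / 2 ≤ 3 :=
      hK ▸ Finset.sum_le_sum_of_subset (Finset.subset_univ _)
    rw [Finset.sum_insert (by simp [ha1, ha2, ha3]), Finset.sum_insert (by simp [h12, h13]),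
      Finset.sum_pair h23, h1, h2, h3] at hsub
    omega
  have heven : ∀ a, l a = 2 * ((l a + 1) / 2) := by
    intro a
    by_cases ha1 : a = c₁
    · rw [ha1, h1]
    by_cases ha2 : a = c₂
    · rw [ha2, h2]
    by_cases ha3 : a = c₃
    · rw [ha3, h3]
    rw [h0 a ha1 ha2 ha3]
  have hsum : ∑ a, l a = 6 := by
    rw [Finset.sum_congr rfl fun a _ => heven a, ← Finset.mul_sum, hK]
    norm_num
  have hle := choose_mul_choose_le_multinomial l h12
  have hbound := periodicBound_le l c₁ (by omega)
  have hhalf : Nat.multinomial Finset.univ (fun a => l a / 2) = 6 := by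
    have hspec := Nat.multinomial_spec Finset.univ (fun a => l a / 2)
    have hs : ∑ a, l a / 2 = 3 := by
      rw [← hK]
      refine Finset.sum_congr rfl fun a _ => ?_
      have := heven a
      omega
    rw [hs, Finset.prod_eq_one] at hspec
    · simpa [Nat.factorial] using hspec
    · intro a _
      have h2 : l a ≤ 2 := by
        by_cases ha1 : a = c₁
        · rw [ha1, h1]
        by_cases ha2 : a = c₂
        · rw [ha2, h2]
        by_cases ha3 : a = c₃
        · rw [ha3, h3]
        rw [h0 a ha1 ha2 ha3]
        omega
      interval_cases l a <;> rfl
  rw [hsum, h1, h2] at hle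
  rw [hhalf, h1] at hbound
  rw [hsum]
  have : Nat.choose 6 2 * Nat.choose (6 - 2) 2 = 90 := by decide
  omega

/-- The periodic bound is linear in a small multiplicity, while the multinomial of the upper half k
dominates C(K, k₁) · C(K - k₁, k₂) with K = Σ k. A third letter at least as frequent makes these
binomials large enough. The cases l₁ = 1, l₁ = 2 and l₁ ≥ 3 use different bounds. -/
theorem periodicBound_lt_of_sorted {l : Fin n → ℕ} {c₁ c₂ c₃ : Fin n} (h12 : c₁ ≠ c₂)
    (h13 : c₁ ≠ c₃) (h23 : c₂ ≠ c₃) (h1 : 1 ≤ l c₁) (h2 : l c₁ ≤ l c₂) (h3 : l c₂ ≤ l c₃) :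
    (∑ a, l a) * periodicBound l < Nat.multinomial Finset.univ l := by
  obtain ⟨k, hk⟩ : ∃ k : Fin n → ℕ, k = fun a => (l a + 1) / 2 := ⟨_, rfl⟩
  have hka : ∀ a, k a = (l a + 1) / 2 := fun a => by rw [hk]
  obtain ⟨K, hK⟩ : ∃ K, K = ∑ a, k a := ⟨_, rfl⟩
  have hsum := add_add_le_sum k h12 h13 h23
  rw [← hK] at hsum
  have hmult := choose_mul_choose_le_multinomial k h12
  rw [← hK] at hmult
  -- The rounding term gives the strict inequality |l| < 2K needed when l c₁ = 1.
  have hd : ∑ a, l a + (2 * k c₁ - l c₁) ≤ 2 * K := by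
    rw [hK, ← Finset.add_sum_erase _ l (Finset.mem_univ c₁),
      ← Finset.add_sum_erase _ k (Finset.mem_univ c₁)]
    have : ∑ a ∈ Finset.univ.erase c₁, l a ≤ 2 * ∑ a ∈ Finset.univ.erase c₁, k a := by
      rw [Finset.mul_sum]
      refine Finset.sum_le_sum fun a _ => ?_
      have := hka a
      omega
    have := hka c₁
    omega
  have hk1 := hka c₁
  have hk2 := hka c₂
  have hk3 := hka c₃
  rcases Nat.eq_or_lt_of_le h1 with h1' | h1'
  · rcases Nat.eq_or_lt_of_le (h1.trans h2) with h2' | h2'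
    · rw [periodicBound_eq_zero l h1'.symm h12.symm h2'.symm, mul_zero]
      exact Nat.multinomial_pos _ _
    · refine periodicBound_lt_of_half (periodicBound_le_of_eq_one l h1'.symm h12.symm h2') ?_
      rw [← hk]
      refine lt_of_lt_of_le ?_ hmult
      have hk1' : k c₁ = 1 := by omega
      rw [hk1', Nat.choose_one_right]
      obtain ⟨y, hy⟩ : ∃ y, k c₂ = y + 1 := ⟨k c₂ - 1, by omega⟩
      have hc : 2 * (2 * y + 1) ≤ (K - 1).choose (k c₂) := by
        rw [hy]
        exact (two_mul_le_centralBinom_sub y).trans (Nat.choose_le_choose _ (by omega))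
      have hb : l c₂ - 1 ≤ 2 * y + 1 := by omega
      have hdK : ∑ a, l a < 2 * K := by omega
      calc (∑ a, l a) * (l c₂ - 1) ≤ (∑ a, l a) * (2 * y + 1) := Nat.mul_le_mul_left _ hb
        _ < 2 * K * (2 * y + 1) := Nat.mul_lt_mul_of_pos_right hdK (by omega)
        _ = K * (2 * (2 * y + 1)) := by ring
        _ ≤ _ := Nat.mul_le_mul_left _ hc
  · by_cases hx : k c₁ = 1
    · have hl1 : l c₁ = 2 := by omega
      by_cases hK3 : K = 3
      · exact periodicBound_lt_of_two_two_two h12 h13 h23 hl1 (by omega) (by omega)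
          (by rw [← hK3, hK, hk])
      · refine periodicBound_lt_of_half (periodicBound_le l c₁ h1') ?_
        rw [← hk]
        refine lt_of_lt_of_le ?_ hmult
        rw [hx, Nat.choose_one_right, hl1]
        have hc := add_le_choose (y := k c₂) (z := K - 1 - k c₂) (by omega) (by omega)
        rw [show k c₂ + (K - 1 - k c₂) = K - 1 by omega] at hc
        calc (∑ a, l a) * (2 * 2 - 3) ≤ 2 * K := by omega
          _ < K * (K - 1) := by
            rw [mul_comm]
            exact Nat.mul_lt_mul_of_pos_left (by omega) (by omega)
          _ ≤ _ := Nat.mul_le_mul_left _ hc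
    · refine periodicBound_lt_of_half (periodicBound_le l c₁ h1') ?_
      rw [← hk]
      refine lt_of_lt_of_le ?_ hmult
      obtain ⟨x, hx'⟩ : ∃ x, k c₁ = x + 1 := ⟨k c₁ - 1, by omega⟩
      obtain ⟨z, hz⟩ : ∃ z, K = (x + 1) + z := ⟨K - (x + 1), by omega⟩
      have hA : (2 + z).choose 2 ≤ K.choose (k c₁) := by
        rw [hx', hz]
        exact choose_mono_add (by omega) le_rfl
      have hB : 2 * (2 * x + 1) ≤ (K - k c₁).choose (k c₂) := by
        obtain ⟨t, ht⟩ : ∃ t, K - k c₁ = k c₂ + t := ⟨K - k c₁ - k c₂, by omega⟩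
        rw [ht]
        refine (two_mul_le_centralBinom_sub x).trans ?_
        rw [two_mul]
        exact choose_mono_add (by omega) (by omega)
      refine lt_of_lt_of_le ?_ (Nat.mul_le_mul hA hB)
      have h2z := choose_two_add z
      have hzx : 2 * (x + 1) ≤ z := by omega
      have hz4 : 4 ≤ z := by omega
      have hd3 : ∑ a, l a ≤ 3 * z := by omega
      have ha : 2 * l c₁ - 3 ≤ 2 * (2 * x + 1) := by omega
      calc (∑ a, l a) * (2 * l c₁ - 3) ≤ 3 * z * (2 * (2 * x + 1)) := Nat.mul_le_mul hd3 ha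
        _ < (2 + z).choose 2 * (2 * (2 * x + 1)) := by
          refine Nat.mul_lt_mul_of_pos_right ?_ (by omega)
          nlinarith

theorem periodicBound_lt_of_three {l : Fin n → ℕ} {c₁ c₂ c₃ : Fin n} (h12 : c₁ ≠ c₂)
    (h13 : c₁ ≠ c₃) (h23 : c₂ ≠ c₃) (h1 : 1 ≤ l c₁) (h2 : 1 ≤ l c₂) (h3 : 1 ≤ l c₃) :
    (∑ a, l a) * periodicBound l < Nat.multinomial Finset.univ l := by
  rcases le_total (l c₁) (l c₂) with h | h <;> rcases le_total (l c₁) (l c₃) with h' | h' <;>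
    rcases le_total (l c₂) (l c₃) with h'' | h''
  · exact periodicBound_lt_of_sorted h12 h13 h23 h1 h h''
  · exact periodicBound_lt_of_sorted h13 h12 h23.symm h1 h' h''
  · exact periodicBound_lt_of_sorted h12 h13 h23 h1 h h''
  · exact periodicBound_lt_of_sorted h13.symm h23.symm h12 h3 h' h
  · exact periodicBound_lt_of_sorted h12.symm h23 h13 h2 h h'
  · exact periodicBound_lt_of_sorted h12.symm h23 h13 h2 h h'
  · exact periodicBound_lt_of_sorted h23 h12.symm h13.symm h2 h'' h'
  · exact periodicBound_lt_of_sorted h23.symm h13.symm h12.symm h3 h'' h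

end Estimates

/-! ### Estimates for degrees with two letters -/

section TwoLetters

/-- This and the next four lemmas bound (a + b)(2a - 3), for a ≤ b with upper halves x ≤ y, by a
binomial. Here a ≤ 2x, so 2a - 3 ≤ 4x - 3, which for x = 2, …, 5 gives the constants 5, 9, 13, 17.
For x ≥ 6 the cruder bound 16 y² suffices. -/
theorem lt_choose_of_two {y : ℕ} (hy : 20 ≤ y) : 2 * (2 + y) * 5 < (2 + y).choose 2 := by
  have h := choose_two_add y
  nlinarith

theorem lt_choose_of_three {y : ℕ} (hy : 9 ≤ y) : 2 * (3 + y) * 9 < (3 + y).choose 3 := by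
  have h := Nat.descFactorial_eq_factorial_mul_choose (3 + y) 3
  simp only [Nat.descFactorial_succ, Nat.descFactorial_zero, Nat.factorial, Nat.sub_zero, mul_one,
    Nat.succ_eq_add_one, Nat.reduceAdd, Nat.reduceMul] at h
  rw [show 3 + y - 2 = y + 1 by omega, show 3 + y - 1 = y + 2 by omega] at h
  generalize (3 + y).choose 3 = C at h ⊢
  obtain ⟨t, rfl⟩ := Nat.exists_eq_add_of_le hy
  nlinarith [Nat.zero_le (t ^ 2), Nat.zero_le (t ^ 3)]

theorem lt_choose_of_four {y : ℕ} (hy : 7 ≤ y) : 2 * (4 + y) * 13 < (4 + y).choose 4 := by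
  have h := Nat.descFactorial_eq_factorial_mul_choose (4 + y) 4
  simp only [Nat.descFactorial_succ, Nat.descFactorial_zero, Nat.factorial, Nat.sub_zero, mul_one,
    Nat.succ_eq_add_one, Nat.reduceAdd, Nat.reduceMul] at h
  rw [show 4 + y - 3 = y + 1 by omega, show 4 + y - 2 = y + 2 by omega,
    show 4 + y - 1 = y + 3 by omega] at h
  generalize (4 + y).choose 4 = C at h ⊢
  obtain ⟨t, rfl⟩ := Nat.exists_eq_add_of_le hy
  nlinarith [Nat.zero_le (t ^ 2), Nat.zero_le (t ^ 3), Nat.zero_le (t ^ 4)]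

theorem lt_choose_of_five {y : ℕ} (hy : 6 ≤ y) : 2 * (5 + y) * 17 < (5 + y).choose 5 := by
  have h := Nat.descFactorial_eq_factorial_mul_choose (5 + y) 5
  simp only [Nat.descFactorial_succ, Nat.descFactorial_zero, Nat.factorial, Nat.sub_zero, mul_one,
    Nat.succ_eq_add_one, Nat.reduceAdd, Nat.reduceMul] at h
  rw [show 5 + y - 4 = y + 1 by omega, show 5 + y - 3 = y + 2 by omega,
    show 5 + y - 2 = y + 3 by omega, show 5 + y - 1 = y + 4 by omega] at h
  generalize (5 + y).choose 5 = C at h ⊢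
  obtain ⟨t, rfl⟩ := Nat.exists_eq_add_of_le hy
  nlinarith [Nat.zero_le (t ^ 2), Nat.zero_le (t ^ 3), Nat.zero_le (t ^ 4), Nat.zero_le (t ^ 5)]

theorem lt_choose_of_six {y : ℕ} (hy : 6 ≤ y) : 16 * y ^ 2 < (6 + y).choose 6 := by
  have h := Nat.descFactorial_eq_factorial_mul_choose (6 + y) 6
  simp only [Nat.descFactorial_succ, Nat.descFactorial_zero, Nat.factorial, Nat.sub_zero, mul_one,
    Nat.succ_eq_add_one, Nat.reduceAdd, Nat.reduceMul] at h
  rw [show 6 + y - 5 = y + 1 by omega, show 6 + y - 4 = y + 2 by omega,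
    show 6 + y - 3 = y + 3 by omega, show 6 + y - 2 = y + 4 by omega,
    show 6 + y - 1 = y + 5 by omega] at h
  generalize (6 + y).choose 6 = C at h ⊢
  obtain ⟨t, rfl⟩ := Nat.exists_eq_add_of_le hy
  nlinarith [Nat.zero_le (t ^ 2), Nat.zero_le (t ^ 3), Nat.zero_le (t ^ 4), Nat.zero_le (t ^ 5),
    Nat.zero_le (t ^ 6)]

/-- The pairs for which the estimate of the number of periodic words by means of the words of half
the length is sufficient. -/
def IsLargePair (a b : ℕ) : Prop :=
  (a ≤ 4 ∧ 39 ≤ b) ∨ (5 ≤ a ∧ a ≤ 6 ∧ 17 ≤ b) ∨ (7 ≤ a ∧ a ≤ 8 ∧ 13 ≤ b) ∨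
    (9 ≤ a ∧ a ≤ 10 ∧ 11 ≤ b) ∨ 11 ≤ a

theorem lt_choose_half_of_isLargePair {a b : ℕ} (ha : 3 ≤ a) (hab : a ≤ b) (h : IsLargePair a b) :
    (a + b) * (2 * a - 3) < ((a + 1) / 2 + (b + 1) / 2).choose ((a + 1) / 2) := by
  obtain ⟨x, hx⟩ : ∃ x, x = (a + 1) / 2 := ⟨_, rfl⟩
  obtain ⟨y, hy⟩ : ∃ y, y = (b + 1) / 2 := ⟨_, rfl⟩
  rw [← hx, ← hy]
  have h1 : a + b ≤ 2 * (x + y) := by omega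
  rcases h with ⟨h2, h3⟩ | ⟨h2, h2', h3⟩ | ⟨h2, h2', h3⟩ | ⟨h2, h2', h3⟩ | h2
  · obtain rfl : x = 2 := by omega
    exact lt_of_le_of_lt (Nat.mul_le_mul h1 (by omega)) (lt_choose_of_two (by omega))
  · obtain rfl : x = 3 := by omega
    exact lt_of_le_of_lt (Nat.mul_le_mul h1 (by omega)) (lt_choose_of_three (by omega))
  · obtain rfl : x = 4 := by omega
    exact lt_of_le_of_lt (Nat.mul_le_mul h1 (by omega)) (lt_choose_of_four (by omega))
  · obtain rfl : x = 5 := by omega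
    exact lt_of_le_of_lt (Nat.mul_le_mul h1 (by omega)) (lt_choose_of_five (by omega))
  · refine lt_of_le_of_lt (Nat.mul_le_mul (n₂ := 4 * y) (m₂ := 4 * y) (by omega) (by omega)) ?_
    refine lt_of_lt_of_le ?_ (choose_mono_add (x := 6) (y := y) (by omega) le_rfl)
    have := lt_choose_of_six (y := y) (by omega)
    nlinarith

/-- `periodicBound` for degrees with two letters, in a form suited to evaluation. -/
def twoLetterBound (a b : ℕ) : ℕ :=
  ∑ r ∈ Finset.Icc 2 a, if (r ∣ a ∧ r ∣ b) ∨ (r ∣ a - 1 ∧ r ∣ b) ∨ (r ∣ a ∧ r ∣ b - 1) then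
    r.totient * ((a / r + b / r).descFactorial (a / r) / (a / r).factorial) else 0

/-- The finitely many pairs that are not large are checked by evaluation. Exactly those with a
separate polynomial P are excluded. -/
theorem twoLetterBound_lt_of_small : ∀ a ∈ Finset.Icc 3 10, ∀ b ∈ Finset.Icc 3 38,
    a ≤ b ∧ (5 ≤ a → b < 17) ∧
    (7 ≤ a → b < 13) ∧ (9 ≤ a → b < 11) ∧
    ¬ (a = 3 ∧ (b = 3 ∨ b = 4 ∨ b = 6)) ∧ ¬ (a = 4 ∧ b = 4) →
    (a + b) * twoLetterBound a b < (a + b).descFactorial a / a.factorial := by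
  decide +kernel

variable {n : ℕ} {i j : Fin n}

/-- No r > a contributes: it would have to divide a or a - 1, and both are positive because a ≥ 3.
-/
theorem periodicBound_twoDeg_le (hij : i ≠ j) {a b : ℕ} (ha : 3 ≤ a) :
    periodicBound (twoDeg i j a b) ≤ twoLetterBound a b := by
  classical
  have hnear : ∀ r, IsNearMultiple r (twoDeg i j a b) →
      (r ∣ a ∧ r ∣ b) ∨ (r ∣ a - 1 ∧ r ∣ b) ∨ (r ∣ a ∧ r ∣ b - 1) := by
    rintro r (h | ⟨k, hk, h⟩)
    · exact Or.inl ((forall_dvd_twoDeg hij).1 h)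
    · have hi := h i
      have hj := h j
      by_cases hki : k = i
      · subst hki
        simp [twoDeg_left hij, twoDeg_right hij, hij.symm] at hi hj
        exact Or.inr (Or.inl ⟨hi, hj⟩)
      · by_cases hkj : k = j
        · subst hkj
          simp [twoDeg_left hij, twoDeg_right hij, hij] at hi hj
          exact Or.inr (Or.inr ⟨hi, hj⟩)
        · rw [twoDeg_of_ne hki hkj] at hk
          omega
  rw [periodicBound, twoLetterBound, sum_twoDeg]
  rw [← Finset.sum_subset (Finset.Icc_subset_Icc_right (Nat.le_add_right a b))]
  · refine Finset.sum_le_sum fun r _ => ?_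
    split_ifs with h1 h2
    · rw [twoDeg_div hij, multinomial_twoDeg hij, Nat.choose_eq_descFactorial_div_factorial]
    · exact absurd (hnear r h1) h2
    · exact Nat.zero_le _
    · exact le_rfl
  · intro r hr hr'
    rw [if_neg]
    intro h
    simp only [Finset.mem_Icc] at hr hr'
    have hra : ¬ r ∣ a := fun h => by have := Nat.le_of_dvd (by omega) h; omega
    have hra' : ¬ r ∣ a - 1 := fun h => by have := Nat.le_of_dvd (by omega) h; omega
    have := hnear r h
    tauto

theorem periodicBound_lt_of_twoDeg_le (hij : i ≠ j) {a b : ℕ} (ha : 3 ≤ a) (hab : a ≤ b)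
    (h3 : ¬ (a = 3 ∧ (b = 3 ∨ b = 4 ∨ b = 6))) (h4 : ¬ (a = 4 ∧ b = 4)) :
    (a + b) * periodicBound (twoDeg i j a b) <
      Nat.multinomial Finset.univ (twoDeg i j a b) := by
  by_cases hlarge : IsLargePair a b
  · have h := lt_choose_half_of_isLargePair ha hab hlarge
    have hb := periodicBound_le (twoDeg i j a b) i (by rw [twoDeg_left hij]; omega)
    rw [twoDeg_left hij] at hb
    have := periodicBound_lt_of_half hb (by
      have he : (fun c => (twoDeg i j a b c + 1) / 2) =
          twoDeg i j ((a + 1) / 2) ((b + 1) / 2) := by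
        ext c
        by_cases hi : c = i
        · rw [hi, twoDeg_left hij, twoDeg_left hij]
        · by_cases hj : c = j
          · rw [hj, twoDeg_right hij, twoDeg_right hij]
          · simp [twoDeg_of_ne hi hj]
      rw [he, multinomial_twoDeg hij, sum_twoDeg]
      exact h)
    rwa [sum_twoDeg] at this
  · unfold IsLargePair at hlarge
    have h := twoLetterBound_lt_of_small a (Finset.mem_Icc.2 (by omega)) b
      (Finset.mem_Icc.2 (by omega)) ⟨hab, by omega, by omega, by omega, h3, h4⟩
    rw [multinomial_twoDeg hij, Nat.choose_eq_descFactorial_div_factorial]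
    exact lt_of_le_of_lt (Nat.mul_le_mul_left _ (periodicBound_twoDeg_le hij ha)) h

end TwoLetters

/-! ### The polynomials `P_m` and the determinants -/

section Determinants

open MvPolynomial

variable {n : ℕ}

theorem prod_pVar_eq_pMonomial (l : Fin n → ℕ) :
    (∏ i, (pVar i i) ^ (l i * (l i - 1))) *
      ∏ i, ∏ j ∈ Finset.Ioi i, (pVar i j * pVar j i) ^ (l i * l j) =
    pMonomial (pVar (n := n)) (twistExp l) := by
  have h := Finset.prod_prod_Ioi_mul_eq_prod_prod_off_diag
    (fun i j : Fin n => (pVar j i) ^ (l i * l j))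
  have h1 : ∀ i : Fin n, ∏ j ∈ Finset.Ioi i, (pVar i j * pVar j i) ^ (l i * l j) =
      ∏ j ∈ Finset.Ioi i, (pVar i j) ^ (l j * l i) * (pVar j i) ^ (l i * l j) := by
    intro i
    refine Finset.prod_congr rfl fun j _ => ?_
    rw [mul_pow, mul_comm (l j)]
  rw [Finset.prod_congr rfl fun i _ => h1 i, h, ← Finset.prod_mul_distrib, pMonomial,
    Fintype.prod_prod_type]
  refine Finset.prod_congr rfl fun i _ => ?_
  rw [← Finset.mul_prod_erase _ _ (Finset.mem_univ i), ← Finset.compl_singleton]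
  congr 1
  · simp [twistExp]
  · refine Finset.prod_congr rfl fun j hj => ?_
    have : i ≠ j := by
      rintro rfl
      simp at hj
    simp [twistExp, this, mul_comm]

theorem hasDegreeRatio_generic {d : ℕ} {l : Fin n → ℕ} (hl : ∑ a, l a = d + 2)
    (h : (∑ a, l a) * periodicBound l < Nat.multinomial Finset.univ l) :
    HasDegreeRatio (pVar (n := n)) d l (1 - (∏ i, (pVar i i) ^ (l i * (l i - 1))) *
      ∏ i, ∏ j ∈ Finset.Ioi i, (pVar i j * pVar j i) ^ (l i * l j)) := by
  rw [prod_pVar_eq_pMonomial]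
  have := hasDegreeRatio_of_periodicBound_lt (pVar (n := n)) hl (by rwa [hl] at h)
  simpa [twistFactor] using this

theorem eq_twoDeg_of_pos {l : Fin n → ℕ} {i j : Fin n} (hij : i ≠ j)
    (h : ∀ c, 0 < l c → c = i ∨ c = j) : l = twoDeg i j (l i) (l j) := by
  ext c
  by_cases hi : c = i
  · rw [hi, twoDeg_left hij]
  · by_cases hj : c = j
    · rw [hj, twoDeg_right hij]
    · rw [twoDeg_of_ne hi hj]
      by_contra hc
      rcases h c (Nat.pos_of_ne_zero hc) with h | h
      · exact hi h
      · exact hj h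

theorem periodicBound_lt_of_generic {l : Fin n → ℕ} (hl : 2 ≤ ∑ a, l a)
    (h1 : ¬ ∃ i, l = Pi.single i (l i))
    (h2 : ∀ i j, i ≠ j → ∀ b, 0 < b → l ≠ twoDeg i j 1 b)
    (h3 : ∀ i j, i ≠ j → ∀ b, 0 < b → l ≠ twoDeg i j 2 b)
    (h4 : ∀ i j, i ≠ j → l ≠ twoDeg i j 3 3)
    (h5 : ∀ i j, i ≠ j → l ≠ twoDeg i j 3 4)
    (h6 : ∀ i j, i ≠ j → l ≠ twoDeg i j 3 6)
    (h7 : ∀ i j, i ≠ j → l ≠ twoDeg i j 4 4) :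
    (∑ a, l a) * periodicBound l < Nat.multinomial Finset.univ l := by
  have key : ∀ i j, i ≠ j → ∀ a b, 0 < a → a ≤ b → l = twoDeg i j a b →
      (∑ a, l a) * periodicBound l < Nat.multinomial Finset.univ l := by
    intro i j hij a b ha hab heq
    have n1 : a ≠ 1 := fun h => h2 i j hij b (by omega) (h ▸ heq)
    have n2 : a ≠ 2 := fun h => h3 i j hij b (by omega) (h ▸ heq)
    have n3 : ¬ (a = 3 ∧ (b = 3 ∨ b = 4 ∨ b = 6)) := by
      rintro ⟨rfl, rfl | rfl | rfl⟩
      · exact h4 i j hij heq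
      · exact h5 i j hij heq
      · exact h6 i j hij heq
    have n4 : ¬ (a = 4 ∧ b = 4) := by
      rintro ⟨rfl, rfl⟩
      exact h7 i j hij heq
    have := periodicBound_lt_of_twoDeg_le hij (a := a) (b := b) (by omega) hab n3 n4
    rw [heq, sum_twoDeg]
    exact this
  obtain ⟨S, hS⟩ : ∃ S : Finset (Fin n), S = ({c | 0 < l c} : Finset (Fin n)) := ⟨_, rfl⟩
  have hmem : ∀ c, c ∈ S ↔ 0 < l c := by simp [hS]
  rcases lt_or_ge 2 S.card with hc | hc
  · obtain ⟨c₁, m1, c₂, m2, c₃, m3, h12, h13, h23⟩ := Finset.two_lt_card.1 hc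
    exact periodicBound_lt_of_three h12 h13 h23 ((hmem _).1 m1) ((hmem _).1 m2) ((hmem _).1 m3)
  · interval_cases hcard : S.card
    · rw [Finset.card_eq_zero] at hcard
      have : ∀ a, l a = 0 := fun a => by
        have := hmem a
        rw [hcard] at this
        simpa using this
      simp [this] at hl
    · obtain ⟨i, rfl⟩ := Finset.card_eq_one.1 hcard
      refine absurd ⟨i, ?_⟩ h1
      ext c
      by_cases hi : c = i
      · subst hi; simp
      · have := hmem c
        simp [hi] at this
        simp [hi, this]
    · obtain ⟨i, j, hij, rfl⟩ := Finset.card_eq_two.1 hcard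
      have heq := eq_twoDeg_of_pos hij (l := l) fun c hc => by simpa using (hmem c).2 hc
      have hi := (hmem i).1 (by simp)
      have hj := (hmem j).1 (by simp)
      rcases le_total (l i) (l j) with h | h
      · exact key i j hij _ _ hi h heq
      · exact key j i hij.symm _ _ hj h (heq.trans (twoDeg_comm _ _))

theorem hasDegreeRatio_nicholsP {d : ℕ} {l : Fin n → ℕ} (hl : ∑ a, l a = d + 2)
    (h1 : ¬ ∃ i, l = Pi.single i (l i)) : HasDegreeRatio (pVar (n := n)) d l (nicholsP l) := by
  have two : ∀ {a b : ℕ} {s : Fin n × Fin n}, IsTwoTerm l a b s →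
      l = twoDeg s.1 s.2 a b ∧ a + b = d + 2 := by
    rintro a b s ⟨-, h⟩
    have h' : l = twoDeg s.1 s.2 a b := h
    exact ⟨h', by rw [← hl, h', sum_twoDeg]⟩
  unfold nicholsP
  rw [dif_neg h1]
  split_ifs with h2 h3 h4 h5 h6 h7
  · have hspec := h2.choose_spec
    revert hspec
    generalize h2.choose = s
    rintro ⟨hpos, hs⟩
    obtain ⟨b, hb⟩ : ∃ b, l s.2 = b + 1 := ⟨l s.2 - 1, by omega⟩
    rw [hb] at hs
    obtain ⟨he, hd⟩ := two hs
    obtain rfl : d = b := by omega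
    have := hasDegreeRatio_one (pVar (n := n)) hs.1 d
    rw [← he] at this
    simpa [hb] using this
  · have hspec := h3.choose_spec
    revert hspec
    generalize h3.choose = s
    rintro ⟨hpos, hs⟩
    -- A degree 2 e_i + e_j has already been caught by the preceding case, with the letters
    -- exchanged.
    have hb1 : l s.2 ≠ 1 := by
      intro hb
      rw [hb] at hs
      refine h2 ⟨(s.2, s.1), ?_⟩
      have he := (two hs).1
      have h2' : l s.1 = 2 := by
        rw [he]
        exact twoDeg_left hs.1 _ _
      refine ⟨by simp [h2'], hs.1.symm, ?_⟩
      rw [h2']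
      exact he.trans (twoDeg_comm _ _)
    obtain ⟨k, hk | hk⟩ : ∃ k, l s.2 = 2 * k + 2 ∨ l s.2 = 2 * k + 3 := by
      rcases Nat.even_or_odd' (l s.2) with ⟨t, ht | ht⟩
      · exact ⟨t - 1, Or.inl (by omega)⟩
      · exact ⟨t - 1, Or.inr (by omega)⟩
    · rw [hk] at hs
      obtain ⟨he, hd⟩ := two hs
      obtain rfl : d = 2 * k + 2 := by omega
      have := hasDegreeRatio_two_even (pVar (n := n)) hs.1 k
      rw [← he] at this
      simpa only [hk, show 2 * k + 2 - 1 = 2 * k + 1 by omega] using this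
    · rw [hk] at hs
      obtain ⟨he, hd⟩ := two hs
      obtain rfl : d = 2 * k + 3 := by omega
      have := hasDegreeRatio_two_odd (pVar (n := n)) hs.1 k
      rw [← he] at this
      simpa only [hk, show 2 * k + 3 - 1 = 2 * k + 2 by omega] using this
  · have hs := h4.choose_spec
    obtain ⟨he, hd⟩ := two hs
    obtain rfl : d = 4 := by omega
    have := hasDegreeRatio_three_three (pVar (n := n)) hs.1
    rwa [← he] at this
  · have hs := h5.choose_spec
    obtain ⟨he, hd⟩ := two hs
    obtain rfl : d = 5 := by omega
    have := hasDegreeRatio_three_four (pVar (n := n)) hs.1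
    rwa [← he] at this
  · have hs := h6.choose_spec
    obtain ⟨he, hd⟩ := two hs
    obtain rfl : d = 7 := by omega
    have := hasDegreeRatio_three_six (pVar (n := n)) hs.1
    rwa [← he] at this
  · have hs := h7.choose_spec
    obtain ⟨he, hd⟩ := two hs
    obtain rfl : d = 6 := by omega
    have := hasDegreeRatio_four_four (pVar (n := n)) hs.1
    rwa [← he] at this
  · refine hasDegreeRatio_generic hl (periodicBound_lt_of_generic (by omega) h1 ?_ ?_ ?_ ?_ ?_ ?_)
    · intro i j hij b hb he
      have hj : l j = b := by rw [he, twoDeg_right hij]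
      exact h2 ⟨(i, j), by simpa [hj] using hb, hij, by simpa [hj, twoDeg] using he⟩
    · intro i j hij b hb he
      have hj : l j = b := by rw [he, twoDeg_right hij]
      exact h3 ⟨(i, j), by simpa [hj] using hb, hij, by simpa [hj, twoDeg] using he⟩
    · intro i j hij he
      exact h4 ⟨(i, j), hij, he⟩
    · intro i j hij he
      exact h5 ⟨(i, j), hij, he⟩
    · intro i j hij he
      exact h6 ⟨(i, j), hij, he⟩
    · intro i j hij he
      exact h7 ⟨(i, j), hij, he⟩

/-! ### One-letter degrees, cancellation over ℤ[p_ij] and specialisation to a field. -/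

theorem nicholsP_single (i : Fin n) {m : ℕ} (hm : m ≠ 0) :
    nicholsP (Pi.single i m) = qNumber m (pVar i i) := by
  have h : ∃ k : Fin n, (Pi.single i m : Fin n → ℕ) = Pi.single k ((Pi.single i m : Fin n → ℕ) k) :=
    ⟨i, by simp⟩
  unfold nicholsP
  rw [dif_pos h]
  have hc : h.choose = i := by
    by_contra hne
    have := congrFun h.choose_spec i
    rw [Pi.single_eq_of_ne' hne, Pi.single_eq_same] at this
    exact hm this
  rw [hc, Pi.single_eq_same]

theorem twistFactor_single {R : Type*} [CommRing R] (p : Fin n → Fin n → R) (i : Fin n) (m r : ℕ) :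
    twistFactor p (Pi.single i m) r = 1 - p i i ^ (m * (m - 1) / r) := by
  rw [twistFactor, pMonomial, Finset.prod_eq_single (i, i)]
  · simp [twistExp]
  · rintro ⟨a, b⟩ - hab
    by_cases ha : a = i
    · have hb : b ≠ i := fun hb => hab (by rw [ha, hb])
      simp [twistExp, hb]
    · simp [twistExp, ha]
  · simp

theorem one_sub_mul_qNumber {R : Type*} [CommRing R] (q : R) (m : ℕ) :
    (1 - q) * qNumber m q = 1 - q ^ m := by
  rw [qNumber, mul_neg_geom_sum]

/-- In degree (d+2) e_i the contribution is a power of (1 - q^(d+2)) / (1 - q^(d+1)), that is, of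
(d+2)_q / (d+1)_q. This is why a denominator `B` is needed; in all other degrees `B` is 1. -/
theorem exists_ratio {K : Type*} [Field K] (φ : MvPolynomial (Fin n × Fin n) ℤ →+* K) {d : ℕ}
    {l : Fin n → ℕ} (hl : ∑ a, l a = d + 2) :
    ∃ A B, deletionProd (twistFactor (pVar (n := n)) l) (d + 1) l ^ (d + 2) * B =
        A * rootProd (twistFactor (pVar (n := n)) l) (d + 2) l ^ (d + 1) ∧
      (φ A = 0 ↔ φ (nicholsP l) = 0) ∧
      (φ B = 0 → ∃ i, φ (qNumber (d + 1) (pVar i i)) = 0) := by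
  by_cases h : ∃ i, l = Pi.single i (l i)
  · obtain ⟨i, hi⟩ := h
    have hli : l i = d + 2 := by
      rw [hi] at hl
      simpa using hl
    rw [hli] at hi
    subst hi
    refine ⟨qNumber (d + 2) (pVar i i) ^ ((d + 1) * (d + 2)),
      qNumber (d + 1) (pVar i i) ^ ((d + 1) * (d + 2)), ?_, ?_, ?_⟩
    · have hpos : ({j | 0 < (Pi.single i (d + 2) : Fin n → ℕ) j} : Finset (Fin n)) = {i} := by
        ext j
        by_cases hj : j = i
        · subst hj; simp
        · simp [hj]
      have hsub : (Pi.single i (d + 2) - Pi.single i 1 : Fin n → ℕ) = Pi.single i (d + 1) := by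
        ext j
        by_cases hj : j = i
        · subst hj; simp
        · simp [hj]
      rw [deletionProd, hpos, Finset.prod_singleton, hsub, rootProd_single, rootProd_single,
        twistFactor_single, twistFactor_single, show d + 2 - 1 = d + 1 by omega,
        Nat.mul_div_cancel _ (by omega), show (d + 2) * (d + 1) / (d + 1 + 1) = d + 1 from
          Nat.mul_div_cancel_left _ (by omega), ← one_sub_mul_qNumber, ← one_sub_mul_qNumber]
      simp only [mul_pow, ← pow_mul]
      ring
    · rw [nicholsP_single i (by omega), map_pow]
      exact pow_eq_zero_iff (by positivity)
    · intro h
      rw [map_pow] at h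
      exact ⟨i, eq_zero_of_pow_eq_zero h⟩
  · obtain ⟨D, hD, hrad⟩ := hasDegreeRatio_nicholsP hl h
    exact ⟨D, 1, by rw [mul_one, hD], hrad.map_eq_zero_iff φ, by simp⟩

/-- In degree at least two some pair of letters is braided, so the monomial is not 1 and the factor
has constant coefficient 1. Thus the denominators can be cancelled over ℤ[p_ij]. -/
theorem twistFactor_ne_zero {l : Fin n → ℕ} {r : ℕ} (hl : 2 ≤ ∑ a, l a) (hr0 : 0 < r)
    (hr : ∀ a, r ∣ l a) : twistFactor (pVar (n := n)) l r ≠ 0 := by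
  obtain ⟨x, hx⟩ : ∃ x, 0 < twistExp l x := by
    by_cases h : ∃ a, 2 ≤ l a
    · obtain ⟨a, ha⟩ := h
      refine ⟨(a, a), ?_⟩
      simp only [twistExp, if_true]
      exact Nat.mul_pos (by omega) (by omega)
    · push Not at h
      have h1 : 1 < ({a | 0 < l a} : Finset (Fin n)).card := by
        rw [Finset.card_filter]
        refine lt_of_lt_of_le (by omega : 1 < ∑ a, l a) (Finset.sum_le_sum fun a _ => ?_)
        have := h a
        split_ifs <;> omega
      obtain ⟨a, b, ha, hb, hab⟩ := Finset.one_lt_card_iff.1 h1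
      refine ⟨(a, b), ?_⟩
      simp only [Finset.mem_filter, Finset.mem_univ, true_and] at ha hb
      simpa [twistExp, hab] using ⟨ha, hb⟩
  intro h
  have h2 := congrArg (constantCoeff (σ := Fin n × Fin n) (R := ℤ)) h
  have hpos : twistExp l x / r ≠ 0 :=
    (Nat.div_pos (Nat.le_of_dvd hx (dvd_twistExp_of_forall_dvd hr x)) hr0).ne'
  rw [twistFactor, map_sub, map_one, map_zero, pMonomial, map_prod,
    Finset.prod_eq_zero (Finset.mem_univ x)] at h2
  · simp at h2
  · simp [hpos]

theorem rootProd_ne_zero {d : ℕ} {l : Fin n → ℕ} (hl : ∑ a, l a = d + 2) :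
    rootProd (twistFactor (pVar (n := n)) l) (d + 2) l ≠ 0 := by
  rw [rootProd, Finset.prod_ne_zero_iff]
  intro w hw
  have hw : wordDeg w = l := by simpa using hw
  exact pow_ne_zero _ (twistFactor_ne_zero (by omega) (rootOrder_pos w)
    fun a => hw ▸ dvd_wordDeg w dvd_rfl a)

variable {R : Type*} [CommRing R]

theorem wordDeg_mem_piAntidiag {d : ℕ} (w : Fin d → Fin n) :
    wordDeg w ∈ Finset.piAntidiag (Finset.univ : Finset (Fin n)) d := by
  simp [sum_wordDeg]

theorem det_one_sub_rotationMatrix_pow_eq_prod (p : Fin n → Fin n → R) (d : ℕ) :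
    (1 - rotationMatrix p d).det ^ (d + 1) =
      ∏ l ∈ Finset.piAntidiag (Finset.univ : Finset (Fin n)) (d + 1),
        rootProd (twistFactor p l) (d + 1) l := by
  rw [det_one_sub_rotationMatrix_pow,
    ← Finset.prod_fiberwise_of_maps_to fun w _ => wordDeg_mem_piAntidiag w]
  refine Finset.prod_congr rfl fun l _ => Finset.prod_congr rfl fun w hw => ?_
  rw [(Finset.mem_filter.1 hw).2, twistFactor]

/-- Group the pairs (w, j) by the degree l of `w j`: for fixed l, each letter j of l leaves the
words w of degree l - e_j. -/
theorem prod_det_one_sub_twistedWeight_pow_eq_prod (p : Fin n → Fin n → R) (d : ℕ) :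
    (∏ j, (1 - weightedPerm (rotateWord n (d + 1)) (twistedWeight p j)).det) ^ (d + 1) =
      ∏ l ∈ Finset.piAntidiag (Finset.univ : Finset (Fin n)) (d + 2),
        deletionProd (twistFactor p l) (d + 1) l := by
  rw [← Finset.prod_pow]
  have h : ∀ j : Fin n,
      (1 - weightedPerm (rotateWord n (d + 1)) (twistedWeight p j)).det ^ (d + 1) =
      ∏ l ∈ Finset.piAntidiag (Finset.univ : Finset (Fin n)) (d + 2),
        if 0 < l j then rootProd (twistFactor p l) (d + 1) (l - Pi.single j 1) else 1 := by
    intro j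
    rw [det_one_sub_twistedWeight_pow,
      ← Finset.prod_fiberwise_of_maps_to (g := fun w => wordDeg w + Pi.single j 1)
        (t := Finset.piAntidiag (Finset.univ : Finset (Fin n)) (d + 2))]
    · refine Finset.prod_congr rfl fun l _ => ?_
      split_ifs with hj
      · rw [rootProd]
        refine Finset.prod_congr ?_ fun w hw => ?_
        · ext w
          simp only [Finset.mem_filter, Finset.mem_univ, true_and]
          constructor
          · rintro rfl
            simp
          · rintro h
            rw [h]
            ext a
            by_cases ha : a = j
            · subst ha
              simp
              omega
            · simp [ha]
        · have hw := (Finset.mem_filter.1 hw).2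
          have : wordDeg w + Pi.single j 1 = l := by
            rw [hw]
            ext a
            by_cases ha : a = j
            · subst ha
              simp
              omega
            · simp [ha]
          rw [this, twistFactor]
      · refine Finset.prod_eq_one fun w hw => ?_
        rw [← (Finset.mem_filter.1 hw).2] at hj
        simp at hj
    · intro w _
      have := sum_wordDeg w
      simp [Finset.sum_add_distrib, this]
  rw [Finset.prod_congr rfl fun j _ => h j, Finset.prod_comm]
  refine Finset.prod_congr rfl fun l _ => ?_
  rw [deletionProd, Finset.prod_filter]

theorem shuffleMatrix_map {S : Type*} [CommRing S] (φ : R →+* S) (p : Fin n → Fin n → R) (d : ℕ) :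
    (shuffleMatrix p d).map φ = shuffleMatrix (fun i j => φ (p i j)) d := by
  induction d with
  | zero => ext; simp [shuffleMatrix]
  | succ d ih =>
    ext w v
    have := congrFun (congrFun ih (Fin.tail w)) (Fin.tail v)
    simp only [Matrix.map_apply] at this
    simp only [Matrix.map_apply, shuffleMatrix, Matrix.of_apply, map_add, wordChar]
    congr 1
    · split_ifs <;> simp [this]
    · split_ifs <;> simp

theorem det_shuffleMatrix_recursion {K : Type*} [Field K]
    (φ : MvPolynomial (Fin n × Fin n) ℤ →+* K) (d : ℕ) :
    ∃ A B : (Fin n → ℕ) → K,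
      (shuffleMatrix (fun i j => φ (pVar i j)) (d + 2)).det ^ ((d + 1) * (d + 2)) *
        ∏ l ∈ Finset.piAntidiag (Finset.univ : Finset (Fin n)) (d + 2), B l =
      (shuffleMatrix (fun i j => φ (pVar i j)) (d + 1)).det ^ (n * ((d + 1) * (d + 2))) *
        ∏ l ∈ Finset.piAntidiag (Finset.univ : Finset (Fin n)) (d + 2), A l ∧
      (∀ l ∈ Finset.piAntidiag (Finset.univ : Finset (Fin n)) (d + 2),
        (A l = 0 ↔ φ (nicholsP l) = 0)) ∧
      ∀ l ∈ Finset.piAntidiag (Finset.univ : Finset (Fin n)) (d + 2),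
        B l = 0 → ∃ i, φ (qNumber (d + 1) (pVar i i)) = 0 := by
  classical
  have hsum : ∀ l ∈ Finset.piAntidiag (Finset.univ : Finset (Fin n)) (d + 2),
      ∑ a, l a = d + 2 := fun l hl => (Finset.mem_piAntidiag.1 hl).1
  have hex : ∀ l : Fin n → ℕ, ∃ A B, ∑ a, l a = d + 2 →
      deletionProd (twistFactor (pVar (n := n)) l) (d + 1) l ^ (d + 2) * B =
        A * rootProd (twistFactor (pVar (n := n)) l) (d + 2) l ^ (d + 1) ∧
      (φ A = 0 ↔ φ (nicholsP l) = 0) ∧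
      (φ B = 0 → ∃ i, φ (qNumber (d + 1) (pVar i i)) = 0) := by
    intro l
    by_cases hl : ∑ a, l a = d + 2
    · obtain ⟨A, B, h⟩ := exists_ratio φ hl
      exact ⟨A, B, fun _ => h⟩
    · exact ⟨0, 0, fun h => absurd h hl⟩
  choose A B hAB using hex
  refine ⟨fun l => φ (A l), fun l => φ (B l), ?_, fun l hl => (hAB l (hsum l hl)).2.1,
    fun l hl => (hAB l (hsum l hl)).2.2⟩
  -- The two rotation determinants are known as products after raising them to the powers d + 2 and
  -- d + 1; this is a common exponent.
  have hdet := congrArg (fun x => x ^ ((d + 1) * (d + 2)))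
    (det_shuffleMatrix_succ (pVar (n := n)) d)
  simp only [mul_pow] at hdet
  rw [mul_comm (d + 1) (d + 2), pow_mul (Matrix.det _) (d + 2) (d + 1),
    det_one_sub_rotationMatrix_pow_eq_prod, mul_comm (d + 2) (d + 1),
    pow_mul (∏ j, _) (d + 1) (d + 2), prod_det_one_sub_twistedWeight_pow_eq_prod,
    ← Finset.prod_pow, ← Finset.prod_pow] at hdet
  have hprod : (∏ l ∈ Finset.piAntidiag (Finset.univ : Finset (Fin n)) (d + 2),
      deletionProd (twistFactor (pVar (n := n)) l) (d + 1) l ^ (d + 2)) *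
      ∏ l ∈ Finset.piAntidiag (Finset.univ : Finset (Fin n)) (d + 2), B l =
      (∏ l ∈ Finset.piAntidiag (Finset.univ : Finset (Fin n)) (d + 2), A l) *
      ∏ l ∈ Finset.piAntidiag (Finset.univ : Finset (Fin n)) (d + 2),
        rootProd (twistFactor (pVar (n := n)) l) (d + 2) l ^ (d + 1) := by
    rw [← Finset.prod_mul_distrib, ← Finset.prod_mul_distrib]
    exact Finset.prod_congr rfl fun l hl => (hAB l (hsum l hl)).1
  have hne : (∏ l ∈ Finset.piAntidiag (Finset.univ : Finset (Fin n)) (d + 2),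
        rootProd (twistFactor (pVar (n := n)) l) (d + 2) l ^ (d + 1)) ≠ 0 :=
    Finset.prod_ne_zero_iff.2 fun l hl => pow_ne_zero _ (rootProd_ne_zero (hsum l hl))
  have key : (shuffleMatrix (pVar (n := n)) (d + 2)).det ^ ((d + 1) * (d + 2)) *
        ∏ l ∈ Finset.piAntidiag (Finset.univ : Finset (Fin n)) (d + 2), B l =
      (shuffleMatrix (pVar (n := n)) (d + 1)).det ^ (n * ((d + 1) * (d + 2))) *
        ∏ l ∈ Finset.piAntidiag (Finset.univ : Finset (Fin n)) (d + 2), A l := by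
    refine mul_left_cancel₀ hne ?_
    rw [← mul_assoc, hdet, ← pow_mul, mul_assoc, hprod]
    ring
  have := congrArg φ key
  simpa only [map_mul, map_pow, map_prod, RingHom.map_det, RingHom.mapMatrix_apply,
    shuffleMatrix_map] using this

/-- The determinants of all `shuffleMatrix` are nonzero if and only if no `P_m` vanishes. -/
theorem forall_det_shuffleMatrix_ne_zero_iff {K : Type*} [Field K]
    (φ : MvPolynomial (Fin n × Fin n) ℤ →+* K) :
    (∀ d, (shuffleMatrix (fun i j => φ (pVar i j)) (d + 1)).det ≠ 0) ↔
      ∀ m : Fin n → ℕ, 2 ≤ ∑ i, m i → φ (nicholsP m) ≠ 0 := by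
  constructor
  · intro h
    -- If the denominators (d+1)_q do not vanish, no P of degree d + 2 does. Its one-letter cases
    -- give (d+2)_q ≠ 0, the hypothesis needed in the next degree, whence the induction in `hq`.
    have step : ∀ d, (∀ i : Fin n, φ (qNumber (d + 1) (pVar i i)) ≠ 0) →
        ∀ m : Fin n → ℕ, ∑ i, m i = d + 2 → φ (nicholsP m) ≠ 0 := by
      intro d hd m hm
      obtain ⟨A, B, hAB, hA, hB⟩ := det_shuffleMatrix_recursion φ d
      have hBne : ∏ l ∈ Finset.piAntidiag (Finset.univ : Finset (Fin n)) (d + 2), B l ≠ 0 :=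
        Finset.prod_ne_zero_iff.2 fun l hl h0 => by
          obtain ⟨i, hi⟩ := hB l hl h0
          exact hd i hi
      have hAne := right_ne_zero_of_mul (hAB ▸ mul_ne_zero (pow_ne_zero _ (h (d + 1))) hBne)
      have hmem : m ∈ Finset.piAntidiag (Finset.univ : Finset (Fin n)) (d + 2) := by
        simpa using hm
      exact fun h0 => Finset.prod_ne_zero_iff.1 hAne m hmem ((hA m hmem).2 h0)
    have hq : ∀ d, ∀ i : Fin n, φ (qNumber (d + 1) (pVar i i)) ≠ 0 := by
      intro d
      induction d with
      | zero => simp [qNumber]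
      | succ d ih =>
        intro i
        have := step d ih (Pi.single i (d + 2)) (by simp)
        rwa [nicholsP_single i (by omega)] at this
    intro m hm
    obtain ⟨d, hd⟩ := Nat.exists_eq_add_of_le' hm
    exact step d (hq d) m hd
  · intro h d
    induction d with
    | zero => simp [shuffleMatrix_one]
    | succ d ih =>
      obtain ⟨A, B, hAB, hA, -⟩ := det_shuffleMatrix_recursion φ d
      intro h0
      rw [h0, zero_pow (by positivity), zero_mul] at hAB
      refine mul_ne_zero (pow_ne_zero _ ih) (Finset.prod_ne_zero_iff.2 fun l hl h1 => ?_) hAB.symm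
      exact h l (by rw [(Finset.mem_piAntidiag.1 hl).1]; omega) ((hA l hl).1 h1)

end Determinants

/-! ### Skew derivations of the tensor algebra -/

section SkewDerivations

variable {K V : Type*} [Field K] [AddCommGroup V] [Module K V] {n : ℕ}
  {c : V ⊗[K] V →ₗ[K] V ⊗[K] V} (x : Module.Basis (Fin n) K V) {q : Matrix (Fin n) (Fin n) K}

/-- The braiding and the coproduct are defined by recursion on left multiplication by vectors, so
this is the induction that unfolds them. -/
theorem tensorAlgebra_left_induction {P : TensorAlgebra K V → Prop} (one : P 1)
    (mul : ∀ i s, P s → P (TensorAlgebra.ι K (x i) * s))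
    (add : ∀ s t, P s → P t → P (s + t)) (smul : ∀ (a : K) s, P s → P (a • s))
    (t : TensorAlgebra K V) : P t := by
  have key : ∀ t s, P s → P (t * s) := by
    intro t
    induction t using TensorAlgebra.induction with
    | algebraMap r =>
      intro s hs
      rw [← Algebra.smul_def]
      exact smul r s hs
    | ι v =>
      intro s hs
      rw [← x.sum_repr v, map_sum, Finset.sum_mul]
      refine Finset.sum_induction _ P add (by simpa using smul 0 s hs) fun i _ => ?_
      rw [map_smul, smul_mul_assoc]
      exact smul _ _ (mul i s hs)
    | mul a b ha hb =>
      intro s hs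
      rw [mul_assoc]
      exact ha _ (hb _ hs)
    | add a b ha hb =>
      intro s hs
      rw [add_mul]
      exact add _ _ (ha s hs) (hb s hs)
  simpa using key t 1 one

theorem linearMap_ext_left {M : Type*} [AddCommGroup M] [Module K M]
    {F G : TensorAlgebra K V →ₗ[K] M} (one : F 1 = G 1)
    (mul : ∀ i s, F s = G s → F (TensorAlgebra.ι K (x i) * s) = G (TensorAlgebra.ι K (x i) * s)) :
    F = G := by
  ext t
  refine tensorAlgebra_left_induction x one mul (fun s t hs ht => ?_) (fun a s hs => ?_) t
  · rw [map_add, map_add, hs, ht]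
  · rw [map_smul, map_smul, hs]

/-- The automorphism `x j ↦ q i j • x j` of the tensor algebra. -/
noncomputable def braidingChar (q : Matrix (Fin n) (Fin n) K) (i : Fin n) :
    TensorAlgebra K V →ₐ[K] TensorAlgebra K V :=
  TensorAlgebra.lift K (x.constr K fun j => q i j • TensorAlgebra.ι K (x j))

@[simp]
theorem braidingChar_ι (i j : Fin n) :
    braidingChar x q i (TensorAlgebra.ι K (x j)) = q i j • TensorAlgebra.ι K (x j) := by
  simp [braidingChar]

theorem braidingChar_comm (i j : Fin n) (t : TensorAlgebra K V) :
    braidingChar x q i (braidingChar x q j t) = braidingChar x q j (braidingChar x q i t) := by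
  have h : (braidingChar x q i).toLinearMap ∘ₗ (braidingChar x q j).toLinearMap =
      (braidingChar x q j).toLinearMap ∘ₗ (braidingChar x q i).toLinearMap := by
    refine linearMap_ext_left x (by simp) fun k s hs => ?_
    simp only [LinearMap.comp_apply, AlgHom.toLinearMap_apply] at hs
    simp [hs, smul_smul, mul_comm]
  exact congrArg (fun f => f t) h

variable {x}

theorem braidingExt_one (v : V) : braidingExt c v 1 = 1 ⊗ₜ v := by
  simp [braidingExt]

theorem braidingStep_apply (w v : V) (f : V →ₗ[K] TensorAlgebra K V ⊗[K] V) :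
    braidingStep c w f v =
      tensorLeftMul K V (TensorProduct.map (TensorAlgebra.ι K) f (c (v ⊗ₜ w))) := rfl

theorem tensorLeftMul_tmul (s t : TensorAlgebra K V) (v : V) :
    tensorLeftMul K V (s ⊗ₜ (t ⊗ₜ v)) = (s * t) ⊗ₜ v := by
  simp [tensorLeftMul]

theorem braidingExt_apply (hc : IsDiagonalBraiding c x q) (i : Fin n) (t : TensorAlgebra K V) :
    braidingExt c (x i) t = braidingChar x q i t ⊗ₜ x i := by
  have h : braidingExt c (x i) = (TensorProduct.mk K _ V).flip (x i) ∘ₗ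
      (braidingChar x q i).toLinearMap := by
    refine linearMap_ext_left x (by simp [braidingExt_one]) fun j s hs => ?_
    have hs' : ((TensorAlgebra.lift K (braidingStep c)) s)
        ((TensorProduct.mk K (TensorAlgebra K V) V) 1) (x i) = braidingChar x q i s ⊗ₜ x i := by
      simpa [braidingExt] using hs
    simp [braidingExt, braidingStep_apply, hc.braiding, hs', tensorLeftMul_tmul,
      TensorProduct.smul_tmul']
  rw [h]
  simp

theorem primitiveMul_tmul (hc : IsDiagonalBraiding c x q) (i : Fin n) (a b : TensorAlgebra K V) :
    primitiveMul c (x i) (a ⊗ₜ b) = (TensorAlgebra.ι K (x i) * a) ⊗ₜ b +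
      braidingChar x q i a ⊗ₜ (TensorAlgebra.ι K (x i) * b) := by
  simp [primitiveMul, braidingExt_apply hc]

theorem braidedComul_one : braidedComul c 1 = 1 ⊗ₜ 1 := by
  simp [braidedComul]

theorem braidedComul_ι_mul (v : V) (t : TensorAlgebra K V) :
    braidedComul c (TensorAlgebra.ι K v * t) = primitiveMul c v (braidedComul c t) := by
  simp [braidedComul, primitiveMulₗ]

theorem braidedComul_braidingChar (hc : IsDiagonalBraiding c x q) (k : Fin n)
    (t : TensorAlgebra K V) : braidedComul c (braidingChar x q k t) =
      TensorProduct.map (braidingChar x q k).toLinearMap (braidingChar x q k).toLinearMap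
        (braidedComul c t) := by
  have h : braidedComul c ∘ₗ (braidingChar x q k).toLinearMap =
      TensorProduct.map (braidingChar x q k).toLinearMap (braidingChar x q k).toLinearMap ∘ₗ
        braidedComul c := by
    refine linearMap_ext_left x (by simp [braidedComul_one]) fun i s hs => ?_
    simp only [LinearMap.comp_apply, AlgHom.toLinearMap_apply] at hs ⊢
    rw [map_mul, braidingChar_ι, smul_mul_assoc, map_smul, braidedComul_ι_mul,
      braidedComul_ι_mul, hs]
    induction braidedComul c s using TensorProduct.induction_on with
    | zero => simp
    | tmul a b =>
      simp [primitiveMul_tmul hc, braidingChar_comm x k i, TensorProduct.smul_tmul',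
        TensorProduct.tmul_smul]
    | add a b ha hb => simp only [map_add, smul_add, ha, hb]
  exact congrArg (fun f => f t) h

/-- The augmentation of the tensor algebra. -/
noncomputable def augmentation (K V : Type*) [Field K] [AddCommGroup V] [Module K V] :
    TensorAlgebra K V →ₐ[K] K :=
  TensorAlgebra.algebraMapInv

@[simp]
theorem augmentation_ι (v : V) : augmentation K V (TensorAlgebra.ι K v) = 0 := by
  simp [augmentation, TensorAlgebra.algebraMapInv]

variable (x) in
/-- The coefficient of `x j`, as a linear form on the tensor algebra. -/
noncomputable def linearCoeff (j : Fin n) : TensorAlgebra K V →ₗ[K] K :=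
  x.coord j ∘ₗ TensorAlgebra.ιInv

@[simp]
theorem linearCoeff_one (j : Fin n) : linearCoeff x j 1 = 0 := by
  -- The right module structure used inside the definition of `TensorAlgebra.ιInv`.
  let : Module Kᵐᵒᵖ V := Module.compHom _ ((RingHom.id K).fromOpposite mul_comm)
  have : IsCentralScalar K V := ⟨fun r m => rfl⟩
  simp [linearCoeff, TensorAlgebra.ιInv]

@[simp]
theorem linearCoeff_ι_mul (i j : Fin n) (t : TensorAlgebra K V) :
    linearCoeff x j (TensorAlgebra.ι K (x i) * t) =
      if i = j then augmentation K V t else 0 := by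
  let : Module Kᵐᵒᵖ V := Module.compHom _ ((RingHom.id K).fromOpposite mul_comm)
  have : IsCentralScalar K V := ⟨fun r m => rfl⟩
  have h : (TrivSqZeroExt.fstHom K K V).comp TensorAlgebra.toTrivSqZeroExt =
      augmentation K V := by
    ext v
    simp
  have h2 : TrivSqZeroExt.fst (TensorAlgebra.toTrivSqZeroExt t) = augmentation K V t :=
    congrArg (fun f => f t) h
  simp [linearCoeff, TensorAlgebra.ιInv, h2, Finsupp.single_apply]

variable (c x) in
/-- The skew derivation of the tensor algebra with respect to `x j`. -/
noncomputable def skewDer (j : Fin n) : TensorAlgebra K V →ₗ[K] TensorAlgebra K V :=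
  TensorProduct.rid K (TensorAlgebra K V) ∘ₗ (linearCoeff x j).lTensor (TensorAlgebra K V) ∘ₗ
    braidedComul c

@[simp]
theorem skewDer_one (j : Fin n) : skewDer c x j 1 = 0 := by
  simp [skewDer, braidedComul_one]

theorem rid_lTensor_augmentation_braidedComul (hc : IsDiagonalBraiding c x q)
    (t : TensorAlgebra K V) : TensorProduct.rid K (TensorAlgebra K V)
      ((augmentation K V).toLinearMap.lTensor (TensorAlgebra K V) (braidedComul c t)) = t := by
  have h : (TensorProduct.rid K (TensorAlgebra K V)).toLinearMap ∘ₗ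
      (augmentation K V).toLinearMap.lTensor (TensorAlgebra K V) ∘ₗ braidedComul c =
        LinearMap.id := by
    refine linearMap_ext_left x (by simp [braidedComul_one]) fun i s hs => ?_
    rw [LinearMap.id_apply] at hs ⊢
    conv_rhs => rw [← hs]
    simp only [LinearMap.comp_apply, braidedComul_ι_mul]
    induction braidedComul c s using TensorProduct.induction_on with
    | zero => simp
    | tmul a b => simp [primitiveMul_tmul hc]
    | add a b ha hb => simp only [map_add, mul_add, ha, hb]
  exact congrArg (fun f => f t) h

theorem skewDer_ι_mul (hc : IsDiagonalBraiding c x q) (i j : Fin n) (t : TensorAlgebra K V) :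
    skewDer c x j (TensorAlgebra.ι K (x i) * t) =
      TensorAlgebra.ι K (x i) * skewDer c x j t +
        if i = j then braidingChar x q i t else 0 := by
  simp only [skewDer, LinearMap.comp_apply, braidedComul_ι_mul]
  conv_rhs => enter [2]; rw [← rid_lTensor_augmentation_braidedComul hc t]
  induction braidedComul c t using TensorProduct.induction_on with
  | zero => simp
  | tmul a b =>
    simp [primitiveMul_tmul hc]
  | add a b ha hb =>
    simp only [map_add, mul_add, ha, hb]
    split_ifs <;> abel

theorem skewDer_mul (hc : IsDiagonalBraiding c x q) (j : Fin n) (s t : TensorAlgebra K V) :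
    skewDer c x j (s * t) = s * skewDer c x j t + skewDer c x j s * braidingChar x q j t := by
  refine tensorAlgebra_left_induction x (P := fun s => skewDer c x j (s * t) =
    s * skewDer c x j t + skewDer c x j s * braidingChar x q j t) ?_ (fun i s hs => ?_)
    (fun s s' hs hs' => ?_) (fun a s hs => ?_) s
  · simp
  · rw [mul_assoc, skewDer_ι_mul hc, skewDer_ι_mul hc, hs]
    split_ifs with h
    · subst h
      simp [mul_add, add_mul, mul_assoc, add_assoc]
    · simp [mul_add, mul_assoc]
  · simp only [add_mul, map_add, hs, hs']
    abel
  · simp only [smul_mul_assoc, map_smul, hs, smul_add]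

theorem skewDer_braidingChar (hc : IsDiagonalBraiding c x q) (i j : Fin n)
    (t : TensorAlgebra K V) : skewDer c x j (braidingChar x q i t) =
      q i j • braidingChar x q i (skewDer c x j t) := by
  have h : skewDer c x j ∘ₗ (braidingChar x q i).toLinearMap =
      q i j • (braidingChar x q i).toLinearMap ∘ₗ skewDer c x j := by
    refine linearMap_ext_left x (by simp) fun k s hs => ?_
    simp only [LinearMap.comp_apply, AlgHom.toLinearMap_apply, LinearMap.smul_apply] at hs ⊢
    rw [map_mul, braidingChar_ι, smul_mul_assoc, map_smul, skewDer_ι_mul hc, skewDer_ι_mul hc, hs]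
    split_ifs with h
    · subst h
      simp only [map_add, map_mul, braidingChar_ι, smul_add, braidingChar_comm x i k,
        mul_smul_comm, smul_mul_assoc]
    · simp only [add_zero, map_mul, braidingChar_ι, mul_smul_comm, smul_mul_assoc]
      rw [smul_comm]
  exact congrArg (fun f => f t) h

/-- The part of coassociativity that the argument needs, obtained directly by left induction. -/
theorem lTensor_skewDer_braidedComul (hc : IsDiagonalBraiding c x q) (j : Fin n)
    (t : TensorAlgebra K V) : (skewDer c x j).lTensor (TensorAlgebra K V) (braidedComul c t) =
      braidedComul c (skewDer c x j t) := by
  have h : (skewDer c x j).lTensor (TensorAlgebra K V) ∘ₗ braidedComul c =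
      braidedComul c ∘ₗ skewDer c x j := by
    refine linearMap_ext_left x (by simp [braidedComul_one]) fun i s hs => ?_
    simp only [LinearMap.comp_apply] at hs ⊢
    rw [skewDer_ι_mul hc, braidedComul_ι_mul, map_add, braidedComul_ι_mul, ← hs]
    have h2 : braidedComul c (if i = j then braidingChar x q i s else 0) =
        if i = j then TensorProduct.map (braidingChar x q i).toLinearMap
          (braidingChar x q i).toLinearMap (braidedComul c s) else 0 := by
      split_ifs
      · exact braidedComul_braidingChar hc i s
      · simp
    rw [h2]
    induction braidedComul c s using TensorProduct.induction_on with
    | zero => simp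
    | tmul a b =>
      simp only [primitiveMul_tmul hc, map_add, LinearMap.lTensor_tmul, skewDer_ι_mul hc]
      split_ifs with h <;> simp [TensorProduct.tmul_add, add_assoc]
    | add a b ha hb =>
      simp only [map_add, ha, hb]
      split_ifs <;> abel
  exact congrArg (fun f => f t) h

theorem augmentation_skewDer (hc : IsDiagonalBraiding c x q) (j : Fin n)
    (t : TensorAlgebra K V) : augmentation K V (skewDer c x j t) = linearCoeff x j t := by
  have hg : ∀ i t, augmentation K V (braidingChar x q i t) = augmentation K V t := by
    intro i t
    have : ((augmentation K V).comp (braidingChar x q i)) = augmentation K V := by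
      refine TensorAlgebra.hom_ext (x.ext fun k => ?_)
      simp
    exact congrArg (fun f => f t) this
  have h : (augmentation K V).toLinearMap ∘ₗ skewDer c x j = linearCoeff x j := by
    refine linearMap_ext_left x (by simp) fun i s _ => ?_
    simp only [LinearMap.comp_apply, AlgHom.toLinearMap_apply, skewDer_ι_mul hc, map_add, map_mul,
      augmentation_ι, zero_mul, zero_add, linearCoeff_ι_mul]
    split_ifs <;> simp [hg]
  exact congrArg (fun f => f t) h

end SkewDerivations

/-! ### Homogeneous components and words -/

section Components

variable {K V : Type*} [Field K] [AddCommGroup V] [Module K V] {n : ℕ}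
  {c : V ⊗[K] V →ₗ[K] V ⊗[K] V} {x : Module.Basis (Fin n) K V} {q : Matrix (Fin n) (Fin n) K}

theorem ι_mem_range_pow_one (v : V) :
    TensorAlgebra.ι K v ∈ LinearMap.range (TensorAlgebra.ι K : V →ₗ[K] _) ^ 1 := by
  simp

theorem tensorComponent_add (d : ℕ) (s t : TensorAlgebra K V) :
    tensorComponent d (s + t) = tensorComponent d s + tensorComponent d t := by
  simp [tensorComponent, DirectSum.decompose_add]

theorem tensorComponent_smul (d : ℕ) (a : K) (t : TensorAlgebra K V) :
    tensorComponent d (a • t) = a • tensorComponent d t := by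
  simp only [tensorComponent, DirectSum.decompose_smul]
  rfl

/-- The projection of the tensor algebra to its homogeneous component of degree `d`. -/
noncomputable def componentMap (K V : Type*) [Field K] [AddCommGroup V] [Module K V] (d : ℕ) :
    TensorAlgebra K V →ₗ[K] TensorAlgebra K V where
  toFun := tensorComponent d
  map_add' := tensorComponent_add d
  map_smul' := tensorComponent_smul d

theorem componentMap_zero_one : componentMap K V 0 1 = 1 :=
  DirectSum.decompose_of_mem_same _ SetLike.GradedOne.one_mem

theorem componentMap_succ_one (d : ℕ) : componentMap K V (d + 1) 1 = 0 :=
  DirectSum.decompose_of_mem_ne _ SetLike.GradedOne.one_mem (by omega)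

theorem componentMap_zero_ι_mul (v : V) (t : TensorAlgebra K V) :
    componentMap K V 0 (TensorAlgebra.ι K v * t) = 0 :=
  DirectSum.coe_decompose_mul_of_left_mem_of_not_le _ (ι_mem_range_pow_one v) (by omega)

theorem componentMap_succ_ι_mul (d : ℕ) (v : V) (t : TensorAlgebra K V) :
    componentMap K V (d + 1) (TensorAlgebra.ι K v * t) =
      TensorAlgebra.ι K v * componentMap K V d t := by
  rw [add_comm]
  exact DirectSum.coe_decompose_mul_add_of_left_mem _ (ι_mem_range_pow_one v)

theorem eq_zero_of_componentMap_eq_zero {t : TensorAlgebra K V}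
    (h : ∀ d, componentMap K V d t = 0) : t = 0 := by
  apply (DirectSum.decompose
    fun k : ℕ => LinearMap.range (TensorAlgebra.ι K : V →ₗ[K] _) ^ k).injective
  rw [DirectSum.decompose_zero]
  ext d
  exact h d

theorem componentMap_braidingChar (i : Fin n) (d : ℕ) (t : TensorAlgebra K V) :
    componentMap K V d (braidingChar x q i t) = braidingChar x q i (componentMap K V d t) := by
  suffices h : ∀ d, componentMap K V d (braidingChar x q i t) =
      braidingChar x q i (componentMap K V d t) from h d
  refine tensorAlgebra_left_induction x (P := fun t => ∀ d,
    componentMap K V d (braidingChar x q i t) = braidingChar x q i (componentMap K V d t))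
    (fun d => ?_) (fun j s hs d => ?_) (fun s t hs ht d => ?_) (fun a s hs d => ?_) t
  · cases d <;> simp [componentMap_zero_one, componentMap_succ_one]
  · cases d <;> simp [componentMap_zero_ι_mul, componentMap_succ_ι_mul, hs]
  · simp [hs, ht]
  · simp [hs]

theorem componentMap_skewDer (hc : IsDiagonalBraiding c x q) (j : Fin n) (d : ℕ)
    (t : TensorAlgebra K V) :
    componentMap K V d (skewDer c x j t) = skewDer c x j (componentMap K V (d + 1) t) := by
  suffices h : ∀ d, componentMap K V d (skewDer c x j t) =
      skewDer c x j (componentMap K V (d + 1) t) from h d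
  refine tensorAlgebra_left_induction x (P := fun t => ∀ d,
    componentMap K V d (skewDer c x j t) = skewDer c x j (componentMap K V (d + 1) t))
    (fun d => ?_) (fun i s hs d => ?_) (fun s t hs ht d => ?_) (fun a s hs d => ?_) t
  · simp [componentMap_succ_one]
  · rw [skewDer_ι_mul hc, map_add, componentMap_succ_ι_mul, skewDer_ι_mul hc]
    congr 1
    · cases d with
      | zero =>
        rw [componentMap_zero_ι_mul]
        have : skewDer c x j (componentMap K V 0 s) = 0 := by
          refine tensorAlgebra_left_induction x
            (P := fun s => skewDer c x j (componentMap K V 0 s) = 0) ?_ (fun k s _ => ?_)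
            (fun s t hs ht => ?_) (fun a s hs => ?_) s
          · rw [componentMap_zero_one, skewDer_one]
          · rw [componentMap_zero_ι_mul, map_zero]
          · rw [map_add, map_add, hs, ht, add_zero]
          · rw [map_smul, map_smul, hs, smul_zero]
        rw [this, mul_zero]
      | succ d => rw [componentMap_succ_ι_mul, hs]
    · split_ifs
      · exact componentMap_braidingChar i d s
      · simp
  · simp [hs, ht]
  · simp [hs]

theorem componentMap_zero_apply (x : Module.Basis (Fin n) K V) (t : TensorAlgebra K V) :
    componentMap K V 0 t = algebraMap K _ (augmentation K V t) := by
  have h : componentMap K V 0 = Algebra.linearMap K _ ∘ₗ (augmentation K V).toLinearMap :=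
    linearMap_ext_left x (by simp [componentMap_zero_one])
      fun i s _ => by simp [componentMap_zero_ι_mul]
  exact congrArg (fun f => f t) h

theorem componentMap_one_apply (x : Module.Basis (Fin n) K V) (t : TensorAlgebra K V) :
    componentMap K V 1 t = ∑ j, linearCoeff x j t • TensorAlgebra.ι K (x j) := by
  refine tensorAlgebra_left_induction x (P := fun t => componentMap K V 1 t =
    ∑ j, linearCoeff x j t • TensorAlgebra.ι K (x j)) ?_ (fun i s _ => ?_)
    (fun s t hs ht => ?_) (fun a s hs => ?_) t
  · simpa using componentMap_succ_one 0
  · rw [componentMap_succ_ι_mul 0, componentMap_zero_apply x, ← Algebra.commutes,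
      ← Algebra.smul_def]
    simp [ite_smul]
  · simp only [map_add, hs, ht, add_smul, Finset.sum_add_distrib]
  · simp only [map_smul, hs, Finset.smul_sum, smul_smul, smul_eq_mul]

theorem linearCoeff_componentMap_one (j : Fin n) (t : TensorAlgebra K V) :
    linearCoeff x j (componentMap K V 1 t) = linearCoeff x j t := by
  have h : ∀ i, linearCoeff x j (TensorAlgebra.ι K (x i)) = if i = j then 1 else 0 := by
    intro i
    have := linearCoeff_ι_mul (x := x) i j 1
    rwa [mul_one, map_one] at this
  rw [componentMap_one_apply x, map_sum]
  simp [h]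

variable (x) in
/-- The product of the letters of the word `w` in the tensor algebra. -/
noncomputable def tensorWord {d : ℕ} (w : Fin d → Fin n) : TensorAlgebra K V :=
  (List.ofFn fun k => TensorAlgebra.ι K (x (w k))).prod

theorem tensorWord_cons {d : ℕ} (i : Fin n) (w : Fin d → Fin n) :
    tensorWord x (Fin.cons i w : Fin (d + 1) → Fin n) =
      TensorAlgebra.ι K (x i) * tensorWord x w := by
  simp [tensorWord, List.ofFn_succ]

theorem tensorWord_snoc {d : ℕ} (i : Fin n) (w : Fin d → Fin n) :
    tensorWord x (Fin.snoc w i : Fin (d + 1) → Fin n) =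
      tensorWord x w * TensorAlgebra.ι K (x i) := by
  rw [tensorWord, List.ofFn_succ']
  simp [tensorWord, List.concat_eq_append]

theorem linearIndependent_tensorWord (d : ℕ) :
    LinearIndependent K (tensorWord x : (Fin d → Fin n) → TensorAlgebra K V) := by
  have h : (tensorWord x : (Fin d → Fin n) → TensorAlgebra K V) =
      x.tensorAlgebra ∘ fun w => FreeMonoid.ofList (List.ofFn w) := by
    ext w
    simp [tensorWord, Module.Basis.tensorAlgebra, FreeAlgebra.basisFreeMonoid,
      FreeAlgebra.equivMonoidAlgebraFreeMonoid, FreeMonoid.lift_apply, map_list_prod,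
      List.map_ofFn, Function.comp_def]
  rw [h]
  exact x.tensorAlgebra.linearIndependent.comp _ fun v w hvw => by
    simpa using List.ofFn_injective (FreeMonoid.ofList.injective hvw)

variable (x) in
/-- The homogeneous element with the coefficients `a`. -/
noncomputable def ofCoeff (d : ℕ) : ((Fin d → Fin n) → K) →ₗ[K] TensorAlgebra K V :=
  Fintype.linearCombination K (tensorWord x)

theorem ofCoeff_apply {d : ℕ} (a : (Fin d → Fin n) → K) :
    ofCoeff x d a = ∑ w, a w • tensorWord x w := by
  simp [ofCoeff, Fintype.linearCombination_apply]

theorem ofCoeff_injective (d : ℕ) : Function.Injective (ofCoeff x d) :=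
  linearIndependent_iff_injective_fintypeLinearCombination.1 (linearIndependent_tensorWord d)

theorem ofCoeff_succ {d : ℕ} (a : (Fin (d + 1) → Fin n) → K) :
    ofCoeff x (d + 1) a =
      ∑ i, TensorAlgebra.ι K (x i) * ofCoeff x d fun w => a (Fin.cons i w) := by
  simp only [ofCoeff_apply, sum_cons, tensorWord_cons, Finset.mul_sum, mul_smul_comm]

theorem ofCoeff_succ_right {d : ℕ} (a : (Fin (d + 1) → Fin n) → K) :
    ofCoeff x (d + 1) a =
      ∑ i, (ofCoeff x d fun w => a (Fin.snoc w i)) * TensorAlgebra.ι K (x i) := by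
  simp only [ofCoeff_apply, sum_snoc, tensorWord_snoc, Finset.sum_mul, smul_mul_assoc]

theorem exists_ofCoeff_eq_componentMap (d : ℕ) (t : TensorAlgebra K V) :
    ∃ a, ofCoeff x d a = componentMap K V d t := by
  suffices h : ∀ d, ∃ a, ofCoeff x d a = componentMap K V d t from h d
  refine tensorAlgebra_left_induction x (P := fun t => ∀ d, ∃ a,
    ofCoeff x d a = componentMap K V d t)
    (fun d => ?_) (fun i s hs d => ?_) (fun s t hs ht d => ?_) (fun a s hs d => ?_) t
  · cases d with
    | zero => exact ⟨1, by simp [ofCoeff_apply, componentMap_zero_one, tensorWord]⟩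
    | succ d => exact ⟨0, by simp [componentMap_succ_one]⟩
  · cases d with
    | zero => exact ⟨0, by simp [componentMap_zero_ι_mul]⟩
    | succ d =>
      obtain ⟨a, ha⟩ := hs d
      refine ⟨fun w => if w 0 = i then a (Fin.tail w) else 0, ?_⟩
      rw [ofCoeff_succ, componentMap_succ_ι_mul, ← ha, Finset.sum_eq_single i]
      · simp
      · intro j _ hj
        simp [hj, ofCoeff_apply]
      · simp
  · obtain ⟨a, ha⟩ := hs d
    obtain ⟨b, hb⟩ := ht d
    exact ⟨a + b, by rw [map_add, map_add, ha, hb]⟩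
  · obtain ⟨b, hb⟩ := hs d
    exact ⟨a • b, by rw [map_smul, map_smul, hb]⟩

theorem componentMap_ofCoeff {d : ℕ} (a : (Fin d → Fin n) → K) :
    componentMap K V d (ofCoeff x d a) = ofCoeff x d a := by
  induction d with
  | zero => simp [ofCoeff_apply, tensorWord, componentMap_zero_one]
  | succ d ih => simp only [ofCoeff_succ, map_sum, componentMap_succ_ι_mul, ih]

theorem braidingChar_tensorWord (i : Fin n) {d : ℕ} (w : Fin d → Fin n) :
    braidingChar x q i (tensorWord x w) = wordChar (fun i j => q i j) i w • tensorWord x w := by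
  induction d with
  | zero => simp [tensorWord, wordChar]
  | succ d ih =>
    induction w using Fin.consCases with
    | cons a w =>
      rw [tensorWord_cons, map_mul, ih, wordChar_cons, braidingChar_ι, smul_mul_smul_comm]

/-- The skew Leibniz rule removes a letter and braids it past the later ones; right multiplication
puts it back at the end. This links the derivations with the determinants. -/
theorem sum_skewDer_tensorWord_mul (hc : IsDiagonalBraiding c x q) {d : ℕ} (w : Fin d → Fin n) :
    ∑ j, skewDer c x j (tensorWord x w) * TensorAlgebra.ι K (x j) =
      ∑ v, shuffleMatrix (fun i j => q i j) d w v • tensorWord x v := by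
  induction d with
  | zero => simp [tensorWord, shuffleMatrix]
  | succ d ih =>
    induction w using Fin.consCases with
    | cons a w =>
      simp only [tensorWord_cons, skewDer_ι_mul hc, add_mul, Finset.sum_add_distrib, mul_assoc,
        ← Finset.mul_sum, ih, shuffleMatrix, Matrix.of_apply, add_smul]
      congr 1
      · rw [sum_cons, Finset.sum_eq_single a]
        · simp [tensorWord_cons, Finset.mul_sum]
        · intro b _ hb
          simp [hb.symm]
        · simp
      · simp [ite_mul, ite_smul, rotateWord_cons, tensorWord_snoc, braidingChar_tensorWord]

theorem sum_skewDer_ofCoeff_mul (hc : IsDiagonalBraiding c x q) {d : ℕ}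
    (a : (Fin d → Fin n) → K) :
    ∑ j, skewDer c x j (ofCoeff x d a) * TensorAlgebra.ι K (x j) =
      ofCoeff x d (Matrix.vecMul a (shuffleMatrix (fun i j => q i j) d)) := by
  simp only [ofCoeff_apply, map_sum, map_smul, Finset.sum_mul, smul_mul_assoc]
  rw [Finset.sum_comm]
  simp only [← Finset.smul_sum, sum_skewDer_tensorWord_mul hc]
  simp only [Matrix.vecMul, dotProduct,
    Finset.sum_smul, Finset.smul_sum, smul_smul]
  rw [Finset.sum_comm]

/-- The sum of all ∂_j(t) x_j vanishes, and since words are independent, so does each ∂_j(t): the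
summands end in different letters. -/
theorem skewDer_ofCoeff_eq_zero (hc : IsDiagonalBraiding c x q) {d : ℕ}
    {a : (Fin (d + 1) → Fin n) → K} (h : Matrix.vecMul a (shuffleMatrix (fun i j => q i j) (d + 1)) = 0)
    (j : Fin n) : skewDer c x j (ofCoeff x (d + 1) a) = 0 := by
  have hex : ∀ j, ∃ b, ofCoeff x d b = skewDer c x j (ofCoeff x (d + 1) a) := by
    intro j
    rw [← componentMap_ofCoeff, ← componentMap_skewDer hc]
    exact exists_ofCoeff_eq_componentMap d _
  choose b hb using hex
  have h2 := sum_skewDer_ofCoeff_mul hc a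
  rw [h, map_zero] at h2
  have h3 : ofCoeff x (d + 1) (fun w => b (w (Fin.last d)) (Fin.init w)) = 0 := by
    rw [ofCoeff_succ_right, ← h2]
    exact Finset.sum_congr rfl fun j _ => by simp [← hb]
  have h4 := (map_eq_zero_iff _ (ofCoeff_injective (x := x) (d + 1))).1 h3
  rw [← hb, show b j = 0 from ?_, map_zero]
  ext w
  simpa using congrFun h4 (Fin.snoc w j)

end Components

/-! ### The defining ideal of the Nichols algebra -/

section NicholsIdeal

variable {K V : Type*} [Field K] [AddCommGroup V] [Module K V] {n : ℕ}
  {c : V ⊗[K] V →ₗ[K] V ⊗[K] V} {x : Module.Basis (Fin n) K V} {q : Matrix (Fin n) (Fin n) K}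

variable (c x) in
/-- The composition of the skew derivations with respect to the letters of a word. -/
noncomputable def skewDerWord : List (Fin n) → Module.End K (TensorAlgebra K V)
  | [] => LinearMap.id
  | j :: u => skewDerWord u ∘ₗ skewDer c x j

@[simp]
theorem skewDerWord_nil (t : TensorAlgebra K V) : skewDerWord c x [] t = t := rfl

@[simp]
theorem skewDerWord_cons (j : Fin n) (u : List (Fin n)) (t : TensorAlgebra K V) :
    skewDerWord c x (j :: u) t = skewDerWord c x u (skewDer c x j t) := rfl

variable (c x) in
/-- The elements of the tensor algebra such that no composition of skew derivations has a nonzero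
constant term. -/
def IsSkewRadical (t : TensorAlgebra K V) : Prop :=
  ∀ u, augmentation K V (skewDerWord c x u t) = 0

theorem IsSkewRadical.augmentation {t : TensorAlgebra K V} (h : IsSkewRadical c x t) :
    augmentation K V t = 0 := h []

theorem IsSkewRadical.skewDer {t : TensorAlgebra K V} (h : IsSkewRadical c x t) (j : Fin n) :
    IsSkewRadical c x (skewDer c x j t) := fun u => h (j :: u)

theorem IsSkewRadical.skewDerWord {t : TensorAlgebra K V} (h : IsSkewRadical c x t)
    (u : List (Fin n)) : IsSkewRadical c x (skewDerWord c x u t) := by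
  induction u generalizing t with
  | nil => exact h
  | cons j u ih => exact ih (h.skewDer j)

theorem IsSkewRadical.braidingChar (hc : IsDiagonalBraiding c x q) {t : TensorAlgebra K V}
    (h : IsSkewRadical c x t) (i : Fin n) : IsSkewRadical c x (braidingChar x q i t) := by
  intro u
  induction u generalizing t with
  | nil =>
    have : ((_root_.augmentation K V).comp (_root_.braidingChar x q i)) =
        _root_.augmentation K V := by
      refine TensorAlgebra.hom_ext (x.ext fun k => ?_)
      simp
    exact (congrArg (fun f => f t) this).trans h.augmentation
  | cons j u ih =>
    rw [skewDerWord_cons, skewDer_braidingChar hc, map_smul, map_smul, ih (h.skewDer j),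
      smul_zero]

theorem IsSkewRadical.mul_left (hc : IsDiagonalBraiding c x q) {t : TensorAlgebra K V}
    (h : IsSkewRadical c x t) (s : TensorAlgebra K V) : IsSkewRadical c x (s * t) := by
  intro u
  induction u generalizing s t with
  | nil => simp [h.augmentation]
  | cons j u ih =>
    rw [skewDerWord_cons, skewDer_mul hc, map_add, map_add, ih (h.skewDer j),
      ih (h.braidingChar hc j), add_zero]

theorem IsSkewRadical.mul_right (hc : IsDiagonalBraiding c x q) {t : TensorAlgebra K V}
    (h : IsSkewRadical c x t) (s : TensorAlgebra K V) : IsSkewRadical c x (t * s) := by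
  intro u
  induction u generalizing s t with
  | nil => simp [h.augmentation]
  | cons j u ih =>
    rw [skewDerWord_cons, skewDer_mul hc, map_add, map_add, ih h, ih (h.skewDer j), add_zero]

/-- Derivations commute with taking components up to a shift of the degree. Degree zero is treated
first, since there the shift has no predecessor. -/
theorem IsSkewRadical.componentMap (hc : IsDiagonalBraiding c x q) {t : TensorAlgebra K V}
    (h : IsSkewRadical c x t) (d : ℕ) : IsSkewRadical c x (componentMap K V d t) := by
  have h0 : _root_.componentMap K V 0 t = 0 := by
    rw [componentMap_zero_apply x, h.augmentation, map_zero]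
  cases d with
  | zero =>
    intro u
    simp [h0]
  | succ d =>
    intro u
    induction u generalizing d t with
    | nil =>
      have : ∀ t, _root_.augmentation K V (_root_.componentMap K V (d + 1) t) = 0 := by
        intro t
        refine tensorAlgebra_left_induction x (P := fun t => _root_.augmentation K V
          (_root_.componentMap K V (d + 1) t) = 0) ?_ (fun i s _ => ?_) (fun s t hs ht => ?_)
          (fun a s hs => ?_) t
        · rw [componentMap_succ_one, map_zero]
        · simp [componentMap_succ_ι_mul]
        · simp [hs, ht]
        · simp [hs]
      exact this t
    | cons j u ih =>
      rw [skewDerWord_cons, ← componentMap_skewDer hc]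
      have h0 : _root_.componentMap K V 0 (_root_.skewDer c x j t) = 0 := by
        rw [componentMap_zero_apply x, (h.skewDer j).augmentation, map_zero]
      cases d with
      | zero => simp [h0]
      | succ d => exact ih (h.skewDer j) h0 d

/-- The largest ideal of the tensor algebra which is stable under all skew derivations and has no
elements with nonzero constant term. -/
noncomputable def skewRadical (hc : IsDiagonalBraiding c x q) :
    TwoSidedIdeal (TensorAlgebra K V) :=
  TwoSidedIdeal.mk' {t | IsSkewRadical c x t} (fun u => by simp)
    (fun hs ht u => by rw [map_add, map_add, hs u, ht u, add_zero])
    (fun hs u => by rw [map_neg, map_neg, hs u, neg_zero])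
    (fun ht => ht.mul_left hc _) (fun ht => ht.mul_right hc _)

theorem mem_skewRadical (hc : IsDiagonalBraiding c x q) {t : TensorAlgebra K V} :
    t ∈ skewRadical hc ↔ IsSkewRadical c x t :=
  TwoSidedIdeal.mem_mk' _ _ _ _ _ _ _

theorem mem_toSubspace {I : TwoSidedIdeal (TensorAlgebra K V)} {t : TensorAlgebra K V} :
    t ∈ I.toSubspace ↔ t ∈ I := by
  simp [TwoSidedIdeal.toSubspace, TwoSidedIdeal.mem_asIdeal]

/-- The forms ε ∘ ∂_u, applied to the second tensor factor of Δ(t), recover ∂_u(t); the coideal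
property can therefore be tested on that factor alone. -/
theorem rid_lTensor_skewDerWord_braidedComul (hc : IsDiagonalBraiding c x q)
    (u : List (Fin n)) (t : TensorAlgebra K V) : TensorProduct.rid K (TensorAlgebra K V)
      (((augmentation K V).toLinearMap ∘ₗ skewDerWord c x u).lTensor (TensorAlgebra K V)
        (braidedComul c t)) = skewDerWord c x u t := by
  induction u generalizing t with
  | nil => exact rid_lTensor_augmentation_braidedComul hc t
  | cons j u ih =>
    rw [skewDerWord_cons, ← ih, ← lTensor_skewDer_braidedComul hc, ← LinearMap.lTensor_comp_apply]
    rfl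

/-- An element of `A ⊗ B` vanishes if it is annihilated by all `id ⊗ f`, for a separating family
of linear forms `f` on `B`. -/
theorem tensor_eq_zero_of_forall_lTensor {A B ι : Type*} [AddCommGroup A] [Module K A]
    [AddCommGroup B] [Module K B] {f : ι → B →ₗ[K] K} (hf : ∀ b, (∀ u, f u b = 0) → b = 0)
    {z : A ⊗[K] B} (hz : ∀ u, (f u).lTensor A z = 0) : z = 0 := by
  classical
  let e := TensorProduct.equivFinsuppOfBasisLeft (N := B) (Module.Basis.ofVectorSpace K A)
  rw [← e.map_eq_zero_iff]
  ext k
  refine hf _ fun u => ?_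
  rw [show e z k = _ from TensorProduct.equivFinsuppOfBasisLeft_apply _ z k]
  have h : ∀ z : A ⊗[K] B, f u (TensorProduct.lid K B
      (((Module.Basis.ofVectorSpace K A).coord k).rTensor B z)) =
      TensorProduct.lid K K (((Module.Basis.ofVectorSpace K A).coord k).rTensor K
        ((f u).lTensor A z)) := by
    intro z
    induction z using TensorProduct.induction_on with
    | zero => simp
    | tmul a b => simp
    | add a b ha hb => simp only [map_add, ha, hb]
  rw [h, hz, map_zero, map_zero]

/-- Let S be the radical. The kernel of T ⊗ T → T/S ⊗ T/S is S ⊗ T + T ⊗ S. The forms ε ∘ ∂_u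
separate the points of T/S by definition of S, and applied to Δ(t) they give the elements ∂_u(t) of
S, hence zero. -/
theorem isNicholsCoideal_skewRadical (hc : IsDiagonalBraiding c x q) :
    IsNicholsCoideal c (skewRadical hc) where
  homogeneous t ht d := (mem_skewRadical hc).2 (((mem_skewRadical hc).1 ht).componentMap hc d)
  two_le_degree t ht d hd := by
    have h := (mem_skewRadical hc).1 ht
    change componentMap K V d t = 0
    interval_cases d
    · rw [componentMap_zero_apply x, h.augmentation, map_zero]
    · rw [componentMap_one_apply x]
      refine Finset.sum_eq_zero fun j _ => ?_
      rw [← augmentation_skewDer hc, (h.skewDer j).augmentation, zero_smul]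
  coideal t ht := by
    have ht := (mem_skewRadical hc).1 ht
    let S := (skewRadical hc).toSubspace
    have hS : ∀ u, S ≤ LinearMap.ker ((augmentation K V).toLinearMap ∘ₗ skewDerWord c x u) :=
      fun u s hs => (mem_skewRadical hc).1 (mem_toSubspace.1 hs) u
    have hex : Function.Exact S.subtype S.mkQ := LinearMap.exact_subtype_mkQ S
    have hmap := TensorProduct.map_ker hex (Submodule.mkQ_surjective S) hex
      (Submodule.mkQ_surjective S)
    rw [sup_comm, ← hmap, LinearMap.mem_ker]
    refine tensor_eq_zero_of_forall_lTensor (f := fun u => S.liftQ _ (hS u)) ?_ fun u => ?_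
    · intro b hb
      obtain ⟨s, rfl⟩ := S.mkQ_surjective b
      simp only [Submodule.mkQ_apply, Submodule.liftQ_apply] at hb
      rw [Submodule.mkQ_apply, Submodule.Quotient.mk_eq_zero]
      exact mem_toSubspace.2 ((mem_skewRadical hc).2 hb)
    · have h : ∀ z : TensorAlgebra K V ⊗[K] TensorAlgebra K V,
          TensorProduct.rid K _ ((S.liftQ _ (hS u)).lTensor _ (TensorProduct.map S.mkQ S.mkQ z)) =
          S.mkQ (TensorProduct.rid K _ (((augmentation K V).toLinearMap ∘ₗ
            skewDerWord c x u).lTensor (TensorAlgebra K V) z)) := by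
        intro z
        induction z using TensorProduct.induction_on with
        | zero => simp
        | tmul a b => simp
        | add a b ha hb => simp only [map_add, ha, hb]
      rw [← (TensorProduct.rid K _).map_eq_zero_iff, h, rid_lTensor_skewDerWord_braidedComul hc,
        Submodule.mkQ_apply, Submodule.Quotient.mk_eq_zero]
      exact mem_toSubspace.2 ((mem_skewRadical hc).2 (ht.skewDerWord u))

/-- Apply id ⊗ (coefficient of x_j) to Δ(t). It sends I ⊗ T into I, and kills T ⊗ I because I has no
component of degree one. -/
theorem skewDer_mem_of_isNicholsCoideal {I : TwoSidedIdeal (TensorAlgebra K V)}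
    (hI : IsNicholsCoideal c I) {t : TensorAlgebra K V} (ht : t ∈ I) (j : Fin n) :
    skewDer c x j t ∈ I := by
  have hlin : ∀ s ∈ I, linearCoeff x j s = 0 := by
    intro s hs
    rw [← linearCoeff_componentMap_one, show componentMap K V 1 s = 0 from
      hI.two_le_degree s hs 1 (by omega), map_zero]
  rw [← mem_toSubspace]
  have h : LinearMap.range (I.toSubspace.subtype.rTensor (TensorAlgebra K V)) ⊔
      LinearMap.range (I.toSubspace.subtype.lTensor (TensorAlgebra K V)) ≤
      I.toSubspace.comap ((TensorProduct.rid K (TensorAlgebra K V)).toLinearMap ∘ₗ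
        (linearCoeff x j).lTensor (TensorAlgebra K V)) := by
    refine sup_le ?_ ?_
    · rintro _ ⟨z, rfl⟩
      rw [Submodule.mem_comap]
      induction z using TensorProduct.induction_on with
      | zero => simp
      | tmul a b => simpa using I.toSubspace.smul_mem _ a.2
      | add a b ha hb =>
        rw [map_add, map_add]
        exact add_mem ha hb
    · rintro _ ⟨z, rfl⟩
      rw [Submodule.mem_comap]
      induction z using TensorProduct.induction_on with
      | zero => simp
      | tmul a b => simp [hlin _ (mem_toSubspace.1 b.2)]
      | add a b ha hb =>
        rw [map_add, map_add]
        exact add_mem ha hb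
  exact h (hI.coideal t ht)

/-- By induction the derivatives of a component of degree d + 1 are components of degree d of
elements of I, hence zero; invertibility of S_{d+1} then kills the component. -/
theorem eq_bot_of_isNicholsCoideal (hc : IsDiagonalBraiding c x q)
    (hdet : ∀ d, (shuffleMatrix (fun i j => q i j) (d + 1)).det ≠ 0)
    {I : TwoSidedIdeal (TensorAlgebra K V)} (hI : IsNicholsCoideal c I) : I = ⊥ := by
  have key : ∀ d, ∀ t ∈ I, componentMap K V d t = 0 := by
    intro d
    induction d with
    | zero => exact fun t ht => hI.two_le_degree t ht 0 (by omega)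
    | succ d ih =>
      intro t ht
      obtain ⟨a, ha⟩ := exists_ofCoeff_eq_componentMap (x := x) (d + 1) t
      have h0 : ∀ j, skewDer c x j (ofCoeff x (d + 1) a) = 0 := by
        intro j
        rw [ha, ← componentMap_skewDer hc]
        exact ih _ (skewDer_mem_of_isNicholsCoideal hI ht j)
      have h1 := sum_skewDer_ofCoeff_mul hc a
      simp only [h0, zero_mul, Finset.sum_const_zero] at h1
      have h2 := (map_eq_zero_iff _ (ofCoeff_injective (x := x) (d + 1))).1 h1.symm
      rw [← ha, Matrix.eq_zero_of_vecMul_eq_zero (hdet d) h2, map_zero]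
  refine le_bot_iff.1 fun t ht => ?_
  exact (TwoSidedIdeal.mem_bot _).2 (eq_zero_of_componentMap_eq_zero fun d => key d t ht)

theorem proj_eq_zero_iff {t : TensorAlgebra K V} :
    NicholsAlgebra.proj c t = 0 ↔ t ∈ nicholsIdeal c := by
  rw [TwoSidedIdeal.mem_iff, ← RingCon.eq]
  rfl

theorem bijective_proj_iff : Function.Bijective (NicholsAlgebra.proj c) ↔ nicholsIdeal c = ⊥ := by
  have hsurj : Function.Surjective (NicholsAlgebra.proj c) := RingCon.mkₐ_surjective _
  rw [Function.Bijective, and_iff_left hsurj, injective_iff_map_eq_zero]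
  simp only [proj_eq_zero_iff]
  rw [← le_bot_iff]
  rfl

/-- A left null vector of S_{d+1} is a nonzero homogeneous element of positive degree killed by all
derivations, so it lies in the skew radical and therefore in the Nichols ideal. The converse is
`eq_bot_of_isNicholsCoideal`. -/
theorem bijective_proj_iff_forall_det (hc : IsDiagonalBraiding c x q) :
    Function.Bijective (NicholsAlgebra.proj c) ↔
      ∀ d, (shuffleMatrix (fun i j => q i j) (d + 1)).det ≠ 0 := by
  rw [bijective_proj_iff]
  constructor
  · intro hbot d hd
    obtain ⟨a, ha, ha0⟩ := Matrix.exists_vecMul_eq_zero_iff.2 hd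
    have hder := skewDer_ofCoeff_eq_zero hc ha0
    have hmem : ofCoeff x (d + 1) a ∈ skewRadical hc := by
      rw [mem_skewRadical]
      rintro (_ | ⟨j, u⟩)
      · simp [ofCoeff_succ]
      · simp [hder]
    have hle : skewRadical hc ≤ nicholsIdeal c := le_sSup (isNicholsCoideal_skewRadical hc)
    rw [hbot] at hle
    have h0 := (TwoSidedIdeal.mem_bot _).1 (hle hmem)
    exact ha ((map_eq_zero_iff _ (ofCoeff_injective (x := x) (d + 1))).1 h0)
  · intro h
    rw [nicholsIdeal, sSup_eq_bot]
    exact fun I hI => eq_bot_of_isNicholsCoideal hc h hI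

end NicholsIdeal

/-! ### Conclusion: evaluation of the determinant criterion at the braiding matrix. -/

theorem theorem4p4 {K V : Type*} [Field K] [AddCommGroup V] [Module K V] {n : ℕ}
    (c : V ⊗[K] V →ₗ[K] V ⊗[K] V) (x : Module.Basis (Fin n) K V)
    (q : Matrix (Fin n) (Fin n) K) (hc : IsDiagonalBraiding c x q) :
    Function.Bijective (NicholsAlgebra.proj c) ↔
      ∀ m : Fin n → ℕ, 2 ≤ ∑ i, m i → evalAtMatrix q (nicholsP m) ≠ 0 := by
  rw [bijective_proj_iff_forall_det hc]
  have h := forall_det_shuffleMatrix_ne_zero_iff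
    (MvPolynomial.aeval (R := ℤ) fun s : Fin n × Fin n => q s.1 s.2).toRingHom
  simpa [evalAtMatrix] using h
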